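/- Let $T$ be a complete first-order theory and work in a monster model of $T$. Let $\mathrm{Card}^*$ be the linear order obtained from the cardinals by adding a maximal element $\infty$ and replacing every limit cardinal $\kappa$ by two elements $\kappa_-<\kappa_+$; a cardinal $\kappa$ is identified with $\kappa_+$ if it is a limit cardinal. Let $p(x)$ be a partial type. An *inp-pattern of depth $\kappa$ in $p$* consists of formulas $\varphi_i(x,y_i)$, sequences $\bar a_i=(a_{ij})_{j\in\omega}$ and $k_i\in\omega$ ($i\in\kappa$) such that $\{\varphi_i(x,a_{ij})\}_{j\in\omega}$ is $k_i$-inconsistent for every $i\in\kappa$, and $p(x)\cup\{\varphi_i(x,a_{if(i)})\}_{i\in\kappa}$ is consistent for every $f:\kappa\to\omega$. An *$\mathrm{inp}^2$-pattern of depth $\kappa$ in $p$* consists of formulas $\varphi_i(x,y_i,z_i)$, mutually indiscernible sequences $\bar a_i=(a_{ij})_{j\in\omega}$ and finite tuples $b_i\subseteq\bigcup_{j<i}\bar a_j$ ($i\in\kappa$) such that $p(x)\cup\{\varphi_i(x,a_{i0},b_i)\}_{i\in\kappa}$ is consistent and $\{\varphi_i(x,a_{ij},b_i)\}_{j\in\omega}$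 is inconsistent for every $i\in\kappa$. An *$\mathrm{inp}^3$-pattern* is defined in the same way, with $b_i\subseteq\bigcup_{j\ne i}\bar a_j$ instead. The *burden* $\mathrm{bdn}(p)$ (respectively $\mathrm{bdn}^2(p)$, $\mathrm{bdn}^3(p)$) is the supremum in $\mathrm{Card}^*$ of the depths of inp-patterns (respectively $\mathrm{inp}^2$-, $\mathrm{inp}^3$-patterns) in $p$. The theory $T$ is *strong* (respectively *strong$^2$*, *strong$^3$*) if $\mathrm{bdn}(p)\le(\aleph_0)_-$ (respectively $\mathrm{bdn}^2(p)\le(\aleph_0)_-$, $\mathrm{bdn}^3(p)\le(\aleph_0)_-$) for every partial type $p$ in finitely many variables. It is *strongly$^2$ dependent* if there are no formulas $\varphi_i(x,y_i,z_i)$ (with $x$ a finite tuple), mutually indiscernible sequences $\bar a_i=(a_{ij})_{j\in\omega}$ and finite tuples $b_i\subseteq\bigcup_{j<i}\bar a_j$ ($i\in\omega$) such that $\{\varphi_i(x,a_{i0},b_i)\wedge\neg\varphi_i(x,a_{i1},b_i)\}_{i\in\omega}$ is consistent. Then: 1. For every partial type $p(x)$, $\mathrm{bdn}(p)\le\mathrm{bdn}^2(p)\le\mathrm{bdn}^3(p)$.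 2. If $T$ is strong$^3$ then it is strong$^2$, and if $T$ is strong$^2$ then it is strong. 3. $T$ is strong$^2$ if and only if it is strong$^3$. 4. $T$ is strongly$^2$ dependent if and only if it is NIP and strong$^2$. 5. If $T$ is supersimple, then it is strong$^2$. 6. There is a complete theory that is stable and strong$^2$ but not superstable. 7. There is a complete theory that is stable and strong but not strong$^2$. 8. $T$ is $\mathrm{NTP}_2$ if and only if $\mathrm{bdn}^3(p)<\infty$ for every partial type $p$ in finitely many variables. -/

import Mathlib

open FirstOrder Cardinal

universe u v w x

noncomputable section

namespace Burden

/-! ### The extended linear order of cardinals -/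

/-- The order `Card*`: every cardinal `κ` gives an element `κ₊ = (κ, true)`, every limit cardinal `κ`
gives in addition an element `κ₋ = (κ, false)` immediately below `κ₊`, and there is a new maximal
element `∞ = ⊤`. -/
def CardStar : Type (w + 1) :=
  {c : WithTop (Cardinal.{w} ×ₗ Bool) //
    ∀ κ : Cardinal.{w}, c = ((toLex (κ, false) : Cardinal.{w} ×ₗ Bool) : WithTop _) →
      Order.IsSuccLimit κ}

namespace CardStar

instance : LinearOrder CardStar.{w} :=
  inferInstanceAs (LinearOrder {c : WithTop (Cardinal.{w} ×ₗ Bool) //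
    ∀ κ : Cardinal.{w}, c = ((toLex (κ, false) : Cardinal.{w} ×ₗ Bool) : WithTop _) →
      Order.IsSuccLimit κ})

instance : WellFoundedLT CardStar.{w} :=
  inferInstanceAs (WellFoundedLT {c : WithTop (Cardinal.{w} ×ₗ Bool) //
    ∀ κ : Cardinal.{w}, c = ((toLex (κ, false) : Cardinal.{w} ×ₗ Bool) : WithTop _) →
      Order.IsSuccLimit κ})

/-- The standard embedding of the cardinals, `κ ↦ κ₊`. -/
def ofCard (κ : Cardinal.{w}) : CardStar.{w} :=
  ⟨((toLex (κ, true) : Cardinal.{w} ×ₗ Bool) : WithTop _), fun μ h => by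
    have h' := congrArg Prod.snd (congrArg ofLex (WithTop.coe_injective h))
    simp at h'⟩

/-- The element `κ₋` for a limit cardinal `κ`. -/
def below (κ : Cardinal.{w}) (hκ : Order.IsSuccLimit κ) : CardStar.{w} :=
  ⟨((toLex (κ, false) : Cardinal.{w} ×ₗ Bool) : WithTop _), fun μ h => by
    have h' := congrArg Prod.fst (congrArg ofLex (WithTop.coe_injective h))
    simp only [ofLex_toLex] at h'
    exact h' ▸ hκ⟩

/-- The element `∞`. -/
instance : OrderTop CardStar.{w} where
  top := ⟨⊤, fun _ h => absurd h (WithTop.top_ne_coe)⟩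
  le_top _ := Subtype.coe_le_coe.mp le_top

/-- The supremum of a set in `Card*`. -/
def sup (S : Set CardStar.{w}) : CardStar.{w} :=
  (wellFounded_lt (α := CardStar.{w})).min (upperBounds S) ⟨⊤, fun _ _ => le_top⟩

theorem isLUB_sup (S : Set CardStar.{w}) : IsLUB S (sup S) :=
  ⟨WellFounded.min_mem _ _ _, fun _ hc => not_lt.mp (WellFounded.not_lt_min _ _ hc)⟩

theorem ofCard_le_below_iff {κ μ : Cardinal.{w}} (hμ : Order.IsSuccLimit μ) :
    ofCard κ ≤ below μ hμ ↔ κ < μ := by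
  change (ofCard κ).1 ≤ (below μ hμ).1 ↔ _
  simp [ofCard, below, Prod.Lex.toLex_le_toLex]

theorem ofCard_le_ofCard_iff {κ μ : Cardinal.{w}} : ofCard κ ≤ ofCard μ ↔ κ ≤ μ := by
  change (ofCard κ).1 ≤ (ofCard μ).1 ↔ _
  simp only [ofCard, WithTop.coe_le_coe, Prod.Lex.toLex_le_toLex, le_refl, and_true]
  exact le_iff_lt_or_eq.symm

/-- The element `(ℵ₀)₋`. -/
def belowAleph0 : CardStar.{w} := below ℵ₀ Cardinal.isSuccLimit_aleph0

end CardStar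

/-! ### Formulas with parameters, partial types, indiscernible sequences

A formula in the variables `X` with parameters from a structure `N` is an `L`-formula in the
variables `N ⊕ X`, where the variables from `N` name themselves. -/

section Basics

variable {L : FirstOrder.Language.{u, v}} {N : Type w} [L.Structure N] {X : Type x}

/-- A set of formulas over `N` is consistent: every finite subset has a solution in `N`
(equivalently, the whole set has a solution in some elementary extension of `N`). -/
def Consistent (Φ : Set (L.Formula (N ⊕ X))) : Prop :=
  ∀ Φ₀ ⊆ Φ, Φ₀.Finite → ∃ c : X → N, ∀ φ ∈ Φ₀, φ.Realize (Sum.elim id c)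

/-- The formula `φ(x, a)` over `N` obtained from `φ(x, y)` by plugging in the tuple `a`. -/
def plug {Y : Type} (φ : L.Formula (X ⊕ Y)) (a : Y → N) : L.Formula (N ⊕ X) :=
  φ.relabel (Sum.elim Sum.inr (fun y => Sum.inl (a y)))

theorem realize_plug {Y : Type} (φ : L.Formula (X ⊕ Y)) (a : Y → N) (c : X → N) :
    (plug φ a).Realize (Sum.elim id c) ↔ φ.Realize (Sum.elim c a) := by
  unfold plug
  rw [FirstOrder.Language.Formula.realize_relabel]
  have : (Sum.elim id c : N ⊕ X → N) ∘ (Sum.elim Sum.inr (fun y => Sum.inl (a y)))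
      = Sum.elim c a := by
    funext z
    rcases z with z | z <;> rfl
  rw [this]

/-- The family `(φⱼ)` of formulas over `N` is `k`-inconsistent: no `k` members (with pairwise
distinct indices) are jointly consistent. -/
def KInconsistent (φ : ℕ → L.Formula (N ⊕ X)) (k : ℕ) : Prop :=
  ∀ s : Finset ℕ, s.card = k → ¬ Consistent (φ '' (s : Set ℕ))

/-- `tp(d/A) = tp(e/A)`. -/
def SameTypeOver (L : FirstOrder.Language.{u, v}) {N : Type w} [L.Structure N] {Y : Type} (A : Set N)
    (d e : Y → N) : Prop :=
  ∀ θ : L.Formula (A ⊕ Y),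
    θ.Realize (Sum.elim (fun a : A => (a : N)) d) ↔ θ.Realize (Sum.elim (fun a : A => (a : N)) e)

/-- The sequence `(aⱼ)` of tuples is indiscernible over `A`: any two finite increasing subsequences
of the same length have the same type over `A`. -/
def IndiscernibleOver (L : FirstOrder.Language.{u, v}) {N : Type w} [L.Structure N] {Y : Type} (A : Set N)
    (a : ℕ → Y → N) : Prop :=
  ∀ (r : ℕ) (s t : Fin r → ℕ), StrictMono s → StrictMono t →
    SameTypeOver L A (fun q : Fin r × Y => a (s q.1) q.2) (fun q : Fin r × Y => a (t q.1) q.2)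

/-- The set of elements occurring in the tuples of a sequence. -/
def rowSet {Y : Type} (a : ℕ → Y → N) : Set N := {e | ∃ j y, e = a j y}

/-- The sequences `(aᵢ)` are mutually indiscernible: each one is indiscernible over the union of the
others. -/
def MutuallyIndiscernible (L : FirstOrder.Language.{u, v}) {N : Type w} [L.Structure N] {I : Type x}
    {m : I → ℕ} (a : ∀ i, ℕ → Fin (m i) → N) : Prop :=
  ∀ i, IndiscernibleOver L (⋃ j ∈ {j | j ≠ i}, rowSet (a j)) (a i)

end Basics

/-- A partial type in the variables `X` over (some parameters from) `M`. -/
structure PartialType (L : FirstOrder.Language.{u, v}) (M : Type w) [L.Structure M] (X : Type x) where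
  formulas : Set (L.Formula (M ⊕ X))
  consistent : Consistent formulas

section Patterns

variable {L : FirstOrder.Language.{u, v}} {M : Type w} [L.Structure M] {X : Type x}

/-- The formulas of a partial type over `M`, seen over an elementary extension of `M`. -/
def PartialType.over (p : PartialType L M X) {N : Type w} [L.Structure N] (f : M ↪ₑ[L] N) :
    Set (L.Formula (N ⊕ X)) :=
  (fun φ : L.Formula (M ⊕ X) => φ.relabel (Sum.map f id)) '' p.formulas

/-- There is an inp-pattern of depth `κ` in `p` (in some elementary extension of `M`, that is, in the
monster model). -/
def HasInpPattern (p : PartialType L M X) (κ : Cardinal.{w}) : Prop :=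
  ∃ (N : Type w) (_ : L.Structure N) (f : M ↪ₑ[L] N)
    (m : κ.ord.ToType → ℕ) (φ : ∀ i, L.Formula (X ⊕ Fin (m i)))
    (a : ∀ i, ℕ → Fin (m i) → N) (k : κ.ord.ToType → ℕ),
    (∀ i, KInconsistent (fun j => plug (φ i) (a i j)) (k i)) ∧
    ∀ η : κ.ord.ToType → ℕ, Consistent (p.over f ∪ Set.range fun i => plug (φ i) (a i (η i)))

/-- There are formulas `φᵢ(x, yᵢ, zᵢ)`, mutually indiscernible sequences `aᵢ` and finite tuples
`bᵢ` of elements of the `aⱼ` with `R j i` (`i ∈ κ`) such that `p(x) ∪ {φᵢ(x, aᵢ₀, bᵢ)}ᵢ` is consistent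
and `{φᵢ(x, aᵢⱼ, bᵢ)}ⱼ` is inconsistent for every `i`. -/
def HasInpPatternWith (p : PartialType L M X) (κ : Cardinal.{w})
    (R : κ.ord.ToType → κ.ord.ToType → Prop) : Prop :=
  ∃ (N : Type w) (_ : L.Structure N) (f : M ↪ₑ[L] N)
    (m l : κ.ord.ToType → ℕ) (φ : ∀ i, L.Formula (X ⊕ (Fin (m i) ⊕ Fin (l i))))
    (a : ∀ i, ℕ → Fin (m i) → N) (b : ∀ i, Fin (l i) → N),
    MutuallyIndiscernible L a ∧
    (∀ i t, ∃ j, R j i ∧ b i t ∈ rowSet (a j)) ∧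
    Consistent (p.over f ∪ Set.range fun i => plug (φ i) (Sum.elim (a i 0) (b i))) ∧
    ∀ i, ¬ Consistent (Set.range fun j => plug (φ i) (Sum.elim (a i j) (b i)))

/-- There is an inp²-pattern of depth `κ` in `p`. -/
def HasInp2Pattern (p : PartialType L M X) (κ : Cardinal.{w}) : Prop :=
  HasInpPatternWith p κ (fun j i => j < i)

/-- There is an inp³-pattern of depth `κ` in `p`. -/
def HasInp3Pattern (p : PartialType L M X) (κ : Cardinal.{w}) : Prop :=
  HasInpPatternWith p κ (fun j i => j ≠ i)

/-- The burden of a partial type. -/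
def bdn (p : PartialType L M X) : CardStar.{w} :=
  CardStar.sup (CardStar.ofCard '' {κ | HasInpPattern p κ})

/-- The burden² of a partial type. -/
def bdn2 (p : PartialType L M X) : CardStar.{w} :=
  CardStar.sup (CardStar.ofCard '' {κ | HasInp2Pattern p κ})

/-- The burden³ of a partial type. -/
def bdn3 (p : PartialType L M X) : CardStar.{w} :=
  CardStar.sup (CardStar.ofCard '' {κ | HasInp3Pattern p κ})

end Patterns

/-! ### Properties of theories

Models range over the universe of the language, which contains elementary extensions of every size
of interest. -/

section Theories

variable {L : FirstOrder.Language.{u, v}}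

/-- `T` is strong. -/
def Strong (T : L.Theory) : Prop :=
  ∀ (M : T.ModelType.{u, v, max u v}) (n : ℕ) (p : PartialType L M (Fin n)),
    bdn p ≤ CardStar.belowAleph0

/-- `T` is strong². -/
def Strong2 (T : L.Theory) : Prop :=
  ∀ (M : T.ModelType.{u, v, max u v}) (n : ℕ) (p : PartialType L M (Fin n)),
    bdn2 p ≤ CardStar.belowAleph0

/-- `T` is strong³. -/
def Strong3 (T : L.Theory) : Prop :=
  ∀ (M : T.ModelType.{u, v, max u v}) (n : ℕ) (p : PartialType L M (Fin n)),
    bdn3 p ≤ CardStar.belowAleph0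

/-- `T` is strongly² dependent. -/
def Strongly2Dependent (T : L.Theory) : Prop :=
  ¬ ∃ (M : T.ModelType.{u, v, max u v}) (n : ℕ)
    (m l : ℕ → ℕ) (φ : ∀ i, L.Formula (Fin n ⊕ (Fin (m i) ⊕ Fin (l i))))
    (a : ∀ i, ℕ → Fin (m i) → M) (b : ∀ i, Fin (l i) → M),
    MutuallyIndiscernible L a ∧
    (∀ i t, ∃ j, j < i ∧ b i t ∈ rowSet (a j)) ∧
    Consistent (Set.range fun i =>
      plug (φ i) (Sum.elim (a i 0) (b i)) ⊓ (plug (φ i) (Sum.elim (a i 1) (b i))).not)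

/-- `T` is NIP: no formula `φ(x, y)` has the independence property. -/
def NIP (T : L.Theory) : Prop :=
  ¬ ∃ (M : T.ModelType.{u, v, max u v}) (n m : ℕ) (φ : L.Formula (Fin n ⊕ Fin m))
    (a : ℕ → Fin m → M),
    ∀ S : Set ℕ, Consistent
      ((fun j => plug φ (a j)) '' S ∪ (fun j => (plug φ (a j)).not) '' Sᶜ)

/-- `T` is NTP₂: no formula `φ(x, y)` has the tree property of the second kind. -/
def NTP2 (T : L.Theory) : Prop :=
  ¬ ∃ (M : T.ModelType.{u, v, max u v}) (n m : ℕ) (φ : L.Formula (Fin n ⊕ Fin m))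
    (a : ℕ → ℕ → Fin m → M) (k : ℕ),
    (∀ i, KInconsistent (fun j => plug φ (a i j)) k) ∧
    ∀ η : ℕ → ℕ, Consistent (Set.range fun i => plug φ (a i (η i)))

/-- The formula `φ(x, d)` divides over `A`: in some elementary extension there are realizations `eⱼ`
of `tp(d/A)` such that `{φ(x, eⱼ)}ⱼ` is `k`-inconsistent for some `k`. -/
def Divides {M : Type w} [L.Structure M] {n m : ℕ} (φ : L.Formula (Fin n ⊕ Fin m))
    (d : Fin m → M) (A : Set M) : Prop :=
  ∃ (N : Type w) (_ : L.Structure N) (f : M ↪ₑ[L] N) (e : ℕ → Fin m → N) (k : ℕ),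
    (∀ j, SameTypeOver L (f '' A) (e j) (fun t => f (d t))) ∧
    KInconsistent (fun j => plug φ (e j)) k

/-- `tp(c/B)` divides over `A`: it contains a formula that divides over `A`. -/
def TypeDivides (L : FirstOrder.Language.{u, v}) {M : Type w} [L.Structure M] {n : ℕ} (c : Fin n → M)
    (B A : Set M) : Prop :=
  ∃ (m : ℕ) (φ : L.Formula (Fin n ⊕ Fin m)) (d : Fin m → M),
    (∀ t, d t ∈ B) ∧ φ.Realize (Sum.elim c d) ∧ Divides φ d A

/-- `T` is supersimple: for every finite tuple `c` and every set `B` there is a finite `A ⊆ B` such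
that `tp(c/B)` does not divide over `A`. -/
def Supersimple (T : L.Theory) : Prop :=
  ∀ (M : T.ModelType.{u, v, max u v}) (n : ℕ) (c : Fin n → M) (B : Set M),
    ∃ A ⊆ B, A.Finite ∧ ¬ TypeDivides L c B A

/-- `T` is stable in the cardinal `μ`: there are at most `μ` complete `n`-types over every set of at
most `μ` parameters. -/
def StableIn (T : L.Theory) (μ : Cardinal.{max u v}) : Prop :=
  ∀ (M : T.ModelType.{u, v, max u v}) (A : Set M), #A ≤ μ →
    ∀ n : ℕ, #((L[[A]].completeTheory M).CompleteType (Fin n)) ≤ μ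

/-- `T` is stable: it is stable in some infinite cardinal. -/
def Stable (T : L.Theory) : Prop := ∃ μ : Cardinal.{max u v}, ℵ₀ ≤ μ ∧ StableIn T μ

/-- `T` is superstable: it is stable in all sufficiently large cardinals. -/
def Superstable (T : L.Theory) : Prop :=
  ∃ μ₀ : Cardinal.{max u v}, ∀ μ, μ₀ ≤ μ → StableIn T μ

end Theories

end Burden

end

universe y z

namespace Burden
open FirstOrder.Language

/-! ### Formulas: finitely many variables, conjunctions, solvability -/

variable {L : FirstOrder.Language.{u, v}}

/-! The main tool is extraction: `exists_mutuallyIndiscernible` replaces any array by a mutually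
indiscernible one, in an elementary extension, that keeps every property shared by all choices of
distinct members of the rows. Row-wise `k`-inconsistency and consistency of all paths are such
properties, so an inp-pattern becomes a pattern with mutually indiscernible rows and no parameters
at all; this is the comparison of burdens. The second tool is `MutuallyIndiscernible.blocks`:
consecutive terms may be grouped, rows dropped, and elements of dropped rows appended to the tuples,
without losing mutual indiscernibility.

In an infinite inp³-pattern each row uses parameters from finitely many rows only. A greedily chosen
sequence of rows (`HasPatternOn.nat`) therefore never refers forward; parameters from unchosen rows
are absorbed into the tuples. So for both kinds of pattern, burden at most `(ℵ₀)₋` means that there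
is no inp²-pattern indexed by `ℕ`.

If `c` realizes an inp²-pattern and `K i` is a position where the `i`-th formula fails at `c`,
blocks of length `K i` turn the pattern into a failure of strong² dependence. Conversely, grouping
in pairs turns such a failure into formulas `φ ∧ ¬φ'`; under NIP their rows are inconsistent,
because alternation along an indiscernible sequence gives the independence property. In a
supersimple theory the type of `c` over all rows would not divide over finitely many rows, yet the
next row exhibits dividing.

If inp³-patterns have unbounded depth, the pigeonhole principle yields uncountably many rows with
the same formula and the same `k`, and a free-set argument yields infinitely many of them whose
parameters avoid each other's rows. All paths through these are consistent, which is TP₂. Conversely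
TP₂ stretches to inp-patterns of any depth by compactness.

Both examples consist of sequences in an infinite elementary abelian 2-group, with the relations
"equal up to place `k`". They have quantifier elimination, are stable by counting types, and are not
superstable because a sequence is determined by its truncations. A finite tuple can distinguish
members of only finitely many of infinitely many mutually indiscernible rows (`IsTree.exists_row`).
Without addition every term involves at most one variable, so parameters do not help and the theory
is strong²; with addition the theory is still strong, but the parameters shift a row back into the
class of `x` that the earlier rows determine, and strong² fails. -/

theorem realize_congr_freeVar {N : Type w} [L.Structure N] {α : Type x} [DecidableEq α]
    (φ : L.Formula α) {v v' : α → N} (h : ∀ z ∈ φ.freeVarFinset, v z = v' z) :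
    φ.Realize v ↔ φ.Realize v' := by
  have key : ∀ u : α → N, (φ.restrictFreeVar (id : φ.freeVarFinset → _)).Realize (u ∘ (↑)) default ↔
      φ.Realize u := fun u => by
    exact BoundedFormula.realize_restrictFreeVar u (fun a => rfl)
  rw [← key v, ← key v']
  have : (v ∘ (↑) : φ.freeVarFinset → N) = v' ∘ (↑) := funext fun z => h z z.2
  rw [this]

/-- Conjunction of a finite set of formulas. -/
theorem exists_conj {α : Type x} (Φ : Set (L.Formula α)) (hΦ : Φ.Finite) :
    ∃ ψ : L.Formula α, ∀ (N : Type w) [L.Structure N] (v : α → N),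
      ψ.Realize v ↔ ∀ φ ∈ Φ, φ.Realize v := by
  have := hΦ.to_subtype
  refine ⟨Formula.iInf (fun φ : Φ => (φ : L.Formula α)), fun N _ v => ?_⟩
  rw [Formula.realize_iInf]
  simp

/-- Solvability of a finite set of formulas is expressed by a formula. -/
theorem exists_exFormula {Z : Type z} {X : Type x} (Φ : Set (L.Formula (Z ⊕ X)))
    (hΦ : Φ.Finite) :
    ∃ ψ : L.Formula Z, ∀ (N : Type w) [L.Structure N] [Nonempty N] (v : Z → N),
      ψ.Realize v ↔ ∃ c : X → N, ∀ φ ∈ Φ, φ.Realize (Sum.elim v c) := by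
  classical
  obtain ⟨χ, hχ⟩ := exists_conj.{u, v, w} Φ hΦ
  let S : Finset X := χ.freeVarFinset.toRight
  let f : χ.freeVarFinset → Z ⊕ S := fun y =>
    match y with
    | ⟨Sum.inl a, _⟩ => Sum.inl a
    | ⟨Sum.inr a, ha⟩ => Sum.inr ⟨a, Finset.mem_toRight.2 ha⟩
  let χ' : L.Formula (Z ⊕ S) := χ.restrictFreeVar f
  have hχ' : ∀ (N : Type w) [L.Structure N] (v : Z → N) (c : X → N),
      χ'.Realize (Sum.elim v (fun s : S => c s)) ↔ χ.Realize (Sum.elim v c) := by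
    intro N _ v c
    exact BoundedFormula.realize_restrictFreeVar (v' := Sum.elim v c) (by
      rintro ⟨a | a, ha⟩ <;> rfl)
  refine ⟨χ'.iExs S, fun N _ _ v => ?_⟩
  rw [Formula.realize_iExs]
  constructor
  · rintro ⟨c, hc⟩
    -- `X` may be infinite; only the variables in `S` matter, and the others receive an arbitrary
    -- value.
    refine ⟨fun y => if h : y ∈ S then c ⟨y, h⟩ else Classical.arbitrary N, ?_⟩
    rw [← hχ, ← hχ']
    convert hc using 3 with s
    simp
  · rintro ⟨c, hc⟩
    exact ⟨fun s => c s, (hχ' N v c).2 ((hχ N _).2 hc)⟩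

/-! ### Compactness by ultrapowers -/

section Ultrapower

variable {N : Type w} [L.Structure N] [Nonempty N] {α : Type z} (U : Ultrafilter α)

/-- The ultrapower of a structure. -/
abbrev Ultrapower (_N : Type w) {α : Type z} (U : Ultrafilter α) : Type (max z w) :=
  (U : Filter α).Product (fun _ : α => _N)

/-- The class of a function in the ultrapower. -/
def Ultrapower.mk (g : α → N) : Ultrapower N U := (Quotient.mk'' g : Quotient _)

theorem Ultrapower.realize {β : Type x} (φ : L.Formula β) (v : β → α → N) :
    φ.Realize (fun b => Ultrapower.mk U (v b)) ↔ ∀ᶠ i in (U : Filter α), φ.Realize (fun b => v b i) :=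
  Ultraproduct.realize_formula_cast (M := fun _ : α => N) (u := U) φ v

/-- The diagonal elementary embedding. -/
def Ultrapower.diag : N ↪ₑ[L] Ultrapower N U where
  toFun a := Ultrapower.mk U (fun _ => a)
  map_formula' n φ v := by
    have := Ultrapower.realize U φ (fun b _ => v b)
    simp only [Filter.eventually_const] at this
    exact this

end Ultrapower

/-- A consistent set of formulas is realized in an elementary extension. -/
theorem Consistent.exists_realize {N : Type w} [L.Structure N] [Nonempty N] {Z : Type z}
    {Φ : Set (L.Formula (N ⊕ Z))} (hΦ : Consistent Φ) :
    ∃ (N' : Type (max z w)) (_ : L.Structure N') (f : N ↪ₑ[L] N') (c : Z → N'),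
      ∀ φ ∈ Φ, φ.Realize (Sum.elim f c) := by
  classical
  -- The index set consists of all assignments `c : Z → N`, and the ultrafilter contains the
  -- solution set of every formula in `Φ`. The coordinate functions `c ↦ c y` then form a
  -- realization.
  obtain ⟨U, hU⟩ := Ultrafilter.exists_ultrafilter_of_finite_inter_nonempty
    ((fun φ : L.Formula (N ⊕ Z) => {c : Z → N | φ.Realize (Sum.elim id c)}) '' Φ) (by
      intro T hT
      obtain ⟨T', hT', rfl⟩ := Finset.subset_set_image_iff.1 hT
      obtain ⟨c, hc⟩ := hΦ T' hT' T'.finite_toSet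
      refine ⟨c, ?_⟩
      rintro _ hs
      obtain ⟨φ, hφ, rfl⟩ := Finset.mem_image.1 hs
      exact hc φ hφ)
  refine ⟨Ultrapower N U, inferInstance, Ultrapower.diag U, fun y => Ultrapower.mk U (fun c => c y),
    fun φ hφ => ?_⟩
  have h := hU ⟨φ, hφ, rfl⟩
  have := Ultrapower.realize U φ (Sum.elim (fun a _ => a) (fun y c => c y))
  have h2 : (fun b : N ⊕ Z => Ultrapower.mk U (Sum.elim (fun a _ => a) (fun y c => c y) b)) =
      Sum.elim (Ultrapower.diag (L := L) U) (fun y => Ultrapower.mk U (fun c => c y)) := by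
    funext b; rcases b with b | b <;> rfl
  rw [h2] at this
  rw [this]
  filter_upwards [h] with c hc
  have h3 : (fun b : N ⊕ Z => (Sum.elim (fun a _ => a) (fun y c => c y) b : (Z → N) → N) c) =
      Sum.elim id c := by
    funext b; rcases b with b | b <;> rfl
  rw [h3]; exact hc


/-! ### Iterated limits along a nonprincipal ultrafilter -/

section Limits

variable {J : Type x}

/-- A predicate on assignments that only depends on the coordinates in `S`. -/
def SupportedOn (P : (J → ℕ) → Prop) (S : Set J) : Prop :=
  ∀ g g', (∀ y ∈ S, g y = g' y) → (P g ↔ P g')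

theorem SupportedOn.not {P : (J → ℕ) → Prop} {S : Set J} (h : SupportedOn P S) :
    SupportedOn (fun g => ¬ P g) S := fun g g' hg => not_congr (h g g' hg)

variable [LinearOrder J]

/-- The iterated limit of a predicate, over the coordinates in a list. -/
def IterLim : List J → ((J → ℕ) → Prop) → (J → ℕ) → Prop
  | [], P, g => P g
  | y :: l, P, g => ∀ᶠ n in (Filter.hyperfilter ℕ : Filter ℕ), IterLim l P (Function.update g y n)

theorem IterLim.mono {l : List J} {P Q : (J → ℕ) → Prop} (h : ∀ g, P g → Q g) {g : J → ℕ}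
    (hg : IterLim l P g) : IterLim l Q g := by
  induction l generalizing g with
  | nil => exact h g hg
  | cons y l ih => exact Filter.Eventually.mono hg fun n hn => ih hn

theorem IterLim.exists {l : List J} {P : (J → ℕ) → Prop} {g : J → ℕ}
    (hg : IterLim l P g) : ∃ g', P g' := by
  induction l generalizing g with
  | nil => exact ⟨g, hg⟩
  | cons y l ih => obtain ⟨n, hn⟩ := Filter.Eventually.exists hg; exact ih hn

theorem iterLim_and {l : List J} {P Q : (J → ℕ) → Prop} {g : J → ℕ} :
    IterLim l (fun g => P g ∧ Q g) g ↔ IterLim l P g ∧ IterLim l Q g := by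
  induction l generalizing g with
  | nil => exact Iff.rfl
  | cons y l ih => simp only [IterLim, ih, Filter.eventually_and]

theorem iterLim_not {l : List J} {P : (J → ℕ) → Prop} {g : J → ℕ} :
    IterLim l (fun g => ¬ P g) g ↔ ¬ IterLim l P g := by
  induction l generalizing g with
  | nil => exact Iff.rfl
  | cons y l ih => simp only [IterLim, ih, Ultrafilter.eventually_not]

theorem SupportedOn.iterLim_congr {P : (J → ℕ) → Prop} {S : Set J} (hP : SupportedOn P S)
    {l : List J} {g g' : J → ℕ} (h : ∀ y ∈ S, y ∉ l → g y = g' y) :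
    IterLim l P g ↔ IterLim l P g' := by
  induction l generalizing g g' with
  | nil => exact hP g g' fun y hy => h y hy (by simp)
  | cons y l ih =>
    refine Filter.eventually_congr (Filter.Eventually.of_forall fun n => ih fun z hz hzl => ?_)
    by_cases hzy : z = y
    · subst hzy; simp
    · simp only [Function.update_of_ne hzy]
      exact h z hz (by simp [hzy, hzl])

/-- A limit over a coordinate on which the predicate does not depend is the limit of a constant, so
such coordinates can be deleted from the list. -/
theorem SupportedOn.iterLim_sublist {P : (J → ℕ) → Prop} {S : Set J} (hP : SupportedOn P S)
    {l l' : List J} (hl : l.Sublist l') (hn : l'.Nodup) (hS : ∀ y ∈ l', y ∈ S → y ∈ l)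
    (g : J → ℕ) : IterLim l' P g ↔ IterLim l P g := by
  induction hl generalizing g with
  | slnil => exact Iff.rfl
  | @cons l l' y hll' ih =>
    rw [List.nodup_cons] at hn
    have hyS : y ∉ S := fun hy => hn.1 (hll'.subset (hS y (by simp) hy))
    rw [← Filter.eventually_const (f := (Filter.hyperfilter ℕ : Filter ℕ)) (p := IterLim l P g)]
    refine Filter.eventually_congr (Filter.Eventually.of_forall fun n => ?_)
    rw [ih hn.2 (fun z hz => hS z (by simp [hz]))]
    refine hP.iterLim_congr fun z hz _ => Function.update_of_ne ?_ _ _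
    rintro rfl; exact hyS hz
  | @cons_cons l l' y hll' ih =>
    rw [List.nodup_cons] at hn
    refine Filter.eventually_congr (Filter.Eventually.of_forall fun n => ?_)
    refine ih hn.2 (fun z hz hzS => ?_) _
    have := hS z (by simp [hz]) hzS
    rw [List.mem_cons] at this
    refine this.resolve_left ?_
    rintro rfl; exact hn.1 hz

theorem iterLim_map {J' : Type z} [LinearOrder J'] {e : J' → J} (he : Function.Injective e)
    (l : List J') (Q : (J' → ℕ) → Prop) (g : J → ℕ) :
    IterLim (l.map e) (fun g => Q (g ∘ e)) g ↔ IterLim l Q (g ∘ e) := by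
  induction l generalizing g with
  | nil => exact Iff.rfl
  | cons y l ih =>
    simp only [List.map_cons, IterLim, ih]
    simp only [Function.update_comp_eq_of_injective _ he]

/-- The truth value of a finitely supported predicate at the iterated limit. -/
def LimTrue (P : (J → ℕ) → Prop) : Prop :=
  ∃ F : Finset J, SupportedOn P F ∧ IterLim F.sort P 0

theorem SupportedOn.iterLim_sort_iff {P : (J → ℕ) → Prop} {F F' : Finset J}
    (hF : SupportedOn P F) (h : F ⊆ F') : IterLim F'.sort P 0 ↔ IterLim F.sort P 0 := by
  refine hF.iterLim_sublist ?_ (Finset.sort_nodup _ _) (fun y _ hy => by simpa using hy) 0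
  refine List.sublist_of_subperm_of_pairwise (r := (· ≤ ·)) ?_ (Finset.pairwise_sort _ _)
    (Finset.pairwise_sort _ _)
  exact (Finset.sort_nodup _ _).subperm (fun y hy => by simpa using h (by simpa using hy))

/-- Any two supports give the same value, since both can be compared with their union. -/
theorem SupportedOn.limTrue_iff {P : (J → ℕ) → Prop} {F : Finset J} (hF : SupportedOn P F) :
    LimTrue P ↔ IterLim F.sort P 0 := by
  refine ⟨?_, fun h => ⟨F, hF, h⟩⟩
  rintro ⟨F', hF', h⟩
  rw [← hF.iterLim_sort_iff (Finset.subset_union_left (s₂ := F'))]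
  exact (hF'.iterLim_sort_iff Finset.subset_union_right).2 h

theorem SupportedOn.limTrue_not {P : (J → ℕ) → Prop} {F : Finset J} (hF : SupportedOn P F) :
    LimTrue (fun g => ¬ P g) ↔ ¬ LimTrue P := by
  rw [hF.not.limTrue_iff, hF.limTrue_iff, iterLim_not]

theorem LimTrue.and {P Q : (J → ℕ) → Prop} (hP : LimTrue P) (hQ : LimTrue Q) :
    LimTrue (fun g => P g ∧ Q g) := by
  obtain ⟨F, hF, h⟩ := hP
  obtain ⟨F', hF', h'⟩ := hQ
  refine ⟨F ∪ F', fun g g' hg => and_congr (hF g g' fun y hy => hg y (by simp [Finset.mem_coe.1 hy]))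
    (hF' g g' fun y hy => hg y (by simp [Finset.mem_coe.1 hy])), ?_⟩
  rw [iterLim_and]
  exact ⟨(hF.iterLim_sort_iff Finset.subset_union_left).2 h,
    (hF'.iterLim_sort_iff Finset.subset_union_right).2 h'⟩

theorem limTrue_forall_finset {ι : Type z} (s : Finset ι) {P : ι → (J → ℕ) → Prop}
    (h : ∀ i ∈ s, LimTrue (P i)) : LimTrue (fun g => ∀ i ∈ s, P i g) := by
  classical
  induction s using Finset.induction_on with
  | empty => exact ⟨∅, fun _ _ _ => by simp, by simp [IterLim]⟩
  | insert i s _ ih =>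
    simp only [Finset.mem_insert, forall_eq_or_imp] at h ⊢
    exact h.1.and (ih h.2)

theorem LimTrue.exists {P : (J → ℕ) → Prop} (h : LimTrue P) : ∃ g, P g := by
  obtain ⟨F, -, h⟩ := h
  exact IterLim.exists h

theorem limTrue_ne {y z : J} (hyz : y ≠ z) : LimTrue (fun g : J → ℕ => g y ≠ g z) := by
  wlog h : y < z generalizing y z
  · obtain ⟨F, hF, h'⟩ := this hyz.symm (lt_of_le_of_ne (not_lt.1 h) hyz.symm)
    exact ⟨F, fun g g' hg => ne_comm.trans ((hF g g' hg).trans ne_comm),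
      IterLim.mono (fun _ => Ne.symm) h'⟩
  refine ⟨{y, z}, fun g g' hg => by
    change g y ≠ g z ↔ g' y ≠ g' z
    rw [hg y (by simp), hg z (by simp)], ?_⟩
  have : ({y, z} : Finset J).sort = [y, z] := by
    rw [Finset.sort_insert _ (by simp [h.le]) (by simp [hyz]), Finset.sort_singleton]
  rw [this]
  refine Filter.Eventually.of_forall fun n => ?_
  -- The ultrafilter is nonprincipal, so the later coordinate almost surely avoids the value `n`
  -- already given to the earlier one.
  have hn : ∀ᶠ k in (Filter.hyperfilter ℕ : Filter ℕ), k ≠ n :=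
    Filter.hyperfilter_le_cofinite (Set.finite_singleton n).compl_mem_cofinite
  refine hn.mono fun k hk => ?_
  simp [IterLim, Function.update_of_ne hyz, hk.symm]

/-- This is the source of indiscernibility. The iterated limit sees only the order in which the
coordinates are taken; the order of `J'` pulled back along `e` is also the one pulled back along
`e'`, and both sides equal the limit computed in `J'`. -/
theorem limTrue_comp_iff {J' : Type z} {e e' : J' → J} (he : Function.Injective e)
    (hee' : ∀ y y', e y ≤ e y' ↔ e' y ≤ e' y') {Q : (J' → ℕ) → Prop} {F : Finset J'}
    (hF : SupportedOn Q F) :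
    LimTrue (fun g => Q (g ∘ e)) ↔ LimTrue (fun g => Q (g ∘ e')) := by
  have he' : Function.Injective e' := fun a b hab => he (le_antisymm ((hee' a b).2 hab.le)
    ((hee' b a).2 hab.ge))
  let _ : LinearOrder J' := LinearOrder.lift' e he
  have key : ∀ e'' : J' → J, (he : Function.Injective e'') → (∀ y y' : J', y ≤ y' ↔ e'' y ≤ e'' y') →
      (LimTrue (fun g => Q (g ∘ e'')) ↔ IterLim F.sort Q 0) := by
    intro e'' he h
    have hs : SupportedOn (fun g => Q (g ∘ e'')) (F.map ⟨e'', he⟩) := fun g g' hg =>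
      hF _ _ fun y hy => hg (e'' y) (by simpa using ⟨y, hy, rfl⟩)
    rw [hs.limTrue_iff, ← Finset.map_sort ⟨e'', he⟩ F (· ≤ ·) (· ≤ ·) (fun a _ b _ => h a b)]
    exact iterLim_map he _ Q 0
  rw [key e he (fun _ _ => Iff.rfl), key e' he' hee']

end Limits

/-! ### Extracting mutually indiscernible sequences -/

variable {L : FirstOrder.Language.{u, v}}

theorem supportedOn_realize {N : Type w} [L.Structure N] {α : Type x} {J : Type z}
    (θ : L.Formula α) (V : (J → ℕ) → α → N) (κ : α → Option J)
    (hV : ∀ g g' y, (∀ j, κ y = some j → g j = g' j) → V g y = V g' y) :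
    ∃ F : Finset J, SupportedOn (fun g => θ.Realize (V g)) F := by
  classical
  refine ⟨θ.freeVarFinset.biUnion fun y => (κ y).toFinset, fun g g' hg => ?_⟩
  refine realize_congr_freeVar θ fun y hy => hV g g' y fun j hj => hg j ?_
  simp only [Finset.coe_biUnion, Set.mem_iUnion]
  exact ⟨y, hy, by simp [hj]⟩

/-- The new rows realize the type of an iterated ultrafilter limit, which replaces Ramsey's theorem.
The second clause says which properties are inherited: those that hold for every choice that is
injective, within each row, on the finitely many places in `F`. -/
theorem exists_mutuallyIndiscernible {N : Type w} [L.Structure N] [Nonempty N] {I : Type z}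
    {m : I → ℕ} (a : ∀ i, ℕ → Fin (m i) → N) :
    ∃ (N' : Type (max z w)) (_ : L.Structure N') (f : N ↪ₑ[L] N') (c : ∀ i, ℕ → Fin (m i) → N'),
      MutuallyIndiscernible L c ∧
      ∀ (F : Finset (I × ℕ)) (ψ : L.Formula (N ⊕ Σ i, ℕ × Fin (m i))),
        (∀ g : I → ℕ → ℕ,
          (∀ i j j', (i, j) ∈ F → (i, j') ∈ F → j ≠ j' → g i j ≠ g i j') →
          ψ.Realize (Sum.elim id fun y => a y.1 (g y.1 y.2.1) y.2.2)) →
        ψ.Realize (Sum.elim f fun y => c y.1 y.2.1 y.2.2) := by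
  classical
  let _ : LinearOrder I := linearOrderOfSTO WellOrderingRel
  -- The variables are ordered row by row. Each row is then an interval of `J`, which is what makes
  -- the indiscernibility mutual.
  let J := I ×ₗ ℕ
  let V : (J → ℕ) → (N ⊕ Σ i, ℕ × Fin (m i)) → N := fun g =>
    Sum.elim id fun y => a y.1 (g (toLex (y.1, y.2.1))) y.2.2
  have hsupp : ∀ ψ : L.Formula (N ⊕ Σ i, ℕ × Fin (m i)),
      ∃ F : Finset J, SupportedOn (fun g => ψ.Realize (V g)) F := fun ψ =>
    supportedOn_realize ψ V (Sum.elim (fun _ => none) fun y => some (toLex (y.1, y.2.1))) (by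
      rintro g g' (y | y) h
      · rfl
      · simp [V, h _ rfl])
  obtain ⟨N', _, f, c, hc⟩ := Consistent.exists_realize
    (Φ := {ψ : L.Formula (N ⊕ Σ i, ℕ × Fin (m i)) | LimTrue fun g => ψ.Realize (V g)}) (by
      intro Φ₀ hΦ₀ hfin
      obtain ⟨g, hg⟩ := (limTrue_forall_finset hfin.toFinset
        (P := fun (ψ : L.Formula (N ⊕ Σ i, ℕ × Fin (m i))) g => ψ.Realize (V g))
        (fun ψ hψ => hΦ₀ (by simpa using hψ))).exists
      exact ⟨_, fun φ hφ => hg φ (by simpa using hφ)⟩)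
  have hcomplete : ∀ ψ : L.Formula (N ⊕ Σ i, ℕ × Fin (m i)),
      ψ.Realize (Sum.elim f c) ↔ LimTrue fun g => ψ.Realize (V g) := by
    intro ψ
    refine ⟨fun h => ?_, hc ψ⟩
    by_contra hn
    obtain ⟨F, hF⟩ := hsupp ψ
    have := hc ψ.not (by
      simp only [Set.mem_ofPred_eq, Formula.realize_not]
      exact hF.limTrue_not.2 hn)
    rw [Formula.realize_not] at this
    exact this h
  refine ⟨N', _, f, fun i j y => c ⟨i, j, y⟩, ?_, ?_⟩
  · intro i r s t hs ht θ
    have hA : ∀ e : (⋃ j ∈ {j | j ≠ i}, rowSet (fun k (y : Fin (m j)) => c ⟨j, k, y⟩) : Set N'),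
        ∃ y : Σ i, ℕ × Fin (m i), y.1 ≠ i ∧ (e : N') = c y := by
      rintro ⟨e, he⟩
      simp only [Set.mem_iUnion] at he
      obtain ⟨j, hj, k, y, rfl⟩ := he
      exact ⟨⟨j, k, y⟩, hj, rfl⟩
    -- Every parameter from another row is itself a coordinate of the realization, so it can be
    -- treated as a variable.
    choose ρ hρ hρc using hA
    let rel : (Fin r → ℕ) → ((⋃ j ∈ {j | j ≠ i}, rowSet (fun k (y : Fin (m j)) => c ⟨j, k, y⟩) :
        Set N') ⊕ (Fin r × Fin (m i))) → N ⊕ Σ i, ℕ × Fin (m i) := fun s =>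
      Sum.elim (fun e => Sum.inr (ρ e)) (fun q => Sum.inr ⟨i, s q.1, q.2⟩)
    have h1 : ∀ s : Fin r → ℕ, θ.Realize (Sum.elim (fun e => (e : N'))
        (fun q : Fin r × Fin (m i) => c ⟨i, s q.1, q.2⟩)) ↔
        LimTrue fun g => (θ.relabel (rel s)).Realize (V g) := by
      intro s
      rw [← hcomplete, Formula.realize_relabel]
      have : (Sum.elim (fun e : (⋃ j ∈ {j | j ≠ i}, rowSet (fun k (y : Fin (m j)) => c ⟨j, k, y⟩) :
          Set N') => (e : N')) (fun q : Fin r × Fin (m i) => c ⟨i, s q.1, q.2⟩)) =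
          Sum.elim f c ∘ rel s := by
        funext y
        rcases y with e | q
        · simp [rel, hρc e]
        · rfl
      rw [this]
    refine (h1 s).trans (Iff.trans ?_ (h1 t).symm)
    let J' := Fin r ⊕ {y : I × ℕ // y.1 ≠ i}
    let emb : (Fin r → ℕ) → J' → J := fun s =>
      Sum.elim (fun q => toLex (i, s q)) (fun y => toLex y.1)
    let W : (J' → ℕ) → _ → N := fun h => Sum.elim
      (fun e => a (ρ e).1 (h (Sum.inr ⟨((ρ e).1, (ρ e).2.1), hρ e⟩)) (ρ e).2.2)
      (fun q : Fin r × Fin (m i) => a i (h (Sum.inl q.1)) q.2)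
    obtain ⟨F, hF⟩ := supportedOn_realize θ W
      (Sum.elim (fun e => some (Sum.inr ⟨((ρ e).1, (ρ e).2.1), hρ e⟩))
        (fun q => some (Sum.inl q.1))) (by
        rintro g g' (y | y) h <;> simp [W, h _ rfl])
    have h2 : ∀ s : Fin r → ℕ, (fun g => (θ.relabel (rel s)).Realize (V g)) =
        fun g => θ.Realize (W (g ∘ emb s)) := by
      intro s
      funext g
      rw [Formula.realize_relabel]
      congr 1
      funext y
      rcases y with e | q <;> rfl
    rw [h2, h2]
    -- In the lexicographic order a place of row `i` compares with a place of another row by the row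
    -- indices alone, so the resulting order does not depend on `s`.
    have hlex : ∀ (s : Fin r → ℕ), StrictMono s → ∀ y y' : J', emb s y ≤ emb s y' ↔
        match y, y' with
        | Sum.inl q, Sum.inl q' => q ≤ q'
        | Sum.inl _, Sum.inr y' => i < y'.1.1
        | Sum.inr y, Sum.inl _ => y.1.1 < i
        | Sum.inr y, Sum.inr y' => toLex y.1 ≤ toLex y'.1 := by
      rintro s hs (q | ⟨⟨y1, y2⟩, hy⟩) (q' | ⟨⟨z1, z2⟩, hz⟩)
      · refine Prod.Lex.toLex_le_toLex.trans ?_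
        simp [hs.le_iff_le]
      · refine Prod.Lex.toLex_le_toLex.trans ?_
        exact ⟨fun h => h.resolve_right fun h => hz h.1.symm, Or.inl⟩
      · refine Prod.Lex.toLex_le_toLex.trans ?_
        exact ⟨fun h => h.resolve_right fun h => hy h.1, Or.inl⟩
      · rfl
    refine limTrue_comp_iff ?_ (fun y y' => (hlex s hs y y').trans (hlex t ht y y').symm) hF
    rintro (q | ⟨y, hy⟩) (q' | ⟨y', hy'⟩) h
    · have := congrArg (fun p => (ofLex p).2) h
      exact congrArg _ (hs.injective this)
    · exact absurd (congrArg (fun p => (ofLex p).1) h).symm hy'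
    · exact absurd (congrArg (fun p => (ofLex p).1) h) hy
    · have : y = y' := h
      subst this; rfl
  · intro F ψ h
    refine (hcomplete ψ).2 ?_
    -- If `ψ` failed at the limit, some assignment would be injective on `F` within each row and
    -- falsify `ψ`, because distinct coordinates differ in the limit.
    by_contra hn
    obtain ⟨G, hG⟩ := hsupp ψ
    have h1 := hG.limTrue_not.2 hn
    have h2 := limTrue_forall_finset ((F ×ˢ F).filter fun p => p.1 ≠ p.2)
      (P := fun (p : (I × ℕ) × (I × ℕ)) (g : J → ℕ) => g (toLex p.1) ≠ g (toLex p.2))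
      (fun p hp => limTrue_ne (fun h => (Finset.mem_filter.1 hp).2 (toLex.injective h)))
    obtain ⟨g, hg1, hg2⟩ := (h1.and h2).exists
    refine hg1 (h (fun i j => g (toLex (i, j))) fun i j j' hj hj' hne => ?_)
    exact hg2 ((i, j), (i, j')) (by simp [hj, hj', hne])


variable {L : FirstOrder.Language.{u, v}}

/-! ### Consistency of families of formulas -/

theorem exists_exFormula₂ {Z : Type z} {X : Type x} {ι : Type*} {ι' : Type*} (s : Finset ι)
    (χ : ι → L.Formula (Z ⊕ X)) (s' : Finset ι') (χ' : ι' → L.Formula (Z ⊕ X)) :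
    ∃ ψ : L.Formula Z, ∀ (N : Type w) [L.Structure N] [Nonempty N] (v : Z → N),
      ψ.Realize v ↔ ∃ c : X → N, (∀ i ∈ s, (χ i).Realize (Sum.elim v c)) ∧
        ∀ i ∈ s', (χ' i).Realize (Sum.elim v c) := by
  obtain ⟨ψ, hψ⟩ := exists_exFormula.{u, v, w} (χ '' s ∪ χ' '' s')
    ((s.finite_toSet.image χ).union (s'.finite_toSet.image χ'))
  refine ⟨ψ, fun N _ _ v => (hψ N v).trans (exists_congr fun c => ?_)⟩
  constructor
  · exact fun h => ⟨fun i hi => h _ (Or.inl ⟨i, hi, rfl⟩), fun i hi => h _ (Or.inr ⟨i, hi, rfl⟩)⟩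
  · rintro ⟨h, h'⟩ _ (⟨i, hi, rfl⟩ | ⟨i, hi, rfl⟩)
    · exact h i hi
    · exact h' i hi

theorem exists_exFormula₁ {Z : Type z} {X : Type x} {ι : Type*} (s : Finset ι)
    (χ : ι → L.Formula (Z ⊕ X)) :
    ∃ ψ : L.Formula Z, ∀ (N : Type w) [L.Structure N] [Nonempty N] (v : Z → N),
      ψ.Realize v ↔ ∃ c : X → N, ∀ i ∈ s, (χ i).Realize (Sum.elim v c) := by
  obtain ⟨ψ, hψ⟩ := exists_exFormula₂.{u, v, w} s χ (∅ : Finset Unit) (fun _ => ⊤)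
  exact ⟨ψ, fun N _ _ v => by simp [hψ]⟩

theorem realize_relabel_map {N : Type w} {X : Type x} {N' : Type*} [L.Structure N'] (f : N → N') (φ : L.Formula (N ⊕ X))
    (c : X → N') :
    (φ.relabel (Sum.map f id)).Realize (Sum.elim id c) ↔ φ.Realize (Sum.elim f c) := by
  rw [Formula.realize_relabel]
  have : (Sum.elim id c : N' ⊕ X → N') ∘ Sum.map f id = Sum.elim f c := by
    funext y; rcases y with y | y <;> rfl
  rw [this]

section Consistency

variable {N : Type w} [L.Structure N] {X : Type x}

theorem consistent_range_iff {I : Type*} (χ : I → L.Formula (N ⊕ X)) :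
    Consistent (Set.range χ) ↔
      ∀ F : Finset I, ∃ c : X → N, ∀ i ∈ F, (χ i).Realize (Sum.elim id c) := by
  classical
  constructor
  · intro h F
    obtain ⟨c, hc⟩ := h (χ '' F) (Set.image_subset_range _ _) (F.finite_toSet.image _)
    exact ⟨c, fun i hi => hc _ ⟨i, hi, rfl⟩⟩
  · intro h Φ₀ hΦ₀ hfin
    obtain ⟨F, -, hF⟩ := Finset.subset_set_image_iff (s := Set.univ) (t := hfin.toFinset) (f := χ)
      |>.1 (by simpa using hΦ₀)
    obtain ⟨c, hc⟩ := h F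
    refine ⟨c, fun φ hφ => ?_⟩
    rw [← hfin.mem_toFinset, ← hF] at hφ
    obtain ⟨i, hi, rfl⟩ := Finset.mem_image.1 hφ
    exact hc i hi

theorem not_consistent_range_iff {I : Type*} (χ : I → L.Formula (N ⊕ X)) :
    ¬ Consistent (Set.range χ) ↔
      ∃ F : Finset I, ¬ ∃ c : X → N, ∀ i ∈ F, (χ i).Realize (Sum.elim id c) := by
  rw [consistent_range_iff, not_forall]

theorem consistent_image_finset_iff {I : Type*} (χ : I → L.Formula (N ⊕ X)) (s : Finset I) :
    Consistent (χ '' s) ↔ ∃ c : X → N, ∀ i ∈ s, (χ i).Realize (Sum.elim id c) := by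
  constructor
  · intro h
    obtain ⟨c, hc⟩ := h _ subset_rfl (s.finite_toSet.image _)
    exact ⟨c, fun i hi => hc _ ⟨i, hi, rfl⟩⟩
  · rintro ⟨c, hc⟩ Φ₀ hΦ₀ _
    refine ⟨c, fun φ hφ => ?_⟩
    obtain ⟨i, hi, rfl⟩ := hΦ₀ hφ
    exact hc i hi

theorem Consistent.mono {Φ Ψ : Set (L.Formula (N ⊕ X))} (h : Consistent Φ) (hs : Ψ ⊆ Φ) :
    Consistent Ψ := fun Φ₀ hΦ₀ => h Φ₀ (hΦ₀.trans hs)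

theorem consistent_over_iff {M : Type w} [L.Structure M] (p : PartialType L M X) (f : M ↪ₑ[L] N)
    {I : Type*} (χ : I → L.Formula (N ⊕ X)) :
    Consistent (p.over f ∪ Set.range χ) ↔
      ∀ (s : Finset p.formulas) (F : Finset I), ∃ c : X → N,
        (∀ φ ∈ s, φ.1.Realize (Sum.elim f c)) ∧ ∀ i ∈ F, (χ i).Realize (Sum.elim id c) := by
  classical
  have : p.over f ∪ Set.range χ = Set.range (Sum.elim
      (fun φ : p.formulas => (φ.1.relabel (Sum.map f id) : L.Formula (N ⊕ X))) χ) := by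
    rw [Set.Sum.elim_range]
    congr 1
    ext φ
    simp [PartialType.over]
  rw [this, consistent_range_iff]
  constructor
  · intro h s F
    obtain ⟨c, hc⟩ := h (s.disjSum F)
    exact ⟨c, fun φ hφ => (realize_relabel_map f φ.1 c).1 (hc (Sum.inl φ) (by simpa using hφ)),
      fun i hi => hc (Sum.inr i) (by simpa using hi)⟩
  · intro h F
    obtain ⟨c, hc, hc'⟩ := h F.toLeft F.toRight
    refine ⟨c, ?_⟩
    rintro (φ | i) hi
    · exact (realize_relabel_map f φ.1 c).2 (hc φ (by simpa using hi))
    · exact hc' i (by simpa using hi)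

/-- Solvability of a finite system is a first-order property of its parameters. -/
theorem exists_realize_elementary_iff {N' : Type w} [L.Structure N'] [Nonempty N]
    (f : N ↪ₑ[L] N') {Z : Type z} {ι : Type*} (s : Finset ι) (χ : ι → L.Formula (Z ⊕ X))
    (v : Z → N) :
    (∃ c : X → N', ∀ i ∈ s, (χ i).Realize (Sum.elim (f ∘ v) c)) ↔
      ∃ c : X → N, ∀ i ∈ s, (χ i).Realize (Sum.elim v c) := by
  have : Nonempty N' := Nonempty.map f inferInstance
  obtain ⟨ψ, hψ⟩ := exists_exFormula₁.{u, v, w} s χ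
  rw [← hψ, ← hψ, f.map_formula]

theorem consistent_range_elementary_iff {N' : Type w} [L.Structure N'] [Nonempty N]
    (f : N ↪ₑ[L] N') {I : Type*} {χ : I → L.Formula (N ⊕ X)} {χ' : I → L.Formula (N' ⊕ X)}
    (h : ∀ i c, (χ' i).Realize (Sum.elim id c) ↔ (χ i).Realize (Sum.elim f c)) :
    Consistent (Set.range χ') ↔ Consistent (Set.range χ) := by
  rw [consistent_range_iff, consistent_range_iff]
  refine forall_congr' fun F => ?_
  rw [← exists_realize_elementary_iff f F χ id]
  simp only [h, Function.comp_id]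

end Consistency

/-! ### Indiscernible sequences -/

section Indiscernible

variable {N : Type w} [L.Structure N]

theorem IndiscernibleOver.exists_iff [Nonempty N] {Y : Type} {A : Set N} {a : ℕ → Y → N}
    (ha : IndiscernibleOver L A a) {r : ℕ} {s t : Fin r → ℕ} (hs : StrictMono s) (ht : StrictMono t)
    {X : Type x} {ι : Type*} (F : Finset ι) (χ : ι → L.Formula ((A ⊕ (Fin r × Y)) ⊕ X)) :
    (∃ c : X → N, ∀ i ∈ F, (χ i).Realize
      (Sum.elim (Sum.elim (fun e : A => (e : N)) (fun q => a (s q.1) q.2)) c)) ↔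
    ∃ c : X → N, ∀ i ∈ F, (χ i).Realize
      (Sum.elim (Sum.elim (fun e : A => (e : N)) (fun q => a (t q.1) q.2)) c) := by
  obtain ⟨ψ, hψ⟩ := exists_exFormula₁.{u, v, w} F χ
  rw [← hψ, ← hψ]
  exact ha r s t hs ht ψ

/-- By compactness some finite subset of the row is inconsistent; indiscernibility carries this to
every subset of the same size, which serves as `k`. -/
theorem IndiscernibleOver.exists_kInconsistent [Nonempty N] {Y Z : Type} {A : Set N}
    {a : ℕ → Y → N} (ha : IndiscernibleOver L A a) {X : Type x} (φ : L.Formula (X ⊕ (Y ⊕ Z)))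
    {b : Z → N} (hb : ∀ t, b t ∈ A)
    (h : ¬ Consistent (Set.range fun j => plug φ (Sum.elim (a j) b))) :
    ∃ k, KInconsistent (fun j => plug φ (Sum.elim (a j) b)) k := by
  rw [not_consistent_range_iff] at h
  obtain ⟨F, hF⟩ := h
  refine ⟨F.card, fun s hs hcon => hF ?_⟩
  rw [consistent_image_finset_iff] at hcon
  simp only [realize_plug] at hcon ⊢
  have key : ∀ t : Finset ℕ, (ht : t.card = F.card) →
      ((∃ c : X → N, ∀ j ∈ t, φ.Realize (Sum.elim c (Sum.elim (a j) b))) ↔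
      ∃ c : X → N, ∀ q ∈ (Finset.univ : Finset (Fin F.card)),
        (φ.relabel (Sum.elim Sum.inr (Sum.elim (fun y => Sum.inl (Sum.inr (q, y)))
          (fun y => Sum.inl (Sum.inl ⟨b y, hb y⟩)))) :
          L.Formula ((A ⊕ (Fin F.card × Y)) ⊕ X)).Realize
        (Sum.elim (Sum.elim (fun e : A => (e : N))
          (fun q => a (t.orderEmbOfFin ht q.1) q.2)) c)) := by
    intro t ht
    refine exists_congr fun c => ?_
    have h1 : ∀ q : Fin F.card, (φ.relabel (Sum.elim Sum.inr (Sum.elim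
          (fun y => Sum.inl (Sum.inr (q, y))) (fun y => Sum.inl (Sum.inl ⟨b y, hb y⟩)))) :
          L.Formula ((A ⊕ (Fin F.card × Y)) ⊕ X)).Realize
        (Sum.elim (Sum.elim (fun e : A => (e : N))
          (fun q => a (t.orderEmbOfFin ht q.1) q.2)) c) ↔
        φ.Realize (Sum.elim c (Sum.elim (a (t.orderEmbOfFin ht q)) b)) := by
      intro q
      rw [Formula.realize_relabel]
      congr! 1
      funext y
      rcases y with y | y | y <;> rfl
    simp only [h1, Finset.mem_univ, true_imp_iff]
    constructor
    · exact fun h q => h _ (Finset.orderEmbOfFin_mem t ht q)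
    · intro h j hj
      have : j ∈ Set.range (t.orderEmbOfFin ht) := by
        rw [Finset.range_orderEmbOfFin]; exact hj
      obtain ⟨q, rfl⟩ := this
      exact h q
  rw [key F rfl]
  rw [key s hs] at hcon
  exact (ha.exists_iff (OrderEmbedding.strictMono _) (OrderEmbedding.strictMono _) _ _).1 hcon

/-- The function `h` builds the new tuple: each coordinate is either a coordinate of one of the `K`
terms in the block or a fixed element of the base. -/
theorem IndiscernibleOver.blocks {Y Y' : Type} {A A' : Set N} {a : ℕ → Y → N}
    (ha : IndiscernibleOver L A a) (hA : A' ⊆ A) (K : ℕ) (h : Y' → (Fin K × Y) ⊕ A) :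
    IndiscernibleOver L A'
      (fun j y => Sum.elim (fun q => a (K * j + q.1) q.2) (fun e : A => (e : N)) (h y)) := by
  intro r s t hs ht θ
  -- `S s` lists the positions covered by the chosen blocks; it is increasing because the blocks are
  -- disjoint intervals of length `K`.
  let S : (Fin r → ℕ) → Fin (r * K) → ℕ := fun s i =>
    K * s (finProdFinEquiv.symm i).1 + (finProdFinEquiv.symm i).2
  have hS : ∀ s : Fin r → ℕ, StrictMono s → StrictMono (S s) := by
    intro s hs i i' hii'
    obtain ⟨⟨q, o⟩, rfl⟩ := finProdFinEquiv.surjective i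
    obtain ⟨⟨q', o'⟩, rfl⟩ := finProdFinEquiv.surjective i'
    simp only [S, Equiv.symm_apply_apply]
    have hlt : (o : ℕ) + K * q < o' + K * q' := hii'
    have ho := o.2
    have ho' := o'.2
    rcases lt_trichotomy q q' with hq | hq | hq
    · have h1 : s q + 1 ≤ s q' := hs hq
      have h2 : K * (s q + 1) ≤ K * s q' := Nat.mul_le_mul_left _ h1
      rw [Nat.mul_add] at h2
      omega
    · subst hq; omega
    · have h1 : (q' : ℕ) + 1 ≤ q := hq
      have h2 : K * ((q' : ℕ) + 1) ≤ K * q := Nat.mul_le_mul_left _ h1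
      rw [Nat.mul_add] at h2
      omega
  have key : ∀ s : Fin r → ℕ, (θ.Realize (Sum.elim (fun e : A' => (e : N)) (fun q : Fin r × Y' =>
      Sum.elim (fun q' => a (K * s q.1 + q'.1) q'.2) (fun e : A => (e : N)) (h q.2))) ↔
      (θ.relabel (Sum.elim (fun e => Sum.inl (Set.inclusion hA e)) fun q : Fin r × Y' =>
        Sum.elim (fun q' => Sum.inr (finProdFinEquiv (q.1, q'.1), q'.2)) (fun e => Sum.inl e)
          (h q.2)) : L.Formula (A ⊕ (Fin (r * K) × Y))).Realize
      (Sum.elim (fun e : A => (e : N)) (fun q : Fin (r * K) × Y => a (S s q.1) q.2))) := by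
    intro s
    rw [Formula.realize_relabel]
    congr! 1
    funext y
    rcases y with e | ⟨q, y⟩
    · rfl
    · simp only [Sum.elim_inr, Function.comp]
      rcases h y with q' | e
      · simp only [Sum.elim_inl, Sum.elim_inr, S, Equiv.symm_apply_apply]
      · rfl
  exact (key s).trans ((ha _ _ _ (hS s hs) (hS t ht) _).trans (key t).symm)

theorem mem_otherRows {I : Type x} {m : I → ℕ} {a : ∀ i, ℕ → Fin (m i) → N} {i j : I} (h : j ≠ i)
    {e : N} (he : e ∈ rowSet (a j)) : e ∈ ⋃ j ∈ {j | j ≠ i}, rowSet (a j) :=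
  Set.mem_biUnion (x := j) h he

/-- Fixed elements may come only from rows outside the range of `h`: these lie in the base over
which each kept row is indiscernible. -/
theorem MutuallyIndiscernible.blocks {I : Type x} {I' : Type y} {m : I → ℕ}
    {a : ∀ i, ℕ → Fin (m i) → N} (ha : MutuallyIndiscernible L a) {h : I' → I}
    (hinj : Function.Injective h) (m' K : I' → ℕ)
    (H : ∀ i, Fin (m' i) → (Fin (K i) × Fin (m (h i))) ⊕ (⋃ j ∈ (Set.range h)ᶜ, rowSet (a j))) :
    MutuallyIndiscernible L (m := m') (fun i j y =>
      Sum.elim (fun q => a (h i) (K i * j + q.1) q.2)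
        (fun e : (⋃ j ∈ (Set.range h)ᶜ, rowSet (a j) : Set N) => (e : N)) (H i y)) := by
  have hB : ∀ i, (⋃ j ∈ (Set.range h)ᶜ, rowSet (a j)) ⊆ ⋃ j ∈ {j | j ≠ h i}, rowSet (a j) := by
    intro i
    refine Set.iUnion₂_mono' fun j hj => ⟨j, ?_, subset_rfl⟩
    rintro rfl
    exact hj ⟨i, rfl⟩
  intro i
  have := (ha (h i)).blocks (A' := ⋃ j ∈ {j | j ≠ i}, rowSet (fun k (y : Fin (m' j)) =>
      Sum.elim (fun q => a (h j) (K j * k + q.1) q.2)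
        (fun e : (⋃ j ∈ (Set.range h)ᶜ, rowSet (a j) : Set N) => (e : N)) (H j y))) ?_ (K i)
    (fun y => (H i y).map id (Set.inclusion (hB i)))
  · convert this using 3 with k y
    dsimp only
    rcases H i y with q | e <;> rfl
  · refine Set.iUnion₂_subset fun j hj => ?_
    rintro _ ⟨k, y, rfl⟩
    dsimp only
    rcases H j y with q | e
    · exact mem_otherRows (fun hh => hj (hinj hh)) ⟨_, _, rfl⟩
    · exact hB i e.2

theorem MutuallyIndiscernible.map {N' : Type w} [L.Structure N'] (f : N ↪ₑ[L] N') {I : Type x}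
    {m : I → ℕ} {a : ∀ i, ℕ → Fin (m i) → N} (ha : MutuallyIndiscernible L a) :
    MutuallyIndiscernible L (fun i j y => f (a i j y)) := by
  intro i r s t hs ht θ
  have hA : ∀ e : (⋃ j ∈ {j | j ≠ i}, rowSet (fun k (y : Fin (m j)) => f (a j k y)) : Set N'),
      ∃ e' : (⋃ j ∈ {j | j ≠ i}, rowSet (a j) : Set N), (e : N') = f e' := by
    rintro ⟨e, he⟩
    simp only [Set.mem_iUnion] at he
    obtain ⟨j, hj, k, y, rfl⟩ := he
    exact ⟨⟨a j k y, mem_otherRows hj ⟨k, y, rfl⟩⟩, rfl⟩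
  choose ρ hρ using hA
  have key : ∀ s : Fin r → ℕ, (θ.Realize (Sum.elim (fun e => (e : N'))
      (fun q : Fin r × Fin (m i) => f (a i (s q.1) q.2))) ↔
      (θ.relabel (Sum.map ρ id)).Realize (Sum.elim (fun e => (e : N))
        (fun q : Fin r × Fin (m i) => a i (s q.1) q.2))) := by
    intro s
    rw [← f.map_formula, Formula.realize_relabel]
    congr! 1
    funext y
    rcases y with e | q
    · exact hρ e
    · rfl
  exact (key s).trans ((ha i r s t hs ht _).trans (key t).symm)

end Indiscernible

/-! ### Patterns over an arbitrary index set -/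

section PatternOn

variable {M : Type w} [L.Structure M] {X : Type x}

/-- The patterns of `HasInpPatternWith`, with rows indexed by an arbitrary type. -/
def HasPatternOn (p : PartialType L M X) (I : Type y) (R : I → I → Prop) : Prop :=
  ∃ (N : Type w) (_ : L.Structure N) (f : M ↪ₑ[L] N)
    (m l : I → ℕ) (φ : ∀ i, L.Formula (X ⊕ (Fin (m i) ⊕ Fin (l i))))
    (a : ∀ i, ℕ → Fin (m i) → N) (b : ∀ i, Fin (l i) → N),
    MutuallyIndiscernible L a ∧
    (∀ i t, ∃ j, R j i ∧ b i t ∈ rowSet (a j)) ∧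
    Consistent (p.over f ∪ Set.range fun i => plug (φ i) (Sum.elim (a i 0) (b i))) ∧
    ∀ i, ¬ Consistent (Set.range fun j => plug (φ i) (Sum.elim (a i j) (b i)))

theorem HasPatternOn.mono {p : PartialType L M X} {I : Type y} {R R' : I → I → Prop}
    (h : HasPatternOn p I R) (hR : ∀ j i, R j i → R' j i) : HasPatternOn p I R' := by
  obtain ⟨N, _, f, m, l, φ, a, b, h1, h2, h3⟩ := h
  refine ⟨N, _, f, m, l, φ, a, b, h1, fun i t => ?_, h3⟩
  obtain ⟨j, hj, hb⟩ := h2 i t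
  exact ⟨j, hR _ _ hj, hb⟩

/-- After extraction no parameters are needed, so the relation can be taken to be empty. -/
theorem hasPatternOn_of_inpPattern [Nonempty M] {p : PartialType L M X} {κ : Cardinal.{w}}
    (h : HasInpPattern p κ) : HasPatternOn p κ.ord.ToType (fun _ _ => False) := by
  classical
  obtain ⟨N, _, f, m, φ, a, k, hk, hcon⟩ := h
  have : Nonempty N := Nonempty.map f inferInstance
  obtain ⟨N', _, f', c, hc, H⟩ := exists_mutuallyIndiscernible (L := L) a
  have : Nonempty N' := Nonempty.map f' inferInstance
  refine ⟨N', _, f'.comp f, m, fun _ => 0,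
    fun i => (φ i).relabel (Sum.elim Sum.inl fun y => Sum.inr (Sum.inl y)), c,
    fun _ => Fin.elim0, hc, fun _ t => t.elim0, ?_, fun i => ?_⟩
  · rw [consistent_over_iff]
    intro s F
    obtain ⟨ψ, hψ⟩ := exists_exFormula₂.{u, v, w} (Z := N ⊕ Σ i, ℕ × Fin (m i)) (X := X) s
      (fun φ => φ.1.relabel (Sum.map (fun e => Sum.inl (f e)) id)) F
      (fun i => (φ i).relabel (Sum.elim Sum.inr fun y => Sum.inl (Sum.inr ⟨i, 0, y⟩)))
    -- No injectivity is needed here: every path of the original array is consistent.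
    have := H ∅ ψ (fun g _ => by
      rw [hψ]
      have := (consistent_over_iff p f _).1 (hcon fun i => g i 0) s F
      obtain ⟨d, hd1, hd2⟩ := this
      refine ⟨d, fun φ hφ => ?_, fun i hi => ?_⟩
      · rw [Formula.realize_relabel]
        convert hd1 φ hφ using 1
        funext y; rcases y with y | y <;> rfl
      · have := hd2 i hi
        rw [realize_plug] at this
        rw [Formula.realize_relabel]
        convert this using 1
        funext y; rcases y with y | y <;> rfl)
    rw [hψ] at this
    obtain ⟨d, hd1, hd2⟩ := this
    refine ⟨d, fun φ hφ => ?_, fun i hi => ?_⟩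
    · have := hd1 φ hφ
      rw [Formula.realize_relabel] at this
      convert this using 1
      funext y; rcases y with y | y <;> rfl
    · have := hd2 i hi
      rw [Formula.realize_relabel] at this
      rw [realize_plug, Formula.realize_relabel]
      convert this using 1
      funext y; rcases y with y | y <;> rfl
  · rw [not_consistent_range_iff]
    refine ⟨Finset.range (k i), ?_⟩
    obtain ⟨ψ, hψ⟩ := exists_exFormula₁.{u, v, w} (Z := N ⊕ Σ i, ℕ × Fin (m i)) (X := X)
      (Finset.range (k i))
      (fun j => (φ i).relabel (Sum.elim Sum.inr fun y => Sum.inl (Sum.inr ⟨i, j, y⟩)))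
    -- Distinct choices at the first `k i` places of row `i` give `k i` members of the original row.
    have := H ((Finset.range (k i)).image fun j => (i, j)) ψ.not (fun g hg => by
      rw [Formula.realize_not, hψ]
      rintro ⟨d, hd⟩
      have hinj : Set.InjOn (g i) (Finset.range (k i)) := by
        intro j hj j' hj' hjj'
        by_contra hne
        exact hg i j j' (Finset.mem_image_of_mem _ hj) (Finset.mem_image_of_mem _ hj') hne hjj'
      refine hk i ((Finset.range (k i)).image (g i)) (by
        rw [Finset.card_image_of_injOn hinj, Finset.card_range]) ?_
      rw [consistent_image_finset_iff]
      refine ⟨d, fun j hj => ?_⟩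
      obtain ⟨j', hj', rfl⟩ := Finset.mem_image.1 hj
      have := hd _ hj'
      rw [Formula.realize_relabel] at this
      rw [realize_plug]
      convert this using 1
      funext y; rcases y with y | y <;> rfl)
    rw [Formula.realize_not, hψ] at this
    rintro ⟨d, hd⟩
    refine this ⟨d, fun j hj => ?_⟩
    have := hd j hj
    rw [realize_plug, Formula.realize_relabel] at this
    rw [Formula.realize_relabel]
    convert this using 1
    funext y; rcases y with y | y <;> rfl

theorem HasPatternOn.congr {p : PartialType L M X} {I : Type y} {I' : Type z}
    {R : I → I → Prop} {R' : I' → I' → Prop} (h : HasPatternOn p I R) (e : I' ≃ I)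
    (hR : ∀ j i, R (e j) (e i) → R' j i) : HasPatternOn p I' R' := by
  obtain ⟨N, _, f, m, l, φ, a, b, h1, h2, h3, h4⟩ := h
  refine ⟨N, _, f, m ∘ e, l ∘ e, fun i => φ (e i), fun i => a (e i), fun i => b (e i), ?_, ?_, ?_,
    fun i => h4 _⟩
  · have := h1.blocks e.injective (m ∘ e) (fun _ => 1) (fun i y => Sum.inl (0, y))
    simpa using this
  · intro i t
    obtain ⟨j, hj, hb⟩ := h2 (e i) t
    obtain ⟨j, rfl⟩ := e.surjective j
    exact ⟨j, hR _ _ hj, hb⟩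
  · refine h3.mono (Set.union_subset_union_right _ ?_)
    rintro _ ⟨i, rfl⟩
    exact ⟨e i, rfl⟩

/-- An infinite inp³-pattern contains an infinite inp²-pattern: pass to a sequence of rows such that
no parameter lies in a later row of the sequence, and append the parameters from the
omitted rows to the tuples. -/
theorem HasPatternOn.nat {p : PartialType L M X} {I : Type y} [Infinite I]
    (h : HasPatternOn p I (fun j i => j ≠ i)) : HasPatternOn p ℕ (fun j i => j < i) := by
  classical
  obtain ⟨N, _, f, m, l, φ, a, b, h1, h2, h3, h4⟩ := h
  choose ρ hρ hb using h2
  -- Each new row differs from the earlier ones and contains none of the positions `ρ` chosen for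
  -- their parameters; finitely many rows have to be avoided.
  obtain ⟨h, -, hh⟩ := exists_seq_of_forall_finset_exists (α := I) (fun _ => True)
    (fun i i' => i' ≠ i ∧ ∀ t, ρ i t ≠ i') (by
      intro s _
      obtain ⟨i', hi'⟩ := Infinite.exists_notMem_finset (s ∪ s.biUnion fun i =>
        Finset.univ.image (ρ i))
      simp only [Finset.mem_union, Finset.mem_biUnion, Finset.mem_image, Finset.mem_univ,
        true_and, not_or, not_exists, not_and] at hi'
      refine ⟨i', trivial, fun i hi => ⟨?_, fun t ht => hi'.2 i hi t ht⟩⟩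
      rintro rfl
      exact hi'.1 hi)
  have hinj : Function.Injective h := by
    intro n n' hn
    rcases lt_trichotomy n n' with hlt | rfl | hlt
    · exact absurd hn.symm (hh _ _ hlt).1
    · rfl
    · exact absurd hn (hh _ _ hlt).1
  -- Parameters in chosen rows stay parameters; those in omitted rows become constant coordinates of
  -- the tuples.
  let In : ∀ n, Type := fun n => {t : Fin (l (h n)) // ρ (h n) t ∈ Set.range h}
  let Out : ∀ n, Type := fun n => {t : Fin (l (h n)) // ρ (h n) t ∉ Set.range h}
  let eIn : ∀ n, In n ≃ Fin (Fintype.card (In n)) := fun n => Fintype.equivFin _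
  let eOut : ∀ n, (Fin (m (h n)) ⊕ Out n) ≃ Fin (Fintype.card (Fin (m (h n)) ⊕ Out n)) :=
    fun n => Fintype.equivFin _
  let H : ∀ n, Fin (Fintype.card (Fin (m (h n)) ⊕ Out n)) →
      (Fin 1 × Fin (m (h n))) ⊕ (⋃ j ∈ (Set.range h)ᶜ, rowSet (a j)) := fun n y =>
    Sum.map (fun y => (0, y)) (fun t : Out n => ⟨b (h n) t.1,
      Set.mem_biUnion (x := ρ (h n) t.1) t.2 (hb _ _)⟩) ((eOut n).symm y)
  let a' : ∀ n, ℕ → Fin (Fintype.card (Fin (m (h n)) ⊕ Out n)) → N := fun n j y =>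
    Sum.elim (fun q => a (h n) (1 * j + q.1) q.2)
      (fun e : (⋃ j ∈ (Set.range h)ᶜ, rowSet (a j) : Set N) => (e : N)) (H n y)
  have ha'1 : ∀ n j y, a' n j (eOut n (Sum.inl y)) = a (h n) j y := fun n j y => by
    simp [a', H]
  have ha'2 : ∀ n j t, a' n j (eOut n (Sum.inr t)) = b (h n) t.1 := fun n j t => by
    simp [a', H]
  let φ' : ∀ n, L.Formula (X ⊕ (Fin (Fintype.card (Fin (m (h n)) ⊕ Out n)) ⊕
      Fin (Fintype.card (In n)))) := fun n =>
    (φ (h n)).relabel (Sum.elim Sum.inl (Sum.elim (fun y => Sum.inr (Sum.inl (eOut n (Sum.inl y))))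
      (fun t => if ht : ρ (h n) t ∈ Set.range h then Sum.inr (Sum.inr (eIn n ⟨t, ht⟩))
        else Sum.inr (Sum.inl (eOut n (Sum.inr ⟨t, ht⟩))))))
  have hφ' : ∀ n j c, (φ' n).Realize (Sum.elim c (Sum.elim (a' n j)
      (fun t => b (h n) ((eIn n).symm t).1))) ↔
      (φ (h n)).Realize (Sum.elim c (Sum.elim (a (h n) j) (b (h n)))) := by
    intro n j c
    rw [Formula.realize_relabel]
    congr! 1
    funext y
    rcases y with y | y | t
    · rfl
    · exact ha'1 n j y
    · simp only [Function.comp, Sum.elim_inr]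
      split_ifs with ht
      · simp
      · simpa using ha'2 n j ⟨t, ht⟩
  refine ⟨N, _, f, _, _, φ', a', fun n t => b (h n) ((eIn n).symm t).1,
    h1.blocks hinj _ (fun _ => 1) H, ?_, ?_, ?_⟩
  · intro n t
    obtain ⟨⟨t, n', hn'⟩, rfl⟩ := (eIn n).surjective t
    refine ⟨n', ?_, ?_⟩
    · by_contra hlt
      rcases (not_lt.1 hlt).lt_or_eq with hlt | rfl
      · exact (hh _ _ hlt).2 t hn'.symm
      · exact hρ _ _ hn'.symm
    · obtain ⟨j, y, hj⟩ := hb (h n) t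
      simp only [Equiv.symm_apply_apply]
      rw [hj]
      revert y
      rw [← hn']
      intro y _
      exact ⟨j, eOut n' (Sum.inl y), (ha'1 _ _ _).symm⟩
  · rw [consistent_over_iff] at h3 ⊢
    intro s F
    obtain ⟨c, hc1, hc2⟩ := h3 s (F.image h)
    refine ⟨c, hc1, fun n hn => ?_⟩
    have := hc2 (h n) (Finset.mem_image_of_mem _ hn)
    rw [realize_plug] at this ⊢
    exact (hφ' n 0 c).2 this
  · intro n
    have := h4 (h n)
    rw [not_consistent_range_iff] at this ⊢
    simpa only [realize_plug, hφ'] using this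

/-- A solution in a further elementary extension replaces the consistent set, and the partial type
is then no longer needed. -/
theorem HasPatternOn.exists_realized [Nonempty M] {n : ℕ} {p : PartialType L M (Fin n)}
    {I : Type y} {R : I → I → Prop} (h : HasPatternOn p I R) :
    ∃ (N : Type w) (_ : L.Structure N) (_ : M ↪ₑ[L] N)
      (m l : I → ℕ) (φ : ∀ i, L.Formula (Fin n ⊕ (Fin (m i) ⊕ Fin (l i))))
      (a : ∀ i, ℕ → Fin (m i) → N) (b : ∀ i, Fin (l i) → N) (c : Fin n → N),
      MutuallyIndiscernible L a ∧
      (∀ i t, ∃ j, R j i ∧ b i t ∈ rowSet (a j)) ∧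
      (∀ i, (φ i).Realize (Sum.elim c (Sum.elim (a i 0) (b i)))) ∧
      ∀ i, ¬ Consistent (Set.range fun j => plug (φ i) (Sum.elim (a i j) (b i))) := by
  obtain ⟨N, _, f, m, l, φ, a, b, h1, h2, h3, h4⟩ := h
  have : Nonempty N := Nonempty.map f inferInstance
  obtain ⟨N', _, f', c, hc⟩ := (h3.mono Set.subset_union_right).exists_realize
  refine ⟨N', _, f'.comp f, m, l, φ, fun i j y => f' (a i j y), fun i t => f' (b i t), c,
    h1.map f', fun i t => ?_, fun i => ?_, fun i => ?_⟩
  · obtain ⟨j, hj, k, y, hy⟩ := h2 i t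
    exact ⟨j, hj, k, y, congrArg f' hy⟩
  · have := hc _ ⟨i, rfl⟩
    dsimp only [plug] at this
    rw [Formula.realize_relabel] at this
    convert this using 1
    funext y; rcases y with y | y | y <;> rfl
  · refine (consistent_range_elementary_iff f' fun j c => ?_).not.2 (h4 i)
    rw [realize_plug]
    dsimp only [plug]
    rw [Formula.realize_relabel]
    congr! 1
    funext y; rcases y with y | y | y <;> rfl

end PatternOn


variable {L : FirstOrder.Language.{u, v}}

/-! ### Burdens -/

theorem CardStar.sup_ofCard_le_belowAleph0_iff {S : Set Cardinal.{w}} :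
    CardStar.sup (CardStar.ofCard '' S) ≤ CardStar.belowAleph0 ↔ ∀ κ ∈ S, κ < ℵ₀ := by
  rw [isLUB_le_iff (CardStar.isLUB_sup _), mem_upperBounds, Set.forall_mem_image]
  exact forall₂_congr fun κ _ => CardStar.ofCard_le_below_iff _

theorem CardStar.sup_mono {S S' : Set CardStar.{w}} (h : S ⊆ S') : sup S ≤ sup S' :=
  (isLUB_sup S).mono (isLUB_sup S') h

section Burden

variable {M : Type w} [L.Structure M] {X : Type x} (p : PartialType L M X)

theorem bdn_le_bdn2 [Nonempty M] : bdn p ≤ bdn2 p :=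
  CardStar.sup_mono (Set.image_mono fun _ hκ =>
    (hasPatternOn_of_inpPattern hκ).mono fun _ _ h => h.elim)

theorem bdn2_le_bdn3 : bdn2 p ≤ bdn3 p :=
  CardStar.sup_mono (Set.image_mono fun _ hκ => HasPatternOn.mono hκ fun _ _ h => h.ne)

theorem infinite_ord_toType {κ : Cardinal.{w}} (h : ℵ₀ ≤ κ) : Infinite κ.ord.ToType := by
  rw [Cardinal.infinite_iff, Cardinal.mk_ord_toType]
  exact h

theorem exists_nat_equiv_aleph0 : ∃ e : (ℵ₀ : Cardinal.{w}).ord.ToType ≃ ℕ,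
    ∀ i j, i < j ↔ e i < e j := by
  have h : Ordinal.lift.{0} (Ordinal.type (α := (ℵ₀ : Cardinal.{w}).ord.ToType) (· < ·)) =
      Ordinal.lift.{w} (Ordinal.type (α := ℕ) (· < ·)) := by
    simp
  obtain ⟨e⟩ := Ordinal.lift_type_eq.1 h
  exact ⟨e.toEquiv, fun i j => e.map_rel_iff.symm⟩

variable {p}

theorem HasPatternOn.inp2Pattern_aleph0 (h : HasPatternOn p ℕ (fun j i => j < i)) :
    HasInp2Pattern p ℵ₀ := by
  obtain ⟨e, he⟩ := exists_nat_equiv_aleph0.{w}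
  exact h.congr e fun j i hji => (he j i).2 hji

/-- The right-hand side is the same as for `bdn2`, which is why strong² and strong³ coincide. -/
theorem bdn3_le_belowAleph0_iff :
    bdn3 p ≤ CardStar.belowAleph0 ↔ ¬ HasPatternOn p ℕ (fun j i => j < i) := by
  rw [bdn3, CardStar.sup_ofCard_le_belowAleph0_iff]
  constructor
  · exact fun h hp => (h ℵ₀ (HasPatternOn.mono hp.inp2Pattern_aleph0 fun _ _ h => h.ne)).false
  · intro h κ hκ
    by_contra hlt
    have := infinite_ord_toType (not_lt.1 hlt)
    exact h (HasPatternOn.nat hκ)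

theorem bdn2_le_belowAleph0_iff :
    bdn2 p ≤ CardStar.belowAleph0 ↔ ¬ HasPatternOn p ℕ (fun j i => j < i) := by
  refine ⟨fun h hp => ?_, fun h => (bdn2_le_bdn3 p).trans (bdn3_le_belowAleph0_iff.2 h)⟩
  rw [bdn2, CardStar.sup_ofCard_le_belowAleph0_iff] at h
  exact (h ℵ₀ hp.inp2Pattern_aleph0).false

variable (L M X) in
/-- The partial type without formulas. -/
def trivialType [Nonempty M] : PartialType L M X where
  formulas := ∅
  consistent := fun _ hΦ₀ _ => ⟨fun _ => Classical.arbitrary M, fun _ hφ => (hΦ₀ hφ).elim⟩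

theorem trivialType_over [Nonempty M] {N : Type w} [L.Structure N] (f : M ↪ₑ[L] N) :
    (trivialType L M X).over f = ∅ := Set.image_empty _

end Burden

/-! ### Theories -/

section Theories

variable {T : L.Theory}

theorem strong2_iff_strong3 : Strong2 T ↔ Strong3 T :=
  forall₃_congr fun _ _ _ => bdn2_le_belowAleph0_iff.trans bdn3_le_belowAleph0_iff.symm

theorem Strong2.strong (h : Strong2 T) : Strong T := fun M n p => (bdn_le_bdn2 p).trans (h M n p)

/-- An elementary extension of a model of `T`, as a model of `T`. -/
abbrev modelOfElementary {M : T.ModelType.{u, v, max u v}} {N : Type (max u v)} [L.Structure N]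
    (f : M ↪ₑ[L] N) : T.ModelType.{u, v, max u v} :=
  have : N ⊨ T := (f.theory_model_iff T).1 inferInstance
  have : Nonempty N := Nonempty.map f inferInstance
  Theory.ModelType.of T N

/-- A failure of strength², in a realized form. -/
theorem exists_realized_of_not_strong2 (h : ¬ Strong2 T) :
    ∃ (N : T.ModelType.{u, v, max u v}) (n : ℕ)
      (m l : ℕ → ℕ) (φ : ∀ i, L.Formula (Fin n ⊕ (Fin (m i) ⊕ Fin (l i))))
      (a : ∀ i, ℕ → Fin (m i) → N) (b : ∀ i, Fin (l i) → N) (c : Fin n → N),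
      MutuallyIndiscernible L a ∧
      (∀ i t, ∃ j, j < i ∧ b i t ∈ rowSet (a j)) ∧
      (∀ i, (φ i).Realize (Sum.elim c (Sum.elim (a i 0) (b i)))) ∧
      ∀ i, ¬ Consistent (Set.range fun j => plug (φ i) (Sum.elim (a i j) (b i))) := by
  simp only [Strong2, not_forall, bdn2_le_belowAleph0_iff, not_not] at h
  obtain ⟨M, n, p, h⟩ := h
  obtain ⟨N, _, f, h⟩ := h.exists_realized
  exact ⟨modelOfElementary f, n, h⟩

/-- A finite base `A` lies in the rows before some `i`. Row `i` is indiscernible over `A` and `b i`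
together, so the tuples `(a i j, b i)` witness that a formula true of `c` divides over `A`. -/
theorem Supersimple.strong2 (hT : Supersimple T) : Strong2 T := by
  by_contra h
  obtain ⟨N, n, m, l, φ, a, b, c, h1, h2, h3, h4⟩ := exists_realized_of_not_strong2 h
  obtain ⟨A, hA, hfin, hdiv⟩ := hT N n c (⋃ i, rowSet (a i))
  have hrow : ∃ i, A ⊆ ⋃ j ∈ {j | j < i}, rowSet (a j) := by
    have : ∀ e : A, ∃ i, e.1 ∈ rowSet (a i) := fun e => by simpa using hA e.2
    choose r hr using this
    have := hfin.to_subtype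
    obtain ⟨k, hk⟩ := (Set.finite_range r).bddAbove
    refine ⟨k + 1, fun e he => Set.mem_biUnion (x := r ⟨e, he⟩) ?_ (hr ⟨e, he⟩)⟩
    exact Nat.lt_succ_of_le (hk ⟨_, rfl⟩)
  obtain ⟨i, hi⟩ := hrow
  have hb : ∀ t, b i t ∈ ⋃ j ∈ {j | j ≠ i}, rowSet (a j) := fun t => by
    obtain ⟨j, hj, h⟩ := h2 i t
    exact mem_otherRows hj.ne h
  have hA' : A ⊆ ⋃ j ∈ {j | j ≠ i}, rowSet (a j) := hi.trans
    (Set.biUnion_mono (fun j hj => ne_of_lt hj) fun _ _ => subset_rfl)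
  obtain ⟨k, hk⟩ := (h1 i).exists_kInconsistent (φ i) hb (h4 i)
  let e : Fin (m i + l i) ≃ Fin (m i) ⊕ Fin (l i) := finSumFinEquiv.symm
  let d : ℕ → Fin (m i + l i) → N := fun j => Sum.elim (a i j) (b i) ∘ e
  have hplug : ∀ (j : ℕ) (c : Fin n → N), ((φ i).relabel (Sum.map id e.symm)).Realize
      (Sum.elim c (d j)) ↔ (φ i).Realize (Sum.elim c (Sum.elim (a i j) (b i))) := by
    intro j c
    rw [Formula.realize_relabel]
    congr! 1
    funext y
    rcases y with y | y <;> simp [d]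
  refine hdiv ⟨m i + l i, (φ i).relabel (Sum.map id e.symm), d 0, ?_, (hplug 0 c).2 (h3 i),
    N, inferInstance, ElementaryEmbedding.refl L N, d, k, ?_, ?_⟩
  · intro t
    obtain ⟨t, rfl⟩ := e.symm.surjective t
    rcases t with t | t
    · simp only [d, Function.comp, Equiv.apply_symm_apply]
      exact Set.mem_iUnion.2 ⟨i, 0, t, rfl⟩
    · simp only [d, Function.comp, Equiv.apply_symm_apply]
      obtain ⟨j, -, h⟩ := h2 i t
      exact Set.mem_iUnion.2 ⟨j, h⟩
  · intro j θ
    have hmem : ∀ e : (ElementaryEmbedding.refl L N '' A : Set N),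
        e.1 ∈ ⋃ j ∈ {j | j ≠ i}, rowSet (a j) := by
      rintro ⟨_, e, he, rfl⟩
      exact hA' he
    have key : ∀ j, θ.Realize (Sum.elim (fun e => (e : N)) (d j)) ↔
        (θ.relabel (Sum.elim (fun e => Sum.inl ⟨e.1, hmem e⟩) fun t =>
          Sum.elim (fun y => Sum.inr (0, y)) (fun t => Sum.inl ⟨b i t, hb t⟩) (e t)) :
          L.Formula ((⋃ j ∈ {j | j ≠ i}, rowSet (a j) : Set N) ⊕ (Fin 1 × Fin (m i)))).Realize
        (Sum.elim (fun e => (e : N)) (fun q => a i ((fun _ : Fin 1 => j) q.1) q.2)) := by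
      intro j
      rw [Formula.realize_relabel]
      congr! 1
      funext y
      rcases y with y | y
      · rfl
      · simp only [Sum.elim_inr, Function.comp, d]
        rcases e y with y | y <;> rfl
    refine (key j).trans (Iff.trans ?_ (key 0).symm)
    exact h1 i 1 (fun _ => j) (fun _ => 0) (Subsingleton.strictMono _) (Subsingleton.strictMono _) _
  · intro s hs
    have := hk s hs
    rw [consistent_image_finset_iff] at this ⊢
    simpa only [realize_plug, hplug] using this

theorem Strongly2Dependent.strong2 (hT : Strongly2Dependent T) : Strong2 T := by
  by_contra h
  obtain ⟨N, n, m, l, φ, a, b, c, h1, h2, h3, h4⟩ := exists_realized_of_not_strong2 h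
  have hK : ∀ i, ∃ K, ¬ (φ i).Realize (Sum.elim c (Sum.elim (a i K) (b i))) := by
    intro i
    by_contra hcon
    push Not at hcon
    refine h4 i ((consistent_range_iff _).2 fun F => ⟨c, fun j _ => ?_⟩)
    rw [realize_plug]
    exact hcon j
  choose K hK using hK
  have hK0 : ∀ i, 0 < K i := fun i => Nat.pos_of_ne_zero fun h0 => hK i (h0 ▸ h3 i)
  -- With blocks of length `K i`, the first tuples of blocks 0 and 1 are `a i 0` and `a i (K i)`,
  -- where the formula holds and fails at `c`.
  let H : ∀ i, Fin (K i * m i) → (Fin (K i) × Fin (m i)) ⊕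
      (⋃ j ∈ (Set.range (id : ℕ → ℕ))ᶜ, rowSet (a j) : Set N) :=
    fun i y => Sum.inl (finProdFinEquiv.symm y)
  refine hT ⟨N, n, fun i => K i * m i, l, fun i => (φ i).relabel (Sum.map id
    (Sum.map (fun y => finProdFinEquiv (⟨0, hK0 i⟩, y)) id)), _, b,
    h1.blocks Function.injective_id _ K H, fun i t => ?_, ?_⟩
  · obtain ⟨j, hj, k, y, hy⟩ := h2 i t
    -- Regrouping moves position `k` of row `j` to offset `k % K j` of block `k / K j`, so the
    -- parameters still lie in the same rows.
    refine ⟨j, hj, k / K j, finProdFinEquiv (⟨k % K j, Nat.mod_lt _ (hK0 j)⟩, y), ?_⟩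
    simp only [H, Equiv.symm_apply_apply, Sum.elim_inl, id, Nat.div_add_mod]
    exact hy
  · rw [consistent_range_iff]
    refine fun F => ⟨c, fun i _ => ?_⟩
    have key : ∀ j, ((φ i).relabel (Sum.map id (Sum.map
        (fun y => finProdFinEquiv ((⟨0, hK0 i⟩ : Fin (K i)), y)) id))).Realize
        (Sum.elim c (Sum.elim (fun y => Sum.elim (fun q => a (id i) (K i * j + q.1) q.2)
        (fun e : (⋃ j ∈ (Set.range (id : ℕ → ℕ))ᶜ, rowSet (a j) : Set N) => (e : N)) (H i y))
        (b i))) ↔ (φ i).Realize (Sum.elim c (Sum.elim (a i (K i * j)) (b i))) := by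
      intro j
      rw [Formula.realize_relabel]
      congr! 1
      funext y
      rcases y with y | y | y
      · rfl
      · simp only [Function.comp, Sum.map_inr, Sum.map_inl, Sum.elim_inr, Sum.elim_inl, H,
          Equiv.symm_apply_apply, id, Nat.add_zero]
      · rfl
    rw [Formula.realize_inf, Formula.realize_not, realize_plug, realize_plug]
    exact ⟨(key 0).2 (h3 i), fun h => hK i (by simpa using (key 1).1 h)⟩

/-- `Nat.pair` cuts a sequence with the independence property into infinitely many rows. After
extraction, the formula may hold at place 0 and fail at place 1 in all rows at once. -/
theorem Strongly2Dependent.nip (hT : Strongly2Dependent T) : NIP T := by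
  classical
  rintro ⟨M, n, m, φ, a, h⟩
  obtain ⟨N, _, f, c, hc, H⟩ := exists_mutuallyIndiscernible (L := L) (I := ℕ) (m := fun _ => m)
    (fun i j => a (Nat.pair i j))
  have : Nonempty N := Nonempty.map f inferInstance
  refine hT ⟨modelOfElementary f, n, fun _ => m, fun _ => 0, fun _ => φ.relabel
    (Sum.elim Sum.inl fun y => Sum.inr (Sum.inl y)), c, fun _ => Fin.elim0, hc,
    fun _ t => t.elim0, ?_⟩
  rw [consistent_range_iff]
  intro F
  let χ : ℕ → L.Formula ((M ⊕ Σ _ : ℕ, ℕ × Fin m) ⊕ Fin n) := fun i =>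
    φ.relabel (Sum.elim Sum.inr fun y => Sum.inl (Sum.inr ⟨i, 0, y⟩)) ⊓
    (φ.relabel (Sum.elim Sum.inr fun y => Sum.inl (Sum.inr ⟨i, 1, y⟩))).not
  have hχ : ∀ (N : Type (max u v)) [L.Structure N] (g : M → N) (c : ℕ → ℕ → Fin m → N) (i : ℕ)
      (d : Fin n → N), (χ i).Realize (Sum.elim (Sum.elim g fun y => c y.1 y.2.1 y.2.2) d) ↔
      φ.Realize (Sum.elim d (c i 0)) ∧ ¬ φ.Realize (Sum.elim d (c i 1)) := by
    intro N _ g c i d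
    rw [Formula.realize_inf, Formula.realize_not, Formula.realize_relabel,
      Formula.realize_relabel]
    congr! 3 <;> (funext y; rcases y with y | y <;> rfl)
  obtain ⟨ψ, hψ⟩ := exists_exFormula₁.{u, v, max u v} F χ
  have := H (F ×ˢ {0, 1}) ψ (fun g hg => by
    rw [hψ]
    -- The set prescribes truth at the members chosen for place 0. Those chosen for place 1 lie
    -- outside it, as `Nat.pair` separates rows and `g` separates the two places.
    obtain ⟨d, hd⟩ := h {k | ∃ i ∈ F, k = Nat.pair i (g i 0)}
      ((fun i => plug φ (a (Nat.pair i (g i 0)))) '' F ∪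
        (fun i => (plug φ (a (Nat.pair i (g i 1)))).not) '' F) (by
        refine Set.union_subset_union ?_ ?_
        · rintro _ ⟨i, hi, rfl⟩
          exact ⟨_, ⟨i, hi, rfl⟩, rfl⟩
        · rintro _ ⟨i, hi, rfl⟩
          refine ⟨_, ?_, rfl⟩
          rintro ⟨i', hi', h⟩
          obtain ⟨rfl, h⟩ := Nat.pair_eq_pair.1 h
          exact hg i 1 0 (by simpa using hi') (by simpa using hi') one_ne_zero h)
      ((F.finite_toSet.image _).union (F.finite_toSet.image _))
    refine ⟨d, fun i hi => ?_⟩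
    refine (hχ M id (fun i j => a (Nat.pair i (g i j))) i d).2 ⟨?_, ?_⟩
    · have := hd _ (Or.inl ⟨i, hi, rfl⟩)
      rwa [realize_plug] at this
    · have := hd _ (Or.inr ⟨i, hi, rfl⟩)
      rwa [Formula.realize_not, realize_plug] at this)
  rw [hψ] at this
  obtain ⟨d, hd⟩ := this
  refine ⟨d, fun i hi => ?_⟩
  have := (hχ N f c i d).1 (hd i hi)
  have key : ∀ j, (plug (φ.relabel (Sum.elim Sum.inl fun y => Sum.inr (Sum.inl y)) :
      L.Formula (Fin n ⊕ (Fin m ⊕ Fin 0))) (Sum.elim (c i j) Fin.elim0)).Realize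
      (Sum.elim id d) ↔ φ.Realize (Sum.elim d (c i j)) := by
    intro j
    rw [realize_plug, Formula.realize_relabel]
    congr! 1
    funext y; rcases y with y | y <;> rfl
  exact Formula.realize_inf.2 ⟨(key 0).2 this.1, Formula.realize_not.2 fun h => this.2 ((key 1).1 h)⟩

end Theories


/-! ### Alternation along indiscernible sequences and NIP -/

variable {L : FirstOrder.Language.{u, v}} {T : L.Theory}

/-- An indiscernible sequence along which the truth value of a formula alternates yields the
independence property. -/
theorem IndiscernibleOver.exists_of_alternating {N : Type w} [L.Structure N] [Nonempty N]
    {Y Z : Type} {A : Set N} {a : ℕ → Y → N} (ha : IndiscernibleOver L A a) {X : Type x}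
    (φ : L.Formula (X ⊕ (Y ⊕ Z))) {b : Z → N} (hb : ∀ t, b t ∈ A)
    (h : ∀ k : ℕ, ∃ d : X → N, ∀ j < k, φ.Realize (Sum.elim d (Sum.elim (a (2 * j)) b)) ∧
      ¬ φ.Realize (Sum.elim d (Sum.elim (a (2 * j + 1)) b)))
    (S : Set ℕ) (k : ℕ) : ∃ d : X → N, ∀ j < k,
      (φ.Realize (Sum.elim d (Sum.elim (a j) b)) ↔ j ∈ S) := by
  classical
  let χ : Fin k → L.Formula ((A ⊕ (Fin k × Y)) ⊕ X) := fun q =>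
    let θ : L.Formula ((A ⊕ (Fin k × Y)) ⊕ X) :=
      φ.relabel (Sum.elim Sum.inr (Sum.elim (fun y => Sum.inl (Sum.inr (q, y)))
        (fun y => Sum.inl (Sum.inl ⟨b y, hb y⟩))))
    if (q : ℕ) ∈ S then θ else θ.not
  have hχ : ∀ (s : Fin k → ℕ) q d, (χ q).Realize (Sum.elim (Sum.elim (fun e : A => (e : N))
      (fun q => a (s q.1) q.2)) d) ↔
      (φ.Realize (Sum.elim d (Sum.elim (a (s q)) b)) ↔ (q : ℕ) ∈ S) := by
    intro s q d
    have h1 : (φ.relabel (Sum.elim Sum.inr (Sum.elim (fun y => Sum.inl (Sum.inr (q, y)))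
        (fun y => Sum.inl (Sum.inl ⟨b y, hb y⟩)))) : L.Formula ((A ⊕ (Fin k × Y)) ⊕ X)).Realize
        (Sum.elim (Sum.elim (fun e : A => (e : N)) (fun q => a (s q.1) q.2)) d) ↔
        φ.Realize (Sum.elim d (Sum.elim (a (s q)) b)) := by
      rw [Formula.realize_relabel]
      congr! 1
      funext y; rcases y with y | y | y <;> rfl
    by_cases hq : (q : ℕ) ∈ S
    · simp only [χ, if_pos hq, hq, iff_true]; exact h1
    · simp only [χ, if_neg hq, hq, iff_false]
      exact Formula.realize_not.trans (not_congr h1)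
  -- From the pair `2q`, `2q + 1` the position with the desired truth value is selected; this
  -- subsequence is then compared with `0, …, k - 1`.
  let s : Fin k → ℕ := fun q => 2 * q + if (q : ℕ) ∈ S then 0 else 1
  have hs : StrictMono s := by
    intro q q' hq
    have : (q : ℕ) < q' := hq
    simp only [s]
    split_ifs <;> omega
  obtain ⟨d, hd⟩ := (ha.exists_iff hs (fun _ _ h => h : StrictMono fun q : Fin k => (q : ℕ))
    Finset.univ χ).1 (by
      obtain ⟨d, hd⟩ := h k
      refine ⟨d, fun q _ => (hχ s q d).2 ?_⟩
      by_cases hq : (q : ℕ) ∈ S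
      · simpa [s, hq] using (hd q q.2).1
      · simpa [s, hq] using (hd q q.2).2)
  exact ⟨d, fun j hj => (hχ _ ⟨j, hj⟩ d).1 (hd ⟨j, hj⟩ (Finset.mem_univ _))⟩

theorem strongly2Dependent_of_nip_of_strong2 (hnip : NIP T) (hs : Strong2 T) :
    Strongly2Dependent T := by
  classical
  rintro ⟨M, n, m, l, φ, a, b, h1, h2, h3⟩
  let H : ∀ i, Fin (2 * m i) → (Fin 2 × Fin (m i)) ⊕
      (⋃ j ∈ (Set.range (id : ℕ → ℕ))ᶜ, rowSet (a j) : Set M) :=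
    fun i y => Sum.inl (finProdFinEquiv.symm y)
  let a' : ∀ i, ℕ → Fin (2 * m i) → M := fun i j y =>
    Sum.elim (fun q => a (id i) (2 * j + q.1) q.2)
      (fun e : (⋃ j ∈ (Set.range (id : ℕ → ℕ))ᶜ, rowSet (a j) : Set M) => (e : M)) (H i y)
  let sel : ∀ i, Fin 2 → L.Formula (Fin n ⊕ (Fin (2 * m i) ⊕ Fin (l i))) := fun i o =>
    (φ i).relabel (Sum.map id (Sum.map (fun y => finProdFinEquiv (o, y)) id))
  have hsel : ∀ i o j d, (sel i o).Realize (Sum.elim d (Sum.elim (a' i j) (b i))) ↔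
      (φ i).Realize (Sum.elim d (Sum.elim (a i (2 * j + o)) (b i))) := by
    intro i o j d
    rw [Formula.realize_relabel]
    congr! 1
    funext y
    rcases y with y | y | y
    · rfl
    · simp only [Function.comp, Sum.map_inr, Sum.map_inl, Sum.elim_inr, Sum.elim_inl, H, a',
        Equiv.symm_apply_apply, id]
    · rfl
  let φ' : ∀ i, L.Formula (Fin n ⊕ (Fin (2 * m i) ⊕ Fin (l i))) := fun i =>
    sel i 0 ⊓ (sel i 1).not
  have hφ' : ∀ i j d, (plug (φ' i) (Sum.elim (a' i j) (b i))).Realize (Sum.elim id d) ↔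
      (φ i).Realize (Sum.elim d (Sum.elim (a i (2 * j)) (b i))) ∧
      ¬ (φ i).Realize (Sum.elim d (Sum.elim (a i (2 * j + 1)) (b i))) := by
    intro i j d
    rw [realize_plug]
    exact Formula.realize_inf.trans (and_congr (hsel i 0 j d)
      (Formula.realize_not.trans (not_congr (hsel i 1 j d))))
  refine bdn2_le_belowAleph0_iff.1 (hs M n (trivialType L M (Fin n)))
    ⟨M, inferInstance, ElementaryEmbedding.refl L M, fun i => 2 * m i, l, φ', a', b,
      h1.blocks Function.injective_id _ (fun _ => 2) H, fun i t => ?_, ?_, fun i hcon => ?_⟩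
  · obtain ⟨j, hj, k, y, hy⟩ := h2 i t
    refine ⟨j, hj, k / 2, finProdFinEquiv (⟨k % 2, Nat.mod_lt _ two_pos⟩, y), ?_⟩
    simp only [a', H, Equiv.symm_apply_apply, Sum.elim_inl, id, Nat.div_add_mod]
    exact hy
  · rw [trivialType_over, Set.empty_union, consistent_range_iff]
    rw [consistent_range_iff] at h3
    intro F
    obtain ⟨d, hd⟩ := h3 F
    refine ⟨d, fun i hi => (hφ' i 0 d).2 ?_⟩
    have := hd i hi
    rw [Formula.realize_inf, Formula.realize_not, realize_plug, realize_plug] at this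
    exact this
  -- If a row of pairs were consistent, the truth value would alternate arbitrarily often along the
  -- original row, against NIP.
  · rw [consistent_range_iff] at hcon
    have hb : ∀ t, b i t ∈ ⋃ j ∈ {j | j ≠ i}, rowSet (a j) := fun t => by
      obtain ⟨j, hj, h⟩ := h2 i t
      exact mem_otherRows hj.ne h
    have key := (h1 i).exists_of_alternating (φ i) hb (fun k => by
      obtain ⟨d, hd⟩ := hcon (Finset.range k)
      exact ⟨d, fun j hj => (hφ' i j d).1 (hd j (Finset.mem_range.2 hj))⟩)
    let ψ : L.Formula (Fin n ⊕ Fin (m i + l i)) := (φ i).relabel (Sum.map id finSumFinEquiv)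
    let e : ℕ → Fin (m i + l i) → M := fun j => Sum.elim (a i j) (b i) ∘ finSumFinEquiv.symm
    have hψ : ∀ j d, (plug ψ (e j)).Realize (Sum.elim id d) ↔
        (φ i).Realize (Sum.elim d (Sum.elim (a i j) (b i))) := by
      intro j d
      rw [realize_plug, Formula.realize_relabel]
      congr! 1
      funext y
      rcases y with y | y <;> simp [e]
    refine hnip ⟨M, n, m i + l i, ψ, e, fun S => ?_⟩
    refine Consistent.mono (Φ := Set.range fun j => if j ∈ S then plug ψ (e j) else
      (plug ψ (e j)).not) ?_ ?_
    · rw [consistent_range_iff]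
      intro F
      obtain ⟨d, hd⟩ := key S (F.sup id + 1)
      refine ⟨d, fun j hj => ?_⟩
      have := hd j (Nat.lt_succ_of_le (Finset.le_sup (f := id) hj))
      rw [← hψ] at this
      by_cases hjS : j ∈ S
      · simp only [if_pos hjS]; exact this.2 hjS
      · simp only [if_neg hjS]; rw [Formula.realize_not]; exact fun h => hjS (this.1 h)
    · rintro _ (⟨j, hj, rfl⟩ | ⟨j, hj, rfl⟩)
      · exact ⟨j, if_pos hj⟩
      · exact ⟨j, if_neg hj⟩

theorem strongly2Dependent_iff : Strongly2Dependent T ↔ NIP T ∧ Strong2 T :=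
  ⟨fun h => ⟨h.nip, h.strong2⟩, fun h => strongly2Dependent_of_nip_of_strong2 h.1 h.2⟩

/-! ### The tree property of the second kind -/

theorem CardStar.sup_ofCard_lt_top_iff {S : Set Cardinal.{w}} :
    CardStar.sup (CardStar.ofCard '' S) < ⊤ ↔ BddAbove S := by
  constructor
  · intro h
    obtain ⟨c, hc⟩ : ∃ c, c = sup (ofCard '' S) := ⟨_, rfl⟩
    have hub : ∀ κ ∈ S, ofCard κ ≤ c := fun κ hκ => hc ▸ (isLUB_sup _).1 ⟨κ, hκ, rfl⟩
    rw [← hc] at h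
    obtain ⟨c, hc'⟩ := c
    cases c with
    | top => exact absurd h (lt_irrefl _)
    | coe c =>
      refine ⟨(ofLex c).1, fun κ hκ => ?_⟩
      have := hub κ hκ
      change (ofCard κ).1 ≤ _ at this
      simp only [ofCard, WithTop.coe_le_coe] at this
      rcases Prod.Lex.le_iff.1 this with h | h
      · exact h.le
      · exact h.1.le
  · rintro ⟨μ, hμ⟩
    refine lt_of_le_of_lt (b := ofCard μ) ((isLUB_le_iff (isLUB_sup _)).2 ?_) ?_
    · rintro _ ⟨κ, hκ, rfl⟩
      exact ofCard_le_ofCard_iff.2 (hμ hκ)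
    · change (ofCard μ).1 < (⊤ : WithTop _)
      exact WithTop.coe_lt_top _

/-- All rows share one formula and one `k`, so `κ` rows can be modelled, finitely many at a time, by
distinct rows of the given array. -/
theorem hasInpPattern_of_tp2 {M : Type w} [L.Structure M] [Nonempty M] {n m : ℕ}
    {φ : L.Formula (Fin n ⊕ Fin m)} {a : ℕ → ℕ → Fin m → M} {k : ℕ}
    (hk : ∀ i, KInconsistent (fun j => plug φ (a i j)) k)
    (hcon : ∀ η : ℕ → ℕ, Consistent (Set.range fun i => plug φ (a i (η i))))
    (κ : Cardinal.{w}) : HasInpPattern (trivialType L M (Fin n)) κ := by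
  classical
  let I := κ.ord.ToType
  let V : (I → ℕ) → (I × ℕ × Fin m → M) := fun ρ y => a (ρ y.1) y.2.1 y.2.2
  obtain ⟨N, _, f, c, hc⟩ := Consistent.exists_realize
    (Φ := {ψ : L.Formula (M ⊕ I × ℕ × Fin m) | ∃ F : Finset I, ∀ ρ : I → ℕ, Set.InjOn ρ F →
      ψ.Realize (Sum.elim id (V ρ))}) (by
      intro Φ₀ hΦ₀ hfin
      have hex : ∀ ψ ∈ Φ₀, ∃ F : Finset I, ∀ ρ : I → ℕ, Set.InjOn ρ F →
        ψ.Realize (Sum.elim id (V ρ)) := fun ψ hψ => hΦ₀ hψ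
      choose! F hF using hex
      let G := hfin.toFinset.biUnion F
      refine ⟨V fun i => if h : i ∈ G then G.equivFin ⟨i, h⟩ else 0,
        fun ψ hψ => hF ψ hψ (fun i => if h : i ∈ G then G.equivFin ⟨i, h⟩ else 0) ?_⟩
      have hG : F ψ ⊆ G := Finset.subset_biUnion_of_mem F (by simpa using hψ)
      intro i hi j hj hij
      dsimp only at hij
      rw [dif_pos (hG hi), dif_pos (hG hj)] at hij
      simpa using G.equivFin.injective (Fin.ext hij))
  have : Nonempty N := Nonempty.map f inferInstance
  let χ : I → ℕ → L.Formula ((M ⊕ I × ℕ × Fin m) ⊕ Fin n) := fun i j =>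
    φ.relabel (Sum.elim Sum.inr fun y => Sum.inl (Sum.inr (i, j, y)))
  have hχ : ∀ (N : Type w) [L.Structure N] (g : M → N) (c : I × ℕ × Fin m → N) i j d,
      (χ i j).Realize (Sum.elim (Sum.elim g c) d) ↔
      φ.Realize (Sum.elim d fun y => c (i, j, y)) := by
    intro N _ g c i j d
    rw [Formula.realize_relabel]
    congr! 1
    funext y; rcases y with y | y <;> rfl
  refine ⟨N, _, f, fun _ => m, fun _ => φ, fun i j y => c (i, j, y), fun _ => k,
    fun i s hs => ?_, fun η => ?_⟩
  · rw [consistent_image_finset_iff]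
    obtain ⟨ψ, hψ⟩ := exists_exFormula₁.{u, v, w} s (χ i)
    have := hc ψ.not ⟨∅, fun ρ _ => by
      rw [Formula.realize_not, hψ]
      have := hk (ρ i) s hs
      rw [consistent_image_finset_iff] at this
      simpa only [hχ, realize_plug] using this⟩
    rw [Formula.realize_not, hψ] at this
    simpa only [hχ, realize_plug] using this
  · rw [trivialType_over, Set.empty_union, consistent_range_iff]
    intro F
    obtain ⟨ψ, hψ⟩ := exists_exFormula₁.{u, v, w} F (fun i => χ i (η i))
    have := hc ψ ⟨F, fun ρ hρ => by
      rw [hψ]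
      -- The path `η` is transported along `ρ`, which is injective on the rows under consideration;
      -- elsewhere the value 0 is immaterial.
      let η' : ℕ → ℕ := fun r => if h : ∃ i ∈ F, ρ i = r then η h.choose else 0
      have hη' : ∀ i ∈ F, η' (ρ i) = η i := by
        intro i hi
        have h : ∃ i' ∈ F, ρ i' = ρ i := ⟨i, hi, rfl⟩
        simp only [η', dif_pos h]
        rw [hρ h.choose_spec.1 hi h.choose_spec.2]
      obtain ⟨d, hd⟩ := (consistent_range_iff _).1 (hcon η') (F.image ρ)
      refine ⟨d, fun i hi => ?_⟩
      have := hd _ (Finset.mem_image_of_mem ρ hi)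
      rw [realize_plug, hη' i hi] at this
      rw [hχ]
      exact this⟩
    rw [hψ] at this
    simpa only [hχ, realize_plug] using this

/-- A set mapping with finite values on an uncountable set has an infinite free set. -/
theorem exists_free_sequence {I : Type y} (S : I → Set I) (hS : ∀ i, (S i).Finite) {D : Set I}
    (hD : ¬ D.Countable) :
    ∃ h : ℕ → I, Function.Injective h ∧ (∀ n, h n ∈ D) ∧ ∀ n n', n ≠ n' → h n' ∉ S (h n) := by
  have step : ∀ D : {D : Set I // ¬ D.Countable}, ∃ (i : I) (D' : {D : Set I // ¬ D.Countable}),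
      i ∈ D.1 ∧ D'.1 ⊆ D.1 ∧ ∀ j ∈ D'.1, j ≠ i ∧ j ∉ S i ∧ i ∉ S j := by
    rintro ⟨D, hD⟩
    have hinf : D.Infinite := fun h => hD h.countable
    obtain ⟨C, hCD, hC⟩ : ∃ C ⊆ D, C.Infinite ∧ C.Countable := by
      obtain ⟨e⟩ : Nonempty (ℕ ↪ D) := ⟨hinf.natEmbedding⟩
      refine ⟨Set.range fun n => (e n : I), ?_, ?_, Set.countable_range _⟩
      · rintro _ ⟨n, rfl⟩; exact (e n).2
      · exact Set.infinite_range_of_injective (Subtype.val_injective.comp e.injective)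
    -- Each `S j` is finite and so misses some `i ∈ C`. Hence the countably many sets `{j ∈ D | i ∉
    -- S j}` cover `D`, and one is uncountable.
    obtain ⟨i, hi, hiD⟩ : ∃ i ∈ C, ¬ {j ∈ D | i ∉ S j}.Countable := by
      by_contra hcon
      push Not at hcon
      refine hD ((hC.2.biUnion hcon).mono fun j hj => ?_)
      obtain ⟨i, hi, hij⟩ := (hC.1.sdiff (hS j)).nonempty
      exact Set.mem_biUnion hi ⟨hj, hij⟩
    refine ⟨i, ⟨{j ∈ D | i ∉ S j} \ (insert i (S i)), fun h => hiD ?_⟩, hCD hi, ?_, ?_⟩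
    · refine (h.union ((hS i).insert i).countable).mono fun j hj => ?_
      by_cases hj' : j ∈ insert i (S i)
      · exact Or.inr hj'
      · exact Or.inl ⟨hj, hj'⟩
    · exact fun j hj => hj.1.1
    · rintro j ⟨hj, hj'⟩
      rw [Set.mem_insert_iff, not_or] at hj'
      exact ⟨hj'.1, hj'.2, hj.2⟩
  choose pick next hpick hsub hnext using step
  let E : ℕ → {D : Set I // ¬ D.Countable} := fun n => Nat.rec ⟨D, hD⟩ (fun _ D => next D) n
  have hE : Antitone fun n => (E n).1 := antitone_nat_of_succ_le fun n => hsub (E n)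
  have hlt : ∀ n n', n < n' → pick (E n') ∈ (next (E n)).1 := fun n n' h =>
    hE (Nat.succ_le_of_lt h) (hpick (E n'))
  refine ⟨fun n => pick (E n), ?_, fun n => hE (Nat.zero_le n) (hpick _), ?_⟩
  · intro n n' h
    rcases lt_trichotomy n n' with hn | hn | hn
    · exact absurd h.symm (hnext _ _ (hlt _ _ hn)).1
    · exact hn
    · exact absurd h (hnext _ _ (hlt _ _ hn)).1
  · intro n n' hne
    rcases lt_or_gt_of_ne hne with hn | hn
    · exact (hnext _ _ (hlt _ _ hn)).2.1
    · exact (hnext _ _ (hlt _ _ hn)).2.2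

/-- If the parameters of finitely many rows of an inp³-pattern avoid these rows, then all
paths through these rows are consistent. -/
theorem MutuallyIndiscernible.exists_path {N : Type w} [L.Structure N] [Nonempty N] {I : Type y}
    {m l : I → ℕ} {a : ∀ i, ℕ → Fin (m i) → N} (ha : MutuallyIndiscernible L a)
    {b : ∀ i, Fin (l i) → N} {X : Type x} {φ : ∀ i, L.Formula (X ⊕ (Fin (m i) ⊕ Fin (l i)))}
    {F : Finset I} (hb : ∀ i ∈ F, ∀ t, ∃ j, j ∉ F ∧ b i t ∈ rowSet (a j))
    (hcon : ∃ d : X → N, ∀ i ∈ F, (φ i).Realize (Sum.elim d (Sum.elim (a i 0) (b i))))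
    (η : I → ℕ) :
    ∃ d : X → N, ∀ i ∈ F, (φ i).Realize (Sum.elim d (Sum.elim (a i (η i)) (b i))) := by
  classical
  -- The rows are moved from place 0 to place `η i` one at a time; `G` is the set of rows already
  -- moved. All data of the other rows lie in the base over which the current row is indiscernible.
  have key : ∀ G ⊆ F, ∃ d : X → N, ∀ i ∈ F, (φ i).Realize
      (Sum.elim d (Sum.elim (a i (if i ∈ G then η i else 0)) (b i))) := by
    intro G
    induction G using Finset.induction_on with
    | empty => simpa using hcon
    | insert i₀ G hi₀ ih =>
      intro hG
      have hi₀F := hG (Finset.mem_insert_self _ _)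
      have ih := ih fun i hi => hG (Finset.mem_insert_of_mem hi)
      let A : Set N := ⋃ j ∈ {j | j ≠ i₀}, rowSet (a j)
      have hbA : ∀ i ∈ F, ∀ t, b i t ∈ A := fun i hi t => by
        obtain ⟨j, hj, h⟩ := hb i hi t
        refine mem_otherRows ?_ h
        rintro rfl; exact hj hi₀F
      have haA : ∀ i ≠ i₀, ∀ j y, a i j y ∈ A := fun i hi j y => mem_otherRows hi ⟨j, y, rfl⟩
      let χ : F → L.Formula ((A ⊕ (Fin 1 × Fin (m i₀))) ⊕ X) := fun i =>
        (φ i.1).relabel (Sum.elim Sum.inr (Sum.elim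
          (fun y => Sum.inl (if h : i.1 = i₀ then Sum.inr (0, h ▸ y) else
            Sum.inl ⟨a i.1 (if i.1 ∈ G then η i.1 else 0) y, haA i.1 h _ _⟩))
          (fun t => Sum.inl (Sum.inl ⟨b i.1 t, hbA i.1 i.2 t⟩))))
      have hχ : ∀ (s : Fin 1 → ℕ) (i : F) d, (χ i).Realize (Sum.elim (Sum.elim
          (fun e : A => (e : N)) (fun q => a i₀ (s q.1) q.2)) d) ↔
          (φ i.1).Realize (Sum.elim d (Sum.elim (a i.1 (if i.1 = i₀ then s 0 else
            if i.1 ∈ G then η i.1 else 0)) (b i.1))) := by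
        rintro s ⟨i, hi⟩ d
        rw [Formula.realize_relabel]
        congr! 1
        funext y
        rcases y with y | y | y
        · rfl
        · by_cases h : i = i₀
          · subst h
            simp
          · simp [h]
        · rfl
      obtain ⟨d, hd⟩ := ((ha i₀).exists_iff (s := fun _ : Fin 1 => 0) (t := fun _ => η i₀)
        (Subsingleton.strictMono _) (Subsingleton.strictMono _) Finset.univ χ).1 (by
          obtain ⟨d, hd⟩ := ih
          refine ⟨d, fun i _ => (hχ (fun _ => 0) i d).2 ?_⟩
          have := hd i.1 i.2
          split_ifs with h
          · rwa [if_neg (h ▸ hi₀)] at this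
          · rwa [if_pos ‹_›] at this
          · rwa [if_neg ‹_›] at this)
      refine ⟨d, fun i hi => ?_⟩
      have := (hχ (fun _ => η i₀) ⟨i, hi⟩ d).1 (hd ⟨i, hi⟩ (Finset.mem_univ _))
      by_cases h : i = i₀
      · simpa [h] using this
      · simpa [h] using this
  obtain ⟨d, hd⟩ := key F subset_rfl
  exact ⟨d, fun i hi => by simpa [hi] using hd i hi⟩

/-- Depth beyond the number of pairs (formula, `k`) gives an uncountable set of rows of one colour.
A free sequence in it has parameters outside its own rows, hence consistent paths and TP₂. -/
theorem NTP2.bddAbove_inp3Pattern (hT : NTP2 T) (M : T.ModelType.{u, v, max u v}) {n : ℕ}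
    (p : PartialType L M (Fin n)) : BddAbove {κ | HasInp3Pattern p κ} := by
  classical
  let C : Type (max u v) := (Σ w, L.Formula (Fin n ⊕ Fin w)) × ℕ
  let μ : Cardinal.{max u v} := max ℵ₀ #C
  refine ⟨μ, fun κ hκ => ?_⟩
  by_contra hlt
  rw [not_le] at hlt
  obtain ⟨N, _, f, m, l, φ, a, b, h1, h2, h3, h4⟩ := hκ
  have : Nonempty N := Nonempty.map f inferInstance
  choose ρ hρ hb using h2
  let I := κ.ord.ToType
  have hk : ∀ i, ∃ k, KInconsistent (fun j => plug (φ i) (Sum.elim (a i j) (b i))) k := fun i =>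
    (h1 i).exists_kInconsistent (φ i) (fun t => mem_otherRows (hρ i t) (hb i t)) (h4 i)
  choose k hk using hk
  let color : I → C := fun i => (⟨m i + l i, (φ i).relabel (Sum.map id finSumFinEquiv)⟩, k i)
  -- Stated for an arbitrary colour, so that the common colour `χ` can be substituted although the
  -- arities depend on `i`.
  let P : I → C → Prop := fun i χ => ∃ e : ℕ → Fin χ.1.1 → N,
    (∀ j d, χ.1.2.Realize (Sum.elim d (e j)) ↔
      (φ i).Realize (Sum.elim d (Sum.elim (a i j) (b i)))) ∧
    KInconsistent (fun j => plug (φ i) (Sum.elim (a i j) (b i))) χ.2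
  have hP : ∀ i, P i (color i) := by
    intro i
    refine ⟨fun j => Sum.elim (a i j) (b i) ∘ finSumFinEquiv.symm, fun j d => ?_, hk i⟩
    rw [Formula.realize_relabel]
    congr! 1
    funext y
    rcases y with y | y <;> simp
  obtain ⟨χ, hχ⟩ : ∃ χ, Order.succ μ ≤ #(color ⁻¹' {χ}) := by
    refine Cardinal.infinite_pigeonhole_card color (Order.succ μ) ?_ ?_ ?_
    · rw [Cardinal.mk_ord_toType]; exact Order.succ_le_of_lt hlt
    · exact (le_max_left _ _).trans (Order.le_succ _)
    · rw [(Cardinal.isRegular_succ (le_max_left _ _)).cof_ord]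
      exact lt_of_le_of_lt (le_max_right _ _) (Order.lt_succ _)
  have hunc : ¬ (color ⁻¹' {χ}).Countable := by
    rw [← Cardinal.le_aleph0_iff_set_countable, not_le]
    exact lt_of_lt_of_le (lt_of_le_of_lt (le_max_left _ _) (Order.lt_succ _)) hχ
  obtain ⟨h, hinj, hD, hfree⟩ := exists_free_sequence (fun i => Set.range (ρ i))
    (fun i => Set.finite_range _) hunc
  have hPχ : ∀ r, P (h r) χ := fun r => by
    have := hP (h r)
    rwa [show color (h r) = χ from hD r] at this
  obtain ⟨⟨w, ψ⟩, k⟩ := χ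
  choose e he hek using hPχ
  refine hT ⟨modelOfElementary f, n, w, ψ, e, k, fun r s hs hcon => ?_, fun η => ?_⟩
  · refine hek r s hs ?_
    rw [consistent_image_finset_iff] at hcon ⊢
    obtain ⟨d, hd⟩ := hcon
    exact ⟨d, fun j hj => (realize_plug _ _ _).2 ((he r j d).1 ((realize_plug _ _ _).1 (hd j hj)))⟩
  · rw [consistent_range_iff]
    intro F
    have hF := (consistent_range_iff _).1 (h3.mono Set.subset_union_right) (F.image h)
    simp only [realize_plug] at hF
    obtain ⟨d, hd⟩ := h1.exists_path (F := F.image h) (φ := φ) (b := b) (by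
      intro i hi t
      obtain ⟨r, hr, rfl⟩ := Finset.mem_image.1 hi
      refine ⟨ρ (h r) t, fun hmem => ?_, hb _ _⟩
      obtain ⟨r', hr', hrr'⟩ := Finset.mem_image.1 hmem
      by_cases hne : r = r'
      · subst hne; exact hρ _ _ hrr'.symm
      · exact hfree r r' hne ⟨t, hrr'.symm⟩) hF
      (fun i => if hi : ∃ r, h r = i then η hi.choose else 0)
    refine ⟨d, fun r hr => ?_⟩
    have hr' : ∃ r', h r' = h r := ⟨r, rfl⟩
    have := hd (h r) (Finset.mem_image_of_mem h hr)
    rw [dif_pos hr', hinj hr'.choose_spec, ← he] at this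
    exact (realize_plug _ _ _).2 this

theorem ntp2_iff : NTP2 T ↔
    ∀ (M : T.ModelType.{u, v, max u v}) (n : ℕ) (p : PartialType L M (Fin n)), bdn3 p < ⊤ := by
  constructor
  · exact fun hT M n p => CardStar.sup_ofCard_lt_top_iff.2 (hT.bddAbove_inp3Pattern M p)
  · rintro h ⟨M, n, m, φ, a, k, hk, hcon⟩
    have h' := lt_of_le_of_lt ((bdn_le_bdn2 _).trans (bdn2_le_bdn3 _))
      (h M n (trivialType L M (Fin n)))
    obtain ⟨μ, hμ⟩ := CardStar.sup_ofCard_lt_top_iff.1 h'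
    exact (hμ (hasInpPattern_of_tp2 hk hcon (Order.succ μ))).not_gt (Order.lt_succ μ)


/-! ### Refining equivalence relations, possibly on a group of exponent two -/

/-- Function symbols: a constant `0` and, if `g` holds, addition. -/
inductive TreeFn (g : Prop) : ℕ → Type
  | zero : TreeFn g 0
  | add : g → TreeFn g 2

/-- Relation symbols: a binary relation for every natural number. -/
inductive TreeRel : ℕ → Type
  | E (k : ℕ) : TreeRel 2

/-- The language of refining equivalence relations `E k`, with addition if `g` holds. -/
def treeLang (g : Prop) : FirstOrder.Language.{0, 0} := ⟨TreeFn g, TreeRel⟩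

section Tree

variable {g : Prop} {N N' : Type} [(treeLang g).Structure N] [(treeLang g).Structure N']

/-- The interpretation of `E k`, where `E ⊤` is equality. -/
def treeRel (g : Prop) {N : Type} [(treeLang g).Structure N] (k : WithTop ℕ) (x y : N) : Prop :=
  WithTop.recTopCoe (x = y)
    (fun k => Structure.RelMap (L := treeLang g) (M := N) (TreeRel.E k : (treeLang g).Relations 2)
      ![x, y]) k

/-- The interpretation of the constant. -/
def treeZero (g : Prop) (N : Type) [(treeLang g).Structure N] : N :=
  Structure.funMap (L := treeLang g) (TreeFn.zero : (treeLang g).Functions 0) ![]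

/-- The interpretation of addition. -/
def treeAdd {g : Prop} (hg : g) {N : Type} [(treeLang g).Structure N] (x y : N) : N :=
  Structure.funMap (L := treeLang g) (TreeFn.add hg : (treeLang g).Functions 2) ![x, y]

/-- The first-order properties of the structures under consideration. -/
structure IsTree (g : Prop) (N : Type) [(treeLang g).Structure N] : Prop where
  refl : ∀ k (x : N), treeRel g k x x
  symm : ∀ k (x y : N), treeRel g k x y → treeRel g k y x
  trans : ∀ k (x y z : N), treeRel g k x y → treeRel g k y z → treeRel g k x z
  mono : ∀ k k' : WithTop ℕ, k ≤ k' → ∀ x y : N, treeRel g k' x y → treeRel g k x y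
  total : ∀ x y : N, treeRel g 0 x y
  -- Every class of `E k` contains infinitely many classes of `E (k + 1)`; finite sets to be avoided
  -- make this a scheme of sentences.
  split : ∀ (k : ℕ) (x : N) (S : Finset N),
    ∃ y, treeRel g k x y ∧ ∀ z ∈ S, ¬ treeRel g (k + 1 : ℕ) y z
  zero_add : ∀ hg : g, ∀ x : N, treeAdd hg (treeZero g N) x = x
  add_comm : ∀ hg : g, ∀ x y : N, treeAdd hg x y = treeAdd hg y x
  add_assoc : ∀ hg : g, ∀ x y z : N,
    treeAdd hg (treeAdd hg x y) z = treeAdd hg x (treeAdd hg y z)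
  add_self : ∀ hg : g, ∀ x : N, treeAdd hg x x = treeZero g N
  add_rel : ∀ hg : g, ∀ k, ∀ x y z : N, treeRel g k x y →
    treeRel g k (treeAdd hg x z) (treeAdd hg y z)

theorem IsTree.comm_iff (h : IsTree g N) (k) (x y : N) : treeRel g k x y ↔ treeRel g k y x :=
  ⟨h.symm k x y, h.symm k y x⟩

/-- The group structure given by addition. -/
abbrev IsTree.group (h : IsTree g N) (hg : g) : AddCommGroup N where
  add := treeAdd hg
  zero := treeZero g N
  neg := id
  add_assoc := h.add_assoc hg
  add_comm := h.add_comm hg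
  zero_add := h.zero_add hg
  add_zero x := (h.add_comm hg _ _).trans (h.zero_add hg x)
  neg_add_cancel := h.add_self hg
  nsmul := @nsmulRec N ⟨treeZero g N⟩ ⟨treeAdd hg⟩
  zsmul := @zsmulRec N ⟨treeZero g N⟩ ⟨treeAdd hg⟩ ⟨id⟩ (@nsmulRec N ⟨treeZero g N⟩ ⟨treeAdd hg⟩)

theorem realize_zero {α : Type} (v : α → N) (ts : Fin 0 → (treeLang g).Term α) :
    (Term.func (TreeFn.zero : (treeLang g).Functions 0) ts).realize v = treeZero g N := by
  simp only [Term.realize, treeZero]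
  congr 1
  exact Subsingleton.elim _ _

theorem realize_add {α : Type} (hg : g) (v : α → N) (ts : Fin 2 → (treeLang g).Term α) :
    (Term.func (TreeFn.add hg : (treeLang g).Functions 2) ts).realize v =
      treeAdd hg ((ts 0).realize v) ((ts 1).realize v) := by
  simp only [Term.realize, treeAdd]
  congr 1
  funext i
  fin_cases i <;> rfl

/-- The constant, as a term. -/
def zeroTerm (g : Prop) (α : Type) : (treeLang g).Term α :=
  Term.func (TreeFn.zero : (treeLang g).Functions 0) Fin.elim0

/-- The sum of two terms. -/
def addTerm {g : Prop} (hg : g) {α : Type} (s t : (treeLang g).Term α) : (treeLang g).Term α :=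
  Term.func (TreeFn.add hg : (treeLang g).Functions 2) ![s, t]

@[simp] theorem realize_zeroTerm {α : Type} (v : α → N) :
    (zeroTerm g α).realize v = treeZero g N := realize_zero v _

@[simp] theorem realize_addTerm (hg : g) {α : Type} (v : α → N) (s t : (treeLang g).Term α) :
    (addTerm hg s t).realize v = treeAdd hg (s.realize v) (t.realize v) := realize_add hg v _

/-- The relation `treeRel` as a formula. -/
def relFormula {g : Prop} {α : Type} (k : WithTop ℕ) (s t : (treeLang g).Term α) :
    (treeLang g).Formula α :=
  WithTop.recTopCoe (s.equal t) (fun k => Relations.formula₂ (TreeRel.E k :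
    (treeLang g).Relations 2) s t) k

@[simp] theorem realize_relFormula {α : Type} (k : WithTop ℕ) (s t : (treeLang g).Term α)
    (v : α → N) : (relFormula k s t).Realize v ↔ treeRel g k (s.realize v) (t.realize v) := by
  cases k with
  | top => exact Formula.realize_equal
  | coe k => exact Formula.realize_rel₂

/-! ### Terms in two groups of variables -/

theorem term_split_of_not (hg : ¬ g) {X Y : Type} (r : (treeLang g).Term (X ⊕ Y)) :
    (∃ s : (treeLang g).Term X, ∀ (N : Type) [(treeLang g).Structure N] (c : X → N) (a : Y → N),
      r.realize (Sum.elim c a) = s.realize c) ∨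
    (∃ t : (treeLang g).Term Y, ∀ (N : Type) [(treeLang g).Structure N] (c : X → N) (a : Y → N),
      r.realize (Sum.elim c a) = t.realize a) := by
  cases r with
  | var y =>
    rcases y with y | y
    · exact Or.inl ⟨Term.var y, fun _ _ _ _ => rfl⟩
    · exact Or.inr ⟨Term.var y, fun _ _ _ _ => rfl⟩
  | func f ts =>
    cases f with
    | zero =>
      refine Or.inl ⟨zeroTerm g X, fun N _ c a => ?_⟩
      rw [realize_zeroTerm]
      exact realize_zero _ ts
    | add h => exact absurd h hg

theorem term_split_of_add (hg : g) {X Y : Type} (r : (treeLang g).Term (X ⊕ Y)) :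
    ∃ (s : (treeLang g).Term X) (t : (treeLang g).Term Y),
      ∀ (N : Type) [(treeLang g).Structure N], IsTree g N → ∀ (c : X → N) (a : Y → N),
      r.realize (Sum.elim c a) = treeAdd hg (s.realize c) (t.realize a) := by
  induction r with
  | var y =>
    rcases y with y | y
    · refine ⟨Term.var y, zeroTerm g Y, fun N _ hN c a => ?_⟩
      rw [realize_zeroTerm, hN.add_comm, hN.zero_add]; rfl
    · refine ⟨zeroTerm g X, Term.var y, fun N _ hN c a => ?_⟩
      rw [realize_zeroTerm, hN.zero_add]; rfl
  | func f ts ih =>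
    cases f with
    | zero =>
      refine ⟨zeroTerm g X, zeroTerm g Y, fun N _ hN c a => ?_⟩
      rw [realize_zeroTerm, realize_zeroTerm, hN.zero_add]
      exact realize_zero _ ts
    | add h =>
      obtain ⟨s, t, h0⟩ := ih 0
      obtain ⟨s', t', h1⟩ := ih 1
      refine ⟨addTerm hg s s', addTerm hg t t', fun N _ hN c a => ?_⟩
      refine (realize_add hg _ ts).trans ?_
      rw [h0 N hN, h1 N hN, realize_addTerm, realize_addTerm]
      let _ := hN.group hg
      exact add_add_add_comm (s.realize c) (t.realize a) (s'.realize c) (t'.realize a)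

/-- The relations are translation invariant, and adding `s' + t` to both sides cancels because the
exponent is two. -/
theorem IsTree.add_add_rel_iff (h : IsTree g N) (hg : g) (k) (s t s' t' : N) :
    treeRel g k (treeAdd hg s t) (treeAdd hg s' t') ↔
      treeRel g k (treeAdd hg s s') (treeAdd hg t t') := by
  let _ := h.group hg
  have hself : ∀ x : N, x + x = 0 := h.add_self hg
  have key : ∀ s t s' t' : N, treeRel g k (s + t) (s' + t') → treeRel g k (s + s') (t + t') := by
    intro s t s' t' hst
    have := h.add_rel hg k _ _ (s' + t) hst
    have h1 : s + t + (s' + t) = s + s' := by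
      rw [show s + t + (s' + t) = s + s' + (t + t) by abel, hself, add_zero]
    have h2 : s' + t' + (s' + t) = t + t' := by
      rw [show s' + t' + (s' + t) = t + t' + (s' + s') by abel, hself, add_zero]
    rw [← h1, ← h2]
    exact this
  exact ⟨key s t s' t', key s s' t t'⟩

/-- Atomic formulas in two groups of variables. -/
theorem atomic_split {X Y : Type} (r r' : (treeLang g).Term (X ⊕ Y)) :
    (∃ s s' : (treeLang g).Term X, ∀ (N : Type) [(treeLang g).Structure N], IsTree g N →
      ∀ (c : X → N) (a : Y → N) k, treeRel g k (r.realize (Sum.elim c a))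
        (r'.realize (Sum.elim c a)) ↔ treeRel g k (s.realize c) (s'.realize c)) ∨
    (∃ t t' : (treeLang g).Term Y, ∀ (N : Type) [(treeLang g).Structure N], IsTree g N →
      ∀ (c : X → N) (a : Y → N) k, treeRel g k (r.realize (Sum.elim c a))
        (r'.realize (Sum.elim c a)) ↔ treeRel g k (t.realize a) (t'.realize a)) ∨
    (∃ (s : (treeLang g).Term X) (t : (treeLang g).Term Y),
      ∀ (N : Type) [(treeLang g).Structure N], IsTree g N →
      ∀ (c : X → N) (a : Y → N) k, treeRel g k (r.realize (Sum.elim c a))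
        (r'.realize (Sum.elim c a)) ↔ treeRel g k (s.realize c) (t.realize a)) := by
  by_cases hg : g
  · obtain ⟨s, t, h⟩ := term_split_of_add hg r
    obtain ⟨s', t', h'⟩ := term_split_of_add hg r'
    refine Or.inr (Or.inr ⟨addTerm hg s s', addTerm hg t t', fun N _ hN c a k => ?_⟩)
    rw [h N hN, h' N hN, realize_addTerm, realize_addTerm, hN.add_add_rel_iff]
  · rcases term_split_of_not hg r with ⟨s, h⟩ | ⟨t, h⟩ <;>
    rcases term_split_of_not hg r' with ⟨s', h'⟩ | ⟨t', h'⟩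
    · exact Or.inl ⟨s, s', fun N _ _ c a k => by rw [h, h']⟩
    · exact Or.inr (Or.inr ⟨s, t', fun N _ _ c a k => by rw [h, h']⟩)
    · exact Or.inr (Or.inr ⟨s', t, fun N _ hN c a k => by rw [h, h', hN.comm_iff]⟩)
    · exact Or.inr (Or.inl ⟨t, t', fun N _ _ c a k => by rw [h, h']⟩)

theorem term_unit (t : (treeLang g).Term Unit) :
    (∀ (N : Type) [(treeLang g).Structure N], IsTree g N → ∀ d : Unit → N,
      t.realize d = treeZero g N) ∨
    (∀ (N : Type) [(treeLang g).Structure N], IsTree g N → ∀ d : Unit → N,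
      t.realize d = d ()) := by
  induction t with
  | var y => exact Or.inr fun _ _ _ _ => rfl
  | func f ts ih =>
    cases f with
    | zero => exact Or.inl fun N _ _ d => realize_zero d ts
    | add hg =>
      rcases ih 0 with h | h <;> rcases ih 1 with h' | h'
      · refine Or.inl fun N _ hN d => (realize_add hg d ts).trans ?_
        rw [h N hN, h' N hN, hN.zero_add]
      · refine Or.inr fun N _ hN d => (realize_add hg d ts).trans ?_
        rw [h N hN, h' N hN, hN.zero_add]
      · refine Or.inr fun N _ hN d => (realize_add hg d ts).trans ?_
        rw [h N hN, h' N hN, hN.add_comm, hN.zero_add]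
      · refine Or.inl fun N _ hN d => (realize_add hg d ts).trans ?_
        rw [h N hN, h' N hN, hN.add_self]

/-- With addition, term values lie in the span of finitely many vectors over a field with two
elements; without it, a term is a variable or the constant. -/
theorem IsTree.finite_range_realize (h : IsTree g N) {X : Type} [Finite X] (c : X → N) :
    (Set.range fun s : (treeLang g).Term X => s.realize c).Finite := by
  by_cases hg : g
  · let _ := h.group hg
    let _ : Module (ZMod 2) N := AddCommGroup.zmodModule (n := 2) fun x => by
      rw [two_nsmul]; exact h.add_self hg x
    have : Module.Finite (ZMod 2) (Submodule.span (ZMod 2) (Set.range c)) :=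
      Module.Finite.span_of_finite _ (Set.finite_range c)
    have : Finite (Submodule.span (ZMod 2) (Set.range c)) := Module.finite_of_finite (ZMod 2)
    refine Set.Finite.subset (s := (Submodule.span (ZMod 2) (Set.range c) : Set N))
      (Set.toFinite _) ?_
    rintro _ ⟨s, rfl⟩
    induction s with
    | var y => exact Submodule.subset_span ⟨y, rfl⟩
    | func f ts ih =>
      cases f with
      | zero =>
        change Term.realize c _ ∈ _
        rw [realize_zero c ts]
        exact Submodule.zero_mem _
      | add hg' =>
        change Term.realize c _ ∈ _
        rw [realize_add hg' c ts]
        exact Submodule.add_mem _ (ih 0) (ih 1)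
  · refine ((Set.finite_range c).insert (treeZero g N)).subset ?_
    rintro _ ⟨s, rfl⟩
    cases s with
    | var y => exact Or.inr ⟨y, rfl⟩
    | func f ts =>
      cases f with
      | zero => exact Or.inl (realize_zero c ts)
      | add h => exact absurd h hg

/-! ### Quantifier elimination -/

/-- Two tuples satisfy the same atomic formulas with relations from `K`. -/
def AtomicEquiv (g : Prop) (K : Set (WithTop ℕ)) {N N' : Type} [(treeLang g).Structure N]
    [(treeLang g).Structure N'] {α : Type} (v : α → N) (v' : α → N') : Prop :=
  ∀ (r r' : (treeLang g).Term α), ∀ k ∈ K,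
    (treeRel g k (r.realize v) (r'.realize v) ↔ treeRel g k (r.realize v') (r'.realize v'))

theorem AtomicEquiv.mono {K K' : Set (WithTop ℕ)} {α : Type} {v : α → N} {v' : α → N'}
    (h : AtomicEquiv g K' v v') (hK : K ⊆ K') : AtomicEquiv g K v v' :=
  fun r r' k hk => h r r' k (hK hk)

theorem AtomicEquiv.symm {K : Set (WithTop ℕ)} {α : Type} {v : α → N} {v' : α → N'}
    (h : AtomicEquiv g K v v') : AtomicEquiv g K v' v :=
  fun r r' k hk => (h r r' k hk).symm

theorem AtomicEquiv.comp {K : Set (WithTop ℕ)} {α β : Type} {v : α → N} {v' : α → N'}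
    (h : AtomicEquiv g K v v') (e : β → α) : AtomicEquiv g K (v ∘ e) (v' ∘ e) := by
  intro r r' k hk
  have := h (r.relabel e) (r'.relabel e) k hk
  simpa only [Term.realize_relabel] using this

/-- The levels up to `n`, and equality. -/
def levels (n : ℕ) : Set (WithTop ℕ) := {k | k ≤ n ∨ k = ⊤}

/-- The back-and-forth step. An element that is not a term value is described by the finest level,
up to `n`, at which it is related to such a value; `split` supplies an element in the same position
on the other side. Cutting the levels at `n` ensures that a finest one exists. -/
theorem AtomicEquiv.extend (hN : IsTree g N) (hN' : IsTree g N') {n : ℕ} {α : Type} [Finite α]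
    {v : α → N} {v' : α → N'} (h : AtomicEquiv g (levels n) v v') (d : N) :
    ∃ d' : N', AtomicEquiv g (levels n) (Sum.elim v fun _ : Unit => d)
      (Sum.elim v' fun _ : Unit => d') := by
  classical
  -- Atomic formulas separate the old variables from the new one, and a term in the new variable
  -- alone is that variable or zero.
  suffices hd : ∃ d' : N', ∀ (r : (treeLang g).Term α), ∀ k ∈ levels n,
      (treeRel g k d (r.realize v) ↔ treeRel g k d' (r.realize v')) by
    obtain ⟨d', hd⟩ := hd
    have hzero : ∀ k ∈ levels n, (treeRel g k d (treeZero g N) ↔ treeRel g k d' (treeZero g N')) := by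
      intro k hk
      have := hd (zeroTerm g α) k hk
      rwa [realize_zeroTerm, realize_zeroTerm] at this
    refine ⟨d', fun r r' k hk => ?_⟩
    rcases atomic_split r r' with ⟨s, s', hs⟩ | ⟨t, t', ht⟩ | ⟨s, t, hst⟩
    · rw [hs N hN, hs N' hN']
      exact h s s' k hk
    · rw [ht N hN, ht N' hN']
      rcases term_unit t with h0 | h0 <;> rcases term_unit t' with h1 | h1 <;>
        rw [h0 N hN, h0 N' hN', h1 N hN, h1 N' hN']
      · exact iff_of_true (hN.refl _ _) (hN'.refl _ _)
      · rw [hN.comm_iff, hN'.comm_iff]; exact hzero k hk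
      · exact hzero k hk
      · exact iff_of_true (hN.refl _ _) (hN'.refl _ _)
    · rw [hst N hN, hst N' hN']
      rcases term_unit t with h0 | h0 <;> rw [h0 N hN, h0 N' hN']
      · have := h s (zeroTerm g α) k hk
        rwa [realize_zeroTerm, realize_zeroTerm] at this
      · rw [hN.comm_iff, hN'.comm_iff]; exact hd s k hk
  by_cases htop : ∃ r : (treeLang g).Term α, d = r.realize v
  · obtain ⟨r₀, rfl⟩ := htop
    exact ⟨r₀.realize v', fun r k hk => h r₀ r k hk⟩
  let P : ℕ → Prop := fun k => ∃ r : (treeLang g).Term α, treeRel g k d (r.realize v)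
  have hP0 : P 0 := ⟨zeroTerm g α, hN.total _ _⟩
  obtain ⟨r₀, hr₀⟩ : P (Nat.findGreatest P n) := Nat.findGreatest_spec (Nat.zero_le n) hP0
  set k₀ := Nat.findGreatest P n with hk₀
  have hk₀n : k₀ ≤ n := Nat.findGreatest_le n
  -- `d'` is related to the corresponding term at level `k₀` and to no term value at level `k₀ + 1`,
  -- just like `d` as far as levels up to `n` can tell.
  obtain ⟨d', hd', hsep⟩ := hN'.split k₀ (r₀.realize v') (hN'.finite_range_realize v').toFinset
  have hd' := hN'.symm _ _ _ hd'
  refine ⟨d', fun r k hk => ?_⟩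
  have hsep : ¬ treeRel g (k₀ + 1 : ℕ) d' (r.realize v') :=
    hsep _ ((hN'.finite_range_realize v').mem_toFinset.2 ⟨r, rfl⟩)
  by_cases hkk : k ≤ k₀
  · have e1 : treeRel g k d (r₀.realize v) := hN.mono _ _ hkk _ _ hr₀
    have e2 : treeRel g k d' (r₀.realize v') := hN'.mono _ _ hkk _ _ hd'
    have := h r₀ r k hk
    constructor
    · exact fun e => hN'.trans _ _ _ _ e2 (this.1 (hN.trans _ _ _ _ (hN.symm _ _ _ e1) e))
    · exact fun e => hN.trans _ _ _ _ e1 (this.2 (hN'.trans _ _ _ _ (hN'.symm _ _ _ e2) e))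
  · have hlt : ((k₀ + 1 : ℕ) : WithTop ℕ) ≤ k := by
      cases k with
      | top => exact le_top
      | coe k =>
        have : ¬ k ≤ k₀ := fun h => hkk (WithTop.coe_le_coe.2 h)
        exact WithTop.coe_le_coe.2 (Nat.succ_le_of_lt (not_le.1 this))
    refine iff_of_false (fun e => ?_) (fun e => hsep (hN'.mono _ _ hlt _ _ e))
    cases k with
    | top => exact htop ⟨r, e⟩
    | coe k =>
      have hkn : k ≤ n := by
        rcases hk with hk | hk
        · exact WithTop.coe_le_coe.1 hk
        · exact absurd hk WithTop.coe_ne_top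
      exact hkk (WithTop.coe_le_coe.2 (Nat.le_findGreatest hkn ⟨r, e⟩))

/-- A formula mentions finitely many levels, and the back-and-forth step does not raise the level at
a quantifier. -/
theorem exists_level_boundedFormula {α : Type} [Finite α] {m : ℕ}
    (φ : (treeLang g).BoundedFormula α m) :
    ∃ n, ∀ (N N' : Type) [(treeLang g).Structure N] [(treeLang g).Structure N'],
      IsTree g N → IsTree g N' → ∀ (v : α → N) (w : Fin m → N) (v' : α → N') (w' : Fin m → N'),
      AtomicEquiv g (levels n) (Sum.elim v w) (Sum.elim v' w') →
      (φ.Realize v w ↔ φ.Realize v' w') := by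
  induction φ with
  | falsum => exact ⟨0, fun _ _ _ _ _ _ _ _ _ _ _ => Iff.rfl⟩
  | equal t t' =>
    exact ⟨0, fun N N' _ _ _ _ v w v' w' h => h t t' ⊤ (Or.inr rfl)⟩
  | @rel _ l R ts =>
    cases R with
    | E k =>
      refine ⟨k, fun N N' _ _ _ _ v w v' w' h => ?_⟩
      have key : ∀ (N : Type) [(treeLang g).Structure N] (v : α → N) (w : Fin _ → N),
          (BoundedFormula.rel (TreeRel.E k : (treeLang g).Relations 2) ts).Realize v w ↔
          treeRel g k ((ts 0).realize (Sum.elim v w)) ((ts 1).realize (Sum.elim v w)) := by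
        intro N _ v w
        refine BoundedFormula.realize_rel.trans ?_
        refine iff_of_eq (congrArg _ ?_)
        funext i
        fin_cases i <;> rfl
      refine (key N v w).trans (Iff.trans ?_ (key N' v' w').symm)
      exact h _ _ _ (Or.inl le_rfl)
  | imp φ ψ ihφ ihψ =>
    obtain ⟨n, hn⟩ := ihφ
    obtain ⟨n', hn'⟩ := ihψ
    have hle : ∀ {a b : ℕ}, a ≤ b → levels a ⊆ levels b := fun hab k hk =>
      hk.imp (fun h => h.trans (WithTop.coe_le_coe.2 hab)) id
    refine ⟨max n n', fun N N' _ _ hN hN' v w v' w' h => imp_congr ?_ ?_⟩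
    · exact hn N N' hN hN' v w v' w' (h.mono (hle (le_max_left _ _)))
    · exact hn' N N' hN hN' v w v' w' (h.mono (hle (le_max_right _ _)))
  | @all m φ ih =>
    obtain ⟨n, hn⟩ := ih
    have key : ∀ (N N' : Type) [(treeLang g).Structure N] [(treeLang g).Structure N'],
        IsTree g N → IsTree g N' → ∀ (v : α → N) (w : Fin m → N) (v' : α → N') (w' : Fin m → N'),
        AtomicEquiv g (levels n) (Sum.elim v w) (Sum.elim v' w') →
        φ.all.Realize v w → φ.all.Realize v' w' := by
      intro N N' _ _ hN hN' v w v' w' h hall d'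
      obtain ⟨d, hd⟩ := h.symm.extend hN' hN d'
      refine (hn N N' hN hN' v (Fin.snoc w d) v' (Fin.snoc w' d') ?_).1 (hall d)
      have := hd.symm.comp (Sum.elim (fun a => Sum.inl (Sum.inl a))
        (Fin.lastCases (Sum.inr ()) fun i => Sum.inl (Sum.inr i)) :
          α ⊕ Fin (m + 1) → (α ⊕ Fin m) ⊕ Unit)
      convert this using 1 <;>
      · funext y
        rcases y with y | y
        · rfl
        · refine Fin.lastCases ?_ (fun i => ?_) y <;> simp
    exact ⟨n, fun N N' _ _ hN hN' v w v' w' h =>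
      ⟨key N N' hN hN' v w v' w' h, key N' N hN' hN v' w' v w h.symm⟩⟩

/-- Quantifier elimination: the type of a tuple is determined by its atomic type. -/
theorem AtomicEquiv.realize_iff (hN : IsTree g N) (hN' : IsTree g N') {α : Type}
    {v : α → N} {v' : α → N'} (h : AtomicEquiv g Set.univ v v') (φ : (treeLang g).Formula α) :
    φ.Realize v ↔ φ.Realize v' := by
  classical
  obtain ⟨n, hn⟩ := exists_level_boundedFormula
    (φ.restrictFreeVar (id : φ.freeVarFinset → φ.freeVarFinset))
  have key : ∀ (N : Type) [(treeLang g).Structure N] (u : α → N),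
      (φ.restrictFreeVar (id : φ.freeVarFinset → _)).Realize (u ∘ (↑)) default ↔
      φ.Realize u := fun N _ u => BoundedFormula.realize_restrictFreeVar u (fun a => rfl)
  rw [← key, ← key]
  refine hn N N' hN hN' _ _ _ _ ?_
  have := (h.comp (Sum.elim (fun a => a.1) (fun i : Fin 0 => i.elim0) :
    φ.freeVarFinset ⊕ Fin 0 → α)).mono (Set.subset_univ (levels n))
  convert this using 1 <;>
  · funext y
    rcases y with y | y
    · rfl
    · exact y.elim0

end Tree


/-! ### The theories of refining equivalence relations -/

theorem forall_exists_transfer {L : FirstOrder.Language.{u, v}} {M N : Type w}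
    [L.Structure M] [L.Structure N] (h : M ≅[L] N) {α β : Type} [Finite α] [Finite β]
    (ψ : L.Formula (α ⊕ β)) (hM : ∀ a : α → M, ∃ b : β → M, ψ.Realize (Sum.elim a b))
    (a : α → N) : ∃ b : β → N, ψ.Realize (Sum.elim a b) := by
  let σ : L.Sentence := ((ψ.iExs β).relabel (Sum.inr : α → Empty ⊕ α)).iAlls α
  have key : ∀ (K : Type _) [L.Structure K], K ⊨ σ ↔
      ∀ a : α → K, ∃ b : β → K, ψ.Realize (Sum.elim a b) := by
    intro K _
    refine Formula.realize_iAlls.trans (forall_congr' fun a => ?_)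
    rw [Formula.realize_relabel, Sum.elim_comp_inr, Formula.realize_iExs]
  exact (key N).1 ((h.realize_sentence σ).1 ((key M).2 hM)) a

theorem forall_transfer {L : FirstOrder.Language.{u, v}} {M N : Type w}
    [L.Structure M] [L.Structure N] (h : M ≅[L] N) {α : Type} [Finite α]
    (ψ : L.Formula α) (hM : ∀ a : α → M, ψ.Realize a) (a : α → N) : ψ.Realize a := by
  obtain ⟨b, hb⟩ := forall_exists_transfer h (β := Empty) (ψ.relabel Sum.inl)
    (fun a => ⟨Empty.elim, by simpa [Formula.realize_relabel] using hM a⟩) a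
  simpa [Formula.realize_relabel] using hb

/-- All clauses are first-order, one sentence for each level and each size of the finite set in
`split`. -/
theorem IsTree.of_elementarilyEquivalent {g : Prop} {M N : Type} [(treeLang g).Structure M]
    [(treeLang g).Structure N] (hM : IsTree g M) (h : M ≅[treeLang g] N) : IsTree g N := by
  let X : Fin 3 → (treeLang g).Term (Fin 3) := Term.var
  refine ⟨?_, ?_, ?_, ?_, ?_, ?_, ?_, ?_, ?_, ?_, ?_⟩
  · intro k x
    simpa [X] using forall_transfer h (relFormula k (X 0) (X 0))
      (fun a => by simpa [X] using hM.refl k _) ![x, x, x]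
  · intro k x y
    simpa [X] using forall_transfer h ((relFormula k (X 0) (X 1)).imp (relFormula k (X 1) (X 0)))
      (fun a => by simpa [X] using hM.symm k _ _) ![x, y, x]
  · intro k x y z
    simpa [X] using forall_transfer h ((relFormula k (X 0) (X 1)).imp
      ((relFormula k (X 1) (X 2)).imp (relFormula k (X 0) (X 2))))
      (fun a => by simpa [X] using hM.trans k _ _ _) ![x, y, z]
  · intro k k' hk x y
    simpa [X] using forall_transfer h ((relFormula k' (X 0) (X 1)).imp (relFormula k (X 0) (X 1)))
      (fun a => by simpa [X] using hM.mono k k' hk _ _) ![x, y, x]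
  · intro x y
    simpa [X] using forall_transfer h (relFormula 0 (X 0) (X 1))
      (fun a => by simpa [X] using hM.total _ _) ![x, y, x]
  · classical
    intro k x S
    let ψ : (treeLang g).Formula (Option S ⊕ Unit) :=
      relFormula k (Term.var (Sum.inl none)) (Term.var (Sum.inr ())) ⊓
        Formula.iInf fun s : S =>
          (relFormula (k + 1 : ℕ) (Term.var (Sum.inr ())) (Term.var (Sum.inl (some s)))).not
    have hψ : ∀ (K : Type) [(treeLang g).Structure K] (v : Option S ⊕ Unit → K), ψ.Realize v ↔
        treeRel g k (v (Sum.inl none)) (v (Sum.inr ())) ∧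
        ∀ s : S, ¬ treeRel g (k + 1 : ℕ) (v (Sum.inr ())) (v (Sum.inl (some s))) := by
      intro K _ v
      simp only [ψ, Formula.realize_inf, Formula.realize_iInf, Formula.realize_not,
        realize_relFormula, Term.realize_var]
    obtain ⟨b, hb⟩ := forall_exists_transfer h ψ (fun a => by
      obtain ⟨y, hy, hy'⟩ := hM.split k (a none) (Finset.univ.image fun s : S => a (some s))
      exact ⟨fun _ => y, (hψ _ _).2 ⟨hy, fun s => hy' _ (Finset.mem_image_of_mem _
        (Finset.mem_univ s))⟩⟩) (fun o => o.elim x (fun s => s.1))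
    rw [hψ] at hb
    exact ⟨b (), hb.1, fun z hz => hb.2 ⟨z, hz⟩⟩
  · intro hg x
    simpa [X, treeRel] using forall_transfer h (relFormula ⊤ (addTerm hg (zeroTerm g _) (X 0)) (X 0))
      (fun a => by simpa [X, treeRel] using hM.zero_add hg _) ![x, x, x]
  · intro hg x y
    simpa [X, treeRel] using forall_transfer h
      (relFormula ⊤ (addTerm hg (X 0) (X 1)) (addTerm hg (X 1) (X 0)))
      (fun a => by simpa [X, treeRel] using hM.add_comm hg _ _) ![x, y, x]
  · intro hg x y z
    simpa [X, treeRel] using forall_transfer h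
      (relFormula ⊤ (addTerm hg (addTerm hg (X 0) (X 1)) (X 2))
        (addTerm hg (X 0) (addTerm hg (X 1) (X 2))))
      (fun a => by simpa [X, treeRel] using hM.add_assoc hg _ _ _) ![x, y, z]
  · intro hg x
    simpa [X, treeRel] using forall_transfer h (relFormula ⊤ (addTerm hg (X 0) (X 0)) (zeroTerm g _))
      (fun a => by simpa [X, treeRel] using hM.add_self hg _) ![x, x, x]
  · intro hg k x y z
    simpa [X] using forall_transfer h ((relFormula k (X 0) (X 1)).imp
      (relFormula k (addTerm hg (X 0) (X 2)) (addTerm hg (X 1) (X 2))))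
      (fun a => by simpa [X] using hM.add_rel hg k _ _ _) ![x, y, z]

/-- Sequences in an elementary abelian 2-group. -/
def TreeModel (ι : Type) : Type := ℕ → (ι →₀ ZMod 2)

noncomputable instance (ι : Type) : AddCommGroup (TreeModel ι) :=
  inferInstanceAs (AddCommGroup (ℕ → (ι →₀ ZMod 2)))

/-- Two sequences are related by `E k` if they agree up to `k`. -/
noncomputable instance treeStructure (g : Prop) (ι : Type) : (treeLang g).Structure (TreeModel ι) where
  funMap {n} (f : TreeFn g n) x :=
    match n, f, x with
    | _, TreeFn.zero, _ => 0
    | _, TreeFn.add _, x => x 0 + x 1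
  RelMap {n} (r : TreeRel n) x :=
    match n, r, x with
    | _, TreeRel.E k, x => ∀ i < k, (x 0 : TreeModel ι) i = (x 1 : TreeModel ι) i

theorem treeRel_treeModel (g : Prop) {ι : Type} (k : ℕ) (x y : TreeModel ι) :
    treeRel g (k : ℕ) x y ↔ ∀ i < k, x i = y i := Iff.rfl

theorem treeAdd_treeModel {g : Prop} (hg : g) {ι : Type} (x y : TreeModel ι) :
    treeAdd hg x y = x + y := rfl

theorem isTree_treeModel (g : Prop) (ι : Type) [Infinite ι] : IsTree g (TreeModel ι) := by
  classical
  refine ⟨?_, ?_, ?_, ?_, ?_, ?_, ?_, ?_, ?_, ?_, ?_⟩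
  · intro k x
    cases k with
    | top => exact rfl
    | coe k => exact fun i _ => rfl
  · intro k x y
    cases k with
    | top => exact Eq.symm
    | coe k => exact fun h i hi => (h i hi).symm
  · intro k x y z
    cases k with
    | top => exact Eq.trans
    | coe k => exact fun h h' i hi => (h i hi).trans (h' i hi)
  · intro k k' hk x y h
    cases k with
    | top => rw [top_le_iff.1 hk] at h; exact h
    | coe k =>
      intro i hi
      cases k' with
      | top => exact congrFun h i
      | coe k' => exact h i (lt_of_lt_of_le hi (WithTop.coe_le_coe.1 hk))
  · exact fun x y i hi => absurd hi (Nat.not_lt_zero i)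
  · intro k x S
    -- Only place `k` of `x` is changed, to a value taken there by no member of `S`.
    obtain ⟨e, he⟩ := Infinite.exists_notMem_finset (S.image fun z : TreeModel ι => z k)
    refine ⟨Function.update x k e, fun i hi => (Function.update_of_ne hi.ne _ _).symm,
      fun z hz h => he ?_⟩
    have := h k (Nat.lt_succ_self k)
    rw [Finset.mem_image]
    exact ⟨z, hz, this.symm.trans (Function.update_self _ _ _)⟩
  · exact fun _ x => zero_add x
  · exact fun _ x y => add_comm x y
  · exact fun _ x y z => add_assoc x y z
  · intro _ x
    change x + x = 0
    funext i
    ext j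
    exact CharTwo.add_self_eq_zero (x i j)
  · intro hg k x y z
    cases k with
    | top => exact fun h => congrArg (fun t => treeAdd hg t z) h
    | coe k => exact fun h i hi => congrArg (fun t => t + z i) (h i hi)

/-- The theory of refining equivalence relations, with a group structure if `g` holds. -/
def treeTheory (g : Prop) : (treeLang g).Theory := (treeLang g).completeTheory (TreeModel ℕ)

theorem treeTheory_isComplete (g : Prop) : (treeTheory g).IsComplete :=
  completeTheory.isComplete _ _

theorem isTree_of_model {g : Prop} {N : Type} [(treeLang g).Structure N] [h : N ⊨ treeTheory g] :
    IsTree g N := by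
  refine (isTree_treeModel g ℕ).of_elementarilyEquivalent ?_
  have : N ⊨ (treeLang g).completeTheory (TreeModel ℕ) := h
  exact elementarilyEquivalent_iff.2 fun φ => (realize_iff_of_model_completeTheory _ N φ).symm

/-- Quantifier elimination for the empty tuple: every closed term has value zero. -/
theorem IsTree.elementarilyEquivalent {g : Prop} {M N : Type} [(treeLang g).Structure M]
    [(treeLang g).Structure N] (hM : IsTree g M) (hN : IsTree g N) : M ≅[treeLang g] N := by
  have hz : ∀ (K : Type) [(treeLang g).Structure K], IsTree g K →
      ∀ (v : Empty → K) (t : (treeLang g).Term Empty), t.realize v = treeZero g K := by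
    intro K _ hK v t
    induction t with
    | var y => exact y.elim
    | func f ts ih =>
      cases f with
      | zero => exact realize_zero v ts
      | add hg => exact (realize_add hg v ts).trans (by rw [ih, ih, hK.zero_add])
  refine elementarilyEquivalent_iff.2 fun φ => ?_
  refine AtomicEquiv.realize_iff hM hN (fun r r' k _ => ?_) φ
  rw [hz M hM, hz M hM, hz N hN, hz N hN]
  exact iff_of_true (hM.refl _ _) (hN.refl _ _)

theorem treeModel_model (g : Prop) (ι : Type) [Infinite ι] : TreeModel ι ⊨ treeTheory g := by
  have : TreeModel ℕ ⊨ treeTheory g := model_completeTheory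
  exact ((isTree_treeModel g ℕ).elementarilyEquivalent (isTree_treeModel g ι)).theory_model

/-! ### Strength -/

theorem IndiscernibleOver.realize_iff {L : FirstOrder.Language.{u, v}} {N : Type w} [L.Structure N]
    {Y : Type} {A : Set N} {a : ℕ → Y → N} (ha : IndiscernibleOver L A a) (θ : L.Formula (A ⊕ Y))
    (j j' : ℕ) : θ.Realize (Sum.elim (fun e => (e : N)) (a j)) ↔
      θ.Realize (Sum.elim (fun e => (e : N)) (a j')) := by
  have key : ∀ j, θ.Realize (Sum.elim (fun e => (e : N)) (a j)) ↔
      (θ.relabel (Sum.map id fun y => ((0 : Fin 1), y))).Realize (Sum.elim (fun e => (e : N))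
        (fun q : Fin 1 × Y => a ((fun _ : Fin 1 => j) q.1) q.2)) := by
    intro j
    rw [Formula.realize_relabel]
    congr! 1
    funext y; rcases y with y | y <;> rfl
  rw [key, key]
  exact ha 1 (fun _ => j) (fun _ => j') (Subsingleton.strictMono _) (Subsingleton.strictMono _) _

section Strength

variable {g : Prop} {N : Type} [(treeLang g).Structure N]

/-- Otherwise some `e ∈ C` distinguishes members of two rows. At the coarser of the two levels a
term in one row is related to a term in the other through `e`; mutual indiscernibility spreads this
along the first row, so `e` does not distinguish its members after all. -/
theorem IsTree.exists_row (hN : IsTree g N) {I : Type} [Infinite I] {m : I → ℕ}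
    {a : ∀ i, ℕ → Fin (m i) → N} (ha : MutuallyIndiscernible (treeLang g) a) {C : Set N}
    (hC : C.Finite) : ∃ i, ∀ e ∈ C, ∀ (t : (treeLang g).Term (Fin (m i))) k j j',
      treeRel g k e (t.realize (a i j)) → treeRel g k e (t.realize (a i j')) := by
  by_contra hcon
  push Not at hcon
  choose e he t k j j' h h' using hcon
  have := hC.to_subtype
  obtain ⟨i₁, i₂, hne, heq'⟩ := Finite.exists_ne_map_eq_of_infinite (fun i => (⟨e i, he i⟩ : C))
  have heq : e i₁ = e i₂ := congrArg Subtype.val heq'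
  clear heq'
  wlog hk : k i₁ ≤ k i₂ generalizing i₁ i₂
  · exact this i₂ i₁ hne.symm heq.symm (le_of_not_ge hk)
  have h2 : treeRel g (k i₁) (e i₁) ((t i₂).realize (a i₂ (j i₂))) := by
    rw [heq]; exact hN.mono _ _ hk _ _ (h i₂)
  have h3 : treeRel g (k i₁) ((t i₁).realize (a i₁ (j i₁))) ((t i₂).realize (a i₂ (j i₂))) :=
    hN.trans _ _ _ _ (hN.symm _ _ _ (h i₁)) h2
  let θ : (treeLang g).Formula ((⋃ j ∈ {j | j ≠ i₁}, rowSet (a j) : Set N) ⊕ Fin (m i₁)) :=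
    relFormula (k i₁) ((t i₁).relabel Sum.inr) ((t i₂).relabel fun y =>
      Sum.inl ⟨a i₂ (j i₂) y, mem_otherRows hne.symm ⟨j i₂, y, rfl⟩⟩)
  have hθ : ∀ l, θ.Realize (Sum.elim (fun e => (e : N)) (a i₁ l)) ↔
      treeRel g (k i₁) ((t i₁).realize (a i₁ l)) ((t i₂).realize (a i₂ (j i₂))) := by
    intro l
    rw [realize_relFormula, Term.realize_relabel, Term.realize_relabel]
    rfl
  have h4 := (hθ (j' i₁)).1 (((ha i₁).realize_iff θ _ _).1 ((hθ _).2 h3))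
  exact h' i₁ (hN.trans _ _ _ _ h2 (hN.symm _ _ _ h4))

/-- In a row whose members no term value of `c` can distinguish, the type of `(c, a i j, b i)` does
not depend on `j`, so `c` realizes the whole row. The hypothesis `hterm` forbids mixing row and
parameters in one term, which is exactly what addition would allow. -/
theorem IsTree.false_of_pattern (hN : IsTree g N) {I : Type} [Infinite I] {n : ℕ} {m l : I → ℕ}
    {φ : ∀ i, (treeLang g).Formula (Fin n ⊕ (Fin (m i) ⊕ Fin (l i)))}
    {a : ∀ i, ℕ → Fin (m i) → N} {b : ∀ i, Fin (l i) → N} {c : Fin n → N}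
    (ha : MutuallyIndiscernible (treeLang g) a)
    (hb : ∀ i t, ∃ j, j ≠ i ∧ b i t ∈ rowSet (a j))
    (hc : ∀ i, (φ i).Realize (Sum.elim c (Sum.elim (a i 0) (b i))))
    (hincon : ∀ i, ¬ Consistent (Set.range fun j => plug (φ i) (Sum.elim (a i j) (b i))))
    (hterm : ∀ i, ∀ t : (treeLang g).Term (Fin (m i) ⊕ Fin (l i)),
      (∃ s : (treeLang g).Term (Fin (m i)), ∀ j,
        t.realize (Sum.elim (a i j) (b i)) = s.realize (a i j)) ∨
      (∃ s : (treeLang g).Term (Fin (l i)), ∀ j,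
        t.realize (Sum.elim (a i j) (b i)) = s.realize (b i))) : False := by
  obtain ⟨i, hi⟩ := hN.exists_row ha (hN.finite_range_realize c)
  refine hincon i ((consistent_range_iff _).2 fun F => ⟨c, fun j _ => ?_⟩)
  rw [realize_plug]
  refine (AtomicEquiv.realize_iff hN hN (fun r r' k _ => ?_) (φ i)).1 (hc i)
  rcases atomic_split r r' with ⟨s, s', hs⟩ | ⟨t, t', ht⟩ | ⟨s, t, hst⟩
  · rw [hs N hN, hs N hN]
  · rw [ht N hN, ht N hN]
    let A : Set N := ⋃ j ∈ {j | j ≠ i}, rowSet (a j)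
    have hbA : ∀ y, b i y ∈ A := fun y => by
      obtain ⟨j, hj, h⟩ := hb i y
      exact mem_otherRows hj h
    let ρ : Fin (m i) ⊕ Fin (l i) → A ⊕ Fin (m i) :=
      Sum.elim Sum.inr fun y => Sum.inl ⟨b i y, hbA y⟩
    have hρ : ∀ j, Sum.elim (fun e : A => (e : N)) (a i j) ∘ ρ = Sum.elim (a i j) (b i) := by
      intro j
      funext y; rcases y with y | y <;> rfl
    have := (ha i).realize_iff (relFormula k (t.relabel ρ) (t'.relabel ρ)) 0 j
    rw [realize_relFormula, realize_relFormula, Term.realize_relabel, Term.realize_relabel,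
      Term.realize_relabel, Term.realize_relabel] at this
    erw [hρ, hρ] at this
    exact this
  · rw [hst N hN, hst N hN]
    rcases hterm i t with ⟨t', ht'⟩ | ⟨t', ht'⟩
    · rw [ht', ht']
      exact ⟨hi _ ⟨s, rfl⟩ t' k 0 j, hi _ ⟨s, rfl⟩ t' k j 0⟩
    · rw [ht', ht']

theorem strong2_treeTheory : Strong2 (treeTheory False) := by
  by_contra h
  obtain ⟨N, n, m, l, φ, a, b, c, h1, h2, h3, h4⟩ := exists_realized_of_not_strong2 h
  refine (isTree_of_model (N := N)).false_of_pattern h1 (fun i t => ?_) h3 h4 (fun i t => ?_)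
  · obtain ⟨j, hj, h⟩ := h2 i t
    exact ⟨j, hj.ne, h⟩
  · rcases term_split_of_not not_false t with ⟨s, hs⟩ | ⟨s, hs⟩
    · exact Or.inl ⟨s, fun j => hs N _ _⟩
    · exact Or.inr ⟨s, fun j => hs N _ _⟩

/-- An inp-pattern gives a pattern without parameters, so `hterm` holds even with addition. -/
theorem strong_treeTheory (g : Prop) : Strong (treeTheory g) := by
  intro M n p
  rw [bdn, CardStar.sup_ofCard_le_belowAleph0_iff]
  intro κ hκ
  by_contra hlt
  have := infinite_ord_toType (not_lt.1 hlt)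
  obtain ⟨N, _, f, m, l, φ, a, b, c, h1, h2, h3, h4⟩ :=
    (hasPatternOn_of_inpPattern hκ).exists_realized
  have : N ⊨ treeTheory g := (f.theory_model_iff _).1 inferInstance
  refine (isTree_of_model (N := N)).false_of_pattern h1 (fun i t => ?_) h3 h4 (fun i t => ?_)
  · obtain ⟨j, hj, h⟩ := h2 i t
    exact hj.elim
  · have hl : ∀ y : Fin (l i), False := fun y => by
      obtain ⟨j, hj, -⟩ := h2 i y
      exact hj
    refine Or.inl ⟨t.relabel (Sum.elim id fun y => (hl y).elim), fun j => ?_⟩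
    rw [Term.realize_relabel]
    congr 1
    funext y
    rcases y with y | y
    · rfl
    · exact (hl y).elim

end Strength


/-! ### The theory with a group structure is not strong² -/

/-- Iterated sums of terms. -/
def sumTerm {g : Prop} (hg : g) {α : Type} : (n : ℕ) → (Fin n → (treeLang g).Term α) →
    (treeLang g).Term α
  | 0, _ => zeroTerm g α
  | n + 1, f => addTerm hg (sumTerm hg n fun t => f t.castSucc) (f (Fin.last n))

/-- Iterated sums of elements. -/
def treeSum {g : Prop} (hg : g) {N : Type} [(treeLang g).Structure N] : (n : ℕ) → (Fin n → N) → N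
  | 0, _ => treeZero g N
  | n + 1, f => treeAdd hg (treeSum hg n fun t => f t.castSucc) (f (Fin.last n))

@[simp] theorem realize_sumTerm {g : Prop} (hg : g) {N : Type} [(treeLang g).Structure N] {α : Type}
    (v : α → N) {n : ℕ} (f : Fin n → (treeLang g).Term α) :
    (sumTerm hg n f).realize v = treeSum hg n fun t => (f t).realize v := by
  induction n with
  | zero => exact realize_zeroTerm v
  | succ n ih => rw [sumTerm, treeSum, realize_addTerm, ih]

theorem treeSum_treeModel {g : Prop} (hg : g) {ι : Type} {n : ℕ} (f : Fin n → TreeModel ι) :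
    treeSum hg n f = ∑ t, f t := by
  induction n with
  | zero => rfl
  | succ n ih => rw [treeSum, treeAdd_treeModel, ih, Fin.sum_univ_castSucc]

theorem treeModel_add_apply {ι : Type} (x y : TreeModel ι) (i : ℕ) : (x + y) i = x i + y i := rfl

theorem treeModel_sum_apply {ι κ : Type} (s : Finset κ) (f : κ → TreeModel ι) (i : ℕ) :
    (∑ t ∈ s, f t) i = ∑ t ∈ s, f t i := Finset.sum_apply (M := fun _ : ℕ => ι →₀ ZMod 2) i s f

/-- The sequence with a single nonzero entry `j` in place `i`. -/
noncomputable def treeUnit (i j : ℕ) : TreeModel ℕ :=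
  fun k => if k = i then Finsupp.single j 1 else 0

theorem treeUnit_self (i j : ℕ) : treeUnit i j i = Finsupp.single j 1 := if_pos rfl

theorem treeUnit_of_ne {i k : ℕ} (h : k ≠ i) (j : ℕ) : treeUnit i j k = 0 := if_neg h

/-- The `i`-th formula says that `x` agrees up to place `i` with `a i j` plus the earlier `a t 0`.
The sum of the earlier terms fixes the places below `i`, while `j` decides place `i`. -/
theorem not_strong2_treeTheory : ¬ Strong2 (treeTheory True) := by
  classical
  intro hstrong
  have hmod : TreeModel ℕ ⊨ treeTheory True := treeModel_model True ℕ
  have : Nonempty (TreeModel ℕ) := ⟨0⟩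
  let M : (treeTheory True).ModelType := Theory.ModelType.of (treeTheory True) (TreeModel ℕ)
  refine (bdn2_le_belowAleph0_iff (p := trivialType (treeLang True) M (Fin 1))).1
    (hstrong M 1 _) ?_
  let a : ∀ _ : ℕ, ℕ → Fin 1 → TreeModel ℕ := fun i j _ => treeUnit i j
  obtain ⟨N, _, f, c, hc, H⟩ := exists_mutuallyIndiscernible (L := treeLang True) a
  have : Nonempty N := Nonempty.map f inferInstance
  let χ : ∀ i : ℕ, (treeLang True).Formula (Fin 1 ⊕ (Fin 1 ⊕ Fin i)) := fun i =>
    relFormula ((i + 1 : ℕ) : WithTop ℕ) (Term.var (Sum.inl 0))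
      (addTerm trivial (Term.var (Sum.inr (Sum.inl 0)))
        (sumTerm trivial i fun t => Term.var (Sum.inr (Sum.inr t))))
  have hχ : ∀ (K : Type) [(treeLang True).Structure K] (i : ℕ) (d : Fin 1 → K) (a : Fin 1 → K)
      (b : Fin i → K), (χ i).Realize (Sum.elim d (Sum.elim a b)) ↔
        treeRel True (i + 1 : ℕ) (d 0) (treeAdd trivial (a 0) (treeSum trivial i b)) := by
    intro K _ i d a b
    simp [χ]
  let χ' : ∀ i j : ℕ, (treeLang True).Formula ((TreeModel ℕ ⊕ Σ _ : ℕ, ℕ × Fin 1) ⊕ Fin 1) :=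
    fun i j => relFormula ((i + 1 : ℕ) : WithTop ℕ) (Term.var (Sum.inr 0))
      (addTerm trivial (Term.var (Sum.inl (Sum.inr ⟨i, j, 0⟩)))
        (sumTerm trivial i fun t => Term.var (Sum.inl (Sum.inr ⟨t, 0, 0⟩))))
  have hχ' : ∀ (K : Type) [(treeLang True).Structure K] (i j : ℕ) (e : TreeModel ℕ → K)
      (u : (Σ _ : ℕ, ℕ × Fin 1) → K) (d : Fin 1 → K),
      (χ' i j).Realize (Sum.elim (Sum.elim e u) d) ↔ treeRel True (i + 1 : ℕ) (d 0)
        (treeAdd trivial (u ⟨i, j, 0⟩) (treeSum trivial i fun t => u ⟨t, 0, 0⟩)) := by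
    intro K _ i j e u d
    simp [χ']
  have hmodel : ∀ (i j : ℕ) (g : ℕ → ℕ → ℕ) (d : Fin 1 → TreeModel ℕ),
      (χ' i j).Realize (Sum.elim (Sum.elim id fun y => a y.1 (g y.1 y.2.1) y.2.2) d) ↔
      ∀ k < i + 1, d 0 k = treeUnit i (g i j) k + ∑ t : Fin i, treeUnit t (g t 0) k := by
    intro i j g d
    rw [hχ', treeRel_treeModel, treeAdd_treeModel, treeSum_treeModel]
    simp only [treeModel_add_apply, treeModel_sum_apply, a]
  let f' : M ↪ₑ[treeLang True] N := f
  refine ⟨N, _, f', fun _ => 1, fun i => i, χ, c, fun i t => c t 0 0, hc,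
    fun i t => ⟨t, t.2, 0, 0, rfl⟩, ?_, fun i => ?_⟩
  · rw [trivialType_over f', Set.empty_union, consistent_range_iff]
    intro F
    obtain ⟨ψ, hψ⟩ := exists_exFormula₁.{0, 0, 0} F fun i => χ' i 0
    have := H ∅ ψ (fun g _ => by
      rw [hψ]
      -- The solution has at place `k` the nonzero entry of the member chosen for place 0 of row
      -- `k`.
      refine ⟨fun _ k => Finsupp.single (g k 0) 1, fun i _ => (hmodel _ _ _ _).2 fun k hk => ?_⟩
      rcases (Nat.lt_succ_iff.1 hk).eq_or_lt with rfl | hk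
      · rw [Finset.sum_eq_zero fun t _ => treeUnit_of_ne t.2.ne' _, add_zero]
        exact (treeUnit_self _ _).symm
      · rw [Finset.sum_eq_single_of_mem (⟨k, hk⟩ : Fin i) (Finset.mem_univ _)
          (fun t _ ht => treeUnit_of_ne (fun h => ht (Fin.ext h.symm)) _), treeUnit_of_ne hk.ne,
          zero_add]
        exact (treeUnit_self _ _).symm)
    rw [hψ] at this
    obtain ⟨d, hd⟩ := this
    refine ⟨d, fun i hi => ?_⟩
    rw [realize_plug, hχ]
    exact (hχ' _ _ _ _ _ _).1 (hd i hi)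
  · rw [not_consistent_range_iff]
    refine ⟨{0, 1}, ?_⟩
    obtain ⟨ψ, hψ⟩ := exists_exFormula₁.{0, 0, 0} {0, 1} (χ' i)
    have := H {(i, 0), (i, 1)} ψ.not (fun g hg => by
      rw [Formula.realize_not, hψ]
      rintro ⟨d, hd⟩
      -- At place `i` the two conditions prescribe different values, since the parameters are the
      -- same in both.
      have h0 := (hmodel _ _ _ _).1 (hd 0 (by simp)) i (Nat.lt_succ_self i)
      have h1 := (hmodel _ _ _ _).1 (hd 1 (by simp)) i (Nat.lt_succ_self i)
      have h2 := add_right_cancel (h0.symm.trans h1)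
      rw [treeUnit_self, treeUnit_self] at h2
      exact hg i 0 1 (by simp) (by simp) (by simp)
        (Finsupp.single_left_injective (one_ne_zero) h2))
    rw [Formula.realize_not, hψ] at this
    rintro ⟨d, hd⟩
    refine this ⟨d, fun j hj => (hχ' _ _ _ _ _ _).2 ?_⟩
    have := hd j hj
    rwa [realize_plug, hχ] at this


/-! ### The theories of refining equivalence relations are not superstable -/

/-- The supremum of an increasing `ω`-sequence of cardinals is smaller than its countable power, by
König's theorem. -/
theorem exists_lt_power_aleph0 (μ₀ : Cardinal.{w}) : ∃ μ, μ₀ ≤ μ ∧ ℵ₀ ≤ μ ∧ μ < μ ^ (ℵ₀ : Cardinal.{w}) := by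
  let f : ℕ → Cardinal.{w} := fun n => Order.succ^[n] (max μ₀ ℵ₀)
  have hf : ∀ n, f n < f (n + 1) := fun n => by
    simp only [f, Function.iterate_succ_apply']
    exact Order.lt_succ _
  let F : ULift.{w} ℕ → Cardinal.{w} := fun n => f n.down
  have hle : ∀ n, F n ≤ Cardinal.sum F := fun n => Cardinal.le_sum F n
  refine ⟨Cardinal.sum F, (le_max_left _ _).trans (hle ⟨0⟩), (le_max_right _ _).trans (hle ⟨0⟩), ?_⟩
  refine (Cardinal.sum_lt_prod F (fun n => F ⟨n.down + 1⟩) fun n => hf n.down).trans_le ?_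
  refine (Cardinal.prod_le_prod _ (fun _ => Cardinal.sum F) fun n => hle _).trans ?_
  rw [Cardinal.prod_const, Cardinal.lift_id, Cardinal.lift_id]
  simp

theorem mk_treeModel_ge (ι : Type) : #ι ^ (ℵ₀ : Cardinal.{0}) ≤ #(TreeModel ι) := by
  rw [← Cardinal.mk_nat, Cardinal.power_def]
  refine Cardinal.mk_le_of_injective (f := fun (x : ℕ → ι) (k : ℕ) => Finsupp.single (x k) 1) ?_
  intro x x' h
  funext k
  exact Finsupp.single_left_injective one_ne_zero (congrFun h k)

/-- The finitely supported sequences form a set of at most `#ι` parameters, over which distinct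
elements of `TreeModel ι` have distinct types. -/
theorem not_superstable_treeTheory (g : Prop) : ¬ Superstable (treeTheory g) := by
  classical
  rintro ⟨μ₀, hμ₀⟩
  obtain ⟨μ, hμ, hinf, hlt⟩ := exists_lt_power_aleph0 μ₀
  induction μ using Cardinal.inductionOn with | _ ι => ?_
  have : Infinite ι := Cardinal.infinite_iff.2 hinf
  have hmod : TreeModel ι ⊨ treeTheory g := treeModel_model g ι
  have : Nonempty (TreeModel ι) := ⟨0⟩
  let A : Set (TreeModel ι) := Set.range fun (h : ℕ →₀ (ι →₀ ZMod 2)) => (h : ℕ → ι →₀ ZMod 2)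
  have hA : #A ≤ #ι := by
    refine Cardinal.mk_range_le.trans ?_
    rw [Cardinal.mk_finsupp_of_infinite, Cardinal.mk_finsupp_of_infinite]
    refine max_le (by simp) (max_le le_rfl (le_trans ?_ hinf))
    exact Cardinal.mk_le_aleph0
  have hcard := hμ₀ #ι hμ (Theory.ModelType.of (treeTheory g) (TreeModel ι)) A hA 1
  refine (hlt.trans_le (mk_treeModel_ge ι)).not_ge (le_trans ?_ hcard)
  have hM : TreeModel ι ⊨ (treeLang g)[[A]].completeTheory (TreeModel ι) := model_completeTheory
  refine Cardinal.mk_le_of_injective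
    (f := fun c => ((treeLang g)[[A]].completeTheory (TreeModel ι)).typeOf (fun _ : Fin 1 => c)) ?_
  intro c c' hcc
  funext k
  -- The truncation of `c` after place `k`; being related to it at level `k + 1` determines the
  -- entry at place `k`.
  let a : A := ⟨fun i => if i ≤ k then c i else 0,
    Finsupp.onFinset (Finset.range (k + 1)) (fun i => if i ≤ k then c i else 0) (fun i hi => by
      by_contra h
      exact hi (if_neg fun h' => h (Finset.mem_range.2 (Nat.lt_succ_of_le h')))), rfl⟩
  let ψ : (treeLang g)[[A]].Formula (Fin 1) := BoundedFormula.constantsVarsEquiv.symm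
    (relFormula ((k + 1 : ℕ) : WithTop ℕ) (Term.var (Sum.inr 0)) (Term.var (Sum.inl a)))
  have hψ : ∀ d : TreeModel ι, ψ.Realize (fun _ => d) ↔ ∀ i < k + 1, d i = a.1 i := by
    intro d
    refine (BoundedFormula.realize_constantsVarsEquiv (L := treeLang g) (α := A)).symm.trans ?_
    rw [Equiv.apply_symm_apply]
    exact realize_relFormula _ _ _ _
  have h1 := (hψ c).2 fun i hi => (if_pos (Nat.le_of_lt_succ hi)).symm
  rw [← Theory.CompleteType.formula_mem_typeOf
    (T := (treeLang g)[[A]].completeTheory (TreeModel ι))] at h1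
  replace hcc : ((treeLang g)[[A]].completeTheory (TreeModel ι)).typeOf (fun _ : Fin 1 => c) =
    ((treeLang g)[[A]].completeTheory (TreeModel ι)).typeOf (fun _ : Fin 1 => c') := hcc
  rw [hcc, Theory.CompleteType.formula_mem_typeOf] at h1
  exact (((hψ c').1 h1 k (Nat.lt_succ_self k)).trans (if_pos le_rfl)).symm

/-! ### Stability -/

/-- Complete types over `A` are traded for realizations in the language without constants, where
quantifier elimination applies; `e` interprets the parameters. -/
theorem exists_realization {L : FirstOrder.Language.{u, v}} {M : Type w} [L.Structure M] [Nonempty M] (A : Set M)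
    {α : Type x} (p : (L[[A]].completeTheory M).CompleteType α) :
    ∃ (N : Type (max u v w x)) (_ : L.Structure N) (e : A → N) (v : α → N),
      (∀ θ : L.Formula A, θ.Realize e ↔ θ.Realize ((↑) : A → M)) ∧
      ∀ ψ : L[[A]].Formula α, Formula.equivSentence ψ ∈ p ↔
        Formula.Realize (BoundedFormula.constantsVarsEquiv ψ : L.Formula (A ⊕ α)) (Sum.elim e v) := by
  obtain ⟨N, v, rfl⟩ := Theory.exists_modelType_is_realized_in _ p
  let _ : L.Structure N := (lhomWithConstants L A).reduct N
  have : (lhomWithConstants L A).IsExpansionOn N := LHom.isExpansionOn_reduct _ _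
  refine ⟨N, inferInstance, fun a => (L.con a : N), v, fun θ => ?_, fun ψ => ?_⟩
  · exact (Formula.realize_equivSentence N θ).symm.trans
      ((realize_iff_of_model_completeTheory M N _).trans (Formula.realize_equivSentence M θ))
  · rw [Theory.CompleteType.formula_mem_typeOf]
    exact BoundedFormula.realize_constantsVarsEquiv.symm

instance (g : Prop) (n : ℕ) : Subsingleton (TreeFn g n) :=
  ⟨fun f f' => by cases f <;> cases f' <;> rfl⟩

instance (g : Prop) : Countable (Σ n, (treeLang g).Functions n) :=
  Function.Injective.countable (f := Sigma.fst) <| by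
    rintro ⟨n, f⟩ ⟨n', f'⟩ (rfl : n = n')
    exact congrArg _ (Subsingleton.elim (α := TreeFn g n) f f')

/-- By quantifier elimination a type is coded by countably much data with at most `𝔠` values each,
and `𝔠 ^ ℵ₀ = 𝔠`. -/
theorem stable_treeTheory (g : Prop) : Stable (treeTheory g) := by
  classical
  refine ⟨𝔠, aleph0_le_continuum, fun M A hA n => ?_⟩
  let T' := (treeLang g)[[A]].completeTheory M
  let TA := (treeLang g).Term A
  let TX := (treeLang g).Term (Fin n)
  choose N hN e v he hv using fun p : T'.CompleteType (Fin n) => exists_realization A p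
  have htree : ∀ p, IsTree g (N p) := fun p => by
    refine (isTree_of_model (g := g) (N := M)).of_elementarilyEquivalent ?_
    refine elementarilyEquivalent_iff.2 fun φ => ?_
    have := he p (φ.relabel Empty.elim)
    rw [Formula.realize_relabel, Formula.realize_relabel] at this
    rw [Subsingleton.elim (e p ∘ Empty.elim) default,
      Subsingleton.elim (Subtype.val ∘ Empty.elim : Empty → M) default] at this
    exact this.symm
  -- For each term in `x` and each level, one related term over `A` suffices: the relations to all
  -- other terms over `A` follow by transitivity, as those among parameters are fixed.
  let D₁ : T'.CompleteType (Fin n) → TX × WithTop ℕ → Option TA := fun p q =>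
    if h : ∃ t : TA, treeRel g q.2 (t.realize (e p)) (q.1.realize (v p)) then some h.choose else none
  let D₂ : T'.CompleteType (Fin n) → Set (TX × TX × WithTop ℕ) := fun p =>
    {q | treeRel g q.2.2 (q.1.realize (v p)) (q.2.1.realize (v p))}
  have hinj : Function.Injective fun p => (D₁ p, D₂ p) := by
    intro p q hpq
    have h1 : D₁ p = D₁ q := congrArg Prod.fst hpq
    have h2 : D₂ p = D₂ q := congrArg Prod.snd hpq
    have hbase : ∀ (s s' : TA) k, treeRel g k (s.realize (e p)) (s'.realize (e p)) ↔
        treeRel g k (s.realize (e q)) (s'.realize (e q)) := by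
      intro s s' k
      rw [← realize_relFormula, ← realize_relFormula, he, he]
    have hsome : ∀ p k (t : TX) (t₀ : TA), D₁ p (t, k) = some t₀ →
        treeRel g k (t₀.realize (e p)) (t.realize (v p)) := by
      intro p k t t₀ h
      simp only [D₁] at h
      split_ifs at h with h'
      obtain rfl := Option.some.inj h
      exact h'.choose_spec
    have hnone : ∀ p k (t : TX), D₁ p (t, k) = none → ∀ s : TA,
        ¬ treeRel g k (s.realize (e p)) (t.realize (v p)) := by
      intro p k t h s hs
      simp only [D₁] at h
      split_ifs at h with h'
      exact h' ⟨s, hs⟩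
    have hat : AtomicEquiv g Set.univ (Sum.elim (e p) (v p)) (Sum.elim (e q) (v q)) := by
      intro r r' k _
      rcases atomic_split r r' with ⟨s, s', hs⟩ | ⟨t, t', ht⟩ | ⟨s, t, hst⟩
      · rw [hs _ (htree p), hs _ (htree q), hbase]
      · rw [ht _ (htree p), ht _ (htree q)]
        exact Set.ext_iff.1 h2 (t, t', k)
      · rw [hst _ (htree p), hst _ (htree q)]
        cases hD : D₁ p (t, k) with
        | none => exact iff_of_false (hnone p k t hD s) (hnone q k t (h1 ▸ hD) s)
        | some t₀ =>
          have hp := hsome p k t t₀ hD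
          have hq := hsome q k t t₀ (h1 ▸ hD)
          have := hbase s t₀ k
          constructor
          · exact fun h => (htree q).trans _ _ _ _ (this.1 ((htree p).trans _ _ _ _ h
              ((htree p).symm _ _ _ hp))) hq
          · exact fun h => (htree p).trans _ _ _ _ (this.2 ((htree q).trans _ _ _ _ h
              ((htree q).symm _ _ _ hq))) hp
    refine SetLike.ext fun φ => ?_
    obtain ⟨ψ, rfl⟩ := Formula.equivSentence.surjective φ
    rw [hv, hv]
    exact hat.realize_iff (htree p) (htree q) _
  refine (Cardinal.mk_le_of_injective hinj).trans ?_
  rw [Cardinal.mk_prod, Cardinal.lift_id, Cardinal.lift_id, ← Cardinal.power_def, Cardinal.mk_set]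
  have hTA : #(Option TA) ≤ 𝔠 := by
    rw [Cardinal.mk_option]
    refine Cardinal.add_le_of_le aleph0_le_continuum ?_ (one_le_aleph0.trans aleph0_le_continuum)
    refine Term.card_le.trans (max_le aleph0_le_continuum ?_)
    rw [Cardinal.mk_sum, Cardinal.lift_id, Cardinal.lift_id]
    exact Cardinal.add_le_of_le aleph0_le_continuum hA
      (Cardinal.mk_le_aleph0.trans aleph0_le_continuum)
  have hX : #(TX × WithTop ℕ) ≤ ℵ₀ := Cardinal.mk_le_aleph0
  refine Cardinal.mul_le_of_le aleph0_le_continuum ?_ ?_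
  · calc #(Option TA) ^ #(TX × WithTop ℕ) ≤ 𝔠 ^ #(TX × WithTop ℕ) :=
          Cardinal.power_le_power_right hTA
      _ ≤ 𝔠 ^ ℵ₀ := Cardinal.power_le_power_left continuum_ne_zero hX
      _ = 𝔠 := continuum_power_aleph0
  · rw [← two_power_aleph0]
    exact Cardinal.power_le_power_left two_ne_zero Cardinal.mk_le_aleph0

end Burden

theorem mainTheorem11 {L : FirstOrder.Language.{u, v}} (T : L.Theory) (hT : T.IsComplete) :
    (∀ (M : T.ModelType.{u, v, max u v}) (X : Type x) (p : Burden.PartialType L M X),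
      Burden.bdn p ≤ Burden.bdn2 p ∧ Burden.bdn2 p ≤ Burden.bdn3 p) ∧
    ((Burden.Strong3 T → Burden.Strong2 T) ∧ (Burden.Strong2 T → Burden.Strong T)) ∧
    (Burden.Strong2 T ↔ Burden.Strong3 T) ∧
    (Burden.Strongly2Dependent T ↔ Burden.NIP T ∧ Burden.Strong2 T) ∧
    (Burden.Supersimple T → Burden.Strong2 T) ∧
    (∃ (L' : FirstOrder.Language.{0, 0}) (T' : L'.Theory), T'.IsComplete ∧
      Burden.Strong2 T' ∧ Burden.Stable T' ∧ ¬ Burden.Superstable T') ∧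
    (∃ (L' : FirstOrder.Language.{0, 0}) (T' : L'.Theory), T'.IsComplete ∧
      Burden.Strong T' ∧ Burden.Stable T' ∧ ¬ Burden.Strong2 T') ∧
    (Burden.NTP2 T ↔
      ∀ (M : T.ModelType.{u, v, max u v}) (n : ℕ) (p : Burden.PartialType L M (Fin n)),
        Burden.bdn3 p < ⊤) := by
  open Burden in
  exact ⟨fun M _ p => ⟨bdn_le_bdn2 p, bdn2_le_bdn3 p⟩,
    ⟨strong2_iff_strong3.2, Strong2.strong⟩, strong2_iff_strong3, strongly2Dependent_iff,
    Supersimple.strong2,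
    ⟨treeLang False, treeTheory False, treeTheory_isComplete False, strong2_treeTheory,
      stable_treeTheory False, not_superstable_treeTheory False⟩,
    ⟨treeLang True, treeTheory True, treeTheory_isComplete True, strong_treeTheory True,
      stable_treeTheory True, not_strong2_treeTheory⟩,
    ntp2_iff⟩
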